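/- Let $X=\{F=0\}\subset\mathbb{P}^3_{\mathbb{C}}$ be a surface of degree six all of whose singular points are ordinary triple points, i.e. for every singular point $P$ of $X$ there are local analytic coordinates $x,y,z$ of $\mathbb{P}^3$ centred at $P$ in which $X$ is given by $x^3+y^3+z^3+\lambda xyz=0$ for some $\lambda\in\mathbb{C}$ with $\lambda^3\neq-27$. Let $\pi\colon\tilde X\to X$ be the blow-up of $X$ in its singular points; $\tilde X$ is a smooth surface. Then: (1) If $D\subset\mathbb{P}^3$ is a curve of degree three (possibly reducible or non-reduced, the degree being the sum of the degrees of its irreducible components counted with multiplicity) all of whose points lie on $X$, then at most six ordinary triple points of $X$ lie on $D$. (2) There is no $(-1)$-curve of degree three on $X$: there is no irreducible curve $C\subset X$ of degree three in $\mathbb{P}^3$ whose strict transform $\tilde C\subset\tilde X$ is a smooth rational curve with self-intersection number $\tilde C^2=-1$. -/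

import Mathlib

open Topology

noncomputable section

namespace TripleSextic

/-- Complex projective three-space. -/
abbrev P3 : Type := Projectivization ℂ (Fin 4 → ℂ)

/-- The complex projective line. -/
abbrev P1 : Type := Projectivization ℂ (Fin 2 → ℂ)

/-! ### Surfaces in projective space and ordinary triple points -/

/-- The surface `{F = 0}` defined by a form `F`. -/
def surface (F : MvPolynomial (Fin 4) ℂ) : Set P3 :=
  {Q | MvPolynomial.eval Q.rep F = 0}

/-- The singular points of the surface `{F = 0}`. -/
def singularLocus (F : MvPolynomial (Fin 4) ℂ) : Set P3 :=
  {Q | MvPolynomial.eval Q.rep F = 0 ∧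
    ∀ i, MvPolynomial.eval Q.rep (MvPolynomial.pderiv i F) = 0}

/-- The affine chart `(x, y, z) ↦ [b₀ + x b₁ + y b₂ + z b₃]` of `ℙ³` attached to a basis `b`
of `ℂ⁴`, as a vector of polynomials in `x, y, z`; its origin is the point `[b₀]`. -/
def affineChart (b : Module.Basis (Fin 4) ℂ (Fin 4 → ℂ)) (i : Fin 4) : MvPolynomial (Fin 3) ℂ :=
  MvPolynomial.C (b 0 i) + ∑ j : Fin 3, MvPolynomial.X j * MvPolynomial.C (b j.succ i)

/-- `P` is an ordinary triple point of `{F = 0}`: there are local analytic coordinates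
`x 0, x 1, x 2` of `ℙ³` centred at `P` in which the surface is given by
`x₀³ + x₁³ + x₂³ + l x₀ x₁ x₂ = 0` with `l³ ≠ -27` (that is, the local equation of the surface in an
affine chart with origin `P` is this function up to a factor `u` without zero at `P`). -/
def IsOrdinaryTriplePoint (F : MvPolynomial (Fin 4) ℂ) (P : P3) : Prop :=
  ∃ b : Module.Basis (Fin 4) ℂ (Fin 4 → ℂ), Projectivization.mk ℂ (b 0) (b.ne_zero 0) = P ∧
  ∃ (l : ℂ) (x : Fin 3 → (Fin 3 → ℂ) → ℂ) (u : (Fin 3 → ℂ) → ℂ),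
    l ^ 3 ≠ -27 ∧
    (∀ j, AnalyticAt ℂ (x j) 0) ∧ (∀ j, x j 0 = 0) ∧
    LinearIndependent ℂ (fun j => fderiv ℂ (x j) 0) ∧
    AnalyticAt ℂ u 0 ∧ u 0 ≠ 0 ∧
    ∀ᶠ v in 𝓝 (0 : Fin 3 → ℂ),
      MvPolynomial.eval v (MvPolynomial.aeval (affineChart b) F) =
        u v * (x 0 v ^ 3 + x 1 v ^ 3 + x 2 v ^ 3 + l * x 0 v * x 1 v * x 2 v)

/-! ### Curves in projective space and their degree -/

/-- The forms of degree `n` that vanish on `V`. -/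
def vanishingForms (V : Set P3) (n : ℕ) :
    Submodule ℂ (MvPolynomial.homogeneousSubmodule (Fin 4) ℂ n) where
  carrier := {G | ∀ Q ∈ V, MvPolynomial.eval Q.rep (G : MvPolynomial (Fin 4) ℂ) = 0}
  add_mem' := by
    intro G H hG hH Q hQ
    simp [hG Q hQ, hH Q hQ]
  zero_mem' := by
    intro Q _
    simp
  smul_mem' := by
    intro c G hG Q hQ
    simp [MvPolynomial.smul_eval, hG Q hQ]

/-- The Hilbert function of `V`: the dimension of the degree `n` part of its homogeneous coordinate
ring. -/
def hilbertFunction (V : Set P3) (n : ℕ) : ℕ :=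
  Module.finrank ℂ (MvPolynomial.homogeneousSubmodule (Fin 4) ℂ n ⧸ vanishingForms V n)

/-- An irreducible (closed, reduced) curve in `ℙ³`, together with its degree: an irreducible
Zariski closed set whose Hilbert polynomial is linear, with leading coefficient `degree`. -/
structure IrreducibleCurve where
  /-- the set of points of the curve -/
  carrier : Set P3
  /-- the degree of the curve -/
  degree : ℕ
  closed : ∀ Q : P3, (∀ (n : ℕ) (G : MvPolynomial (Fin 4) ℂ), G.IsHomogeneous n →
    (∀ R ∈ carrier, MvPolynomial.eval R.rep G = 0) → MvPolynomial.eval Q.rep G = 0) → Q ∈ carrier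
  irreducible : ∀ (m n : ℕ) (G H : MvPolynomial (Fin 4) ℂ), G.IsHomogeneous m → H.IsHomogeneous n →
    (∀ R ∈ carrier, MvPolynomial.eval R.rep (G * H) = 0) →
    (∀ R ∈ carrier, MvPolynomial.eval R.rep G = 0) ∨ (∀ R ∈ carrier, MvPolynomial.eval R.rep H = 0)
  degree_pos : 0 < degree
  hilbert : ∃ k : ℤ, ∀ᶠ n : ℕ in Filter.atTop,
    (hilbertFunction carrier n : ℤ) = (degree : ℤ) * n + k

/-- A (possibly reducible or non-reduced) curve in `ℙ³`: its irreducible components, repeated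
according to their multiplicities. -/
abbrev Curve : Type := Multiset IrreducibleCurve

/-- The degree of a curve: the sum of the degrees of its components, counted with multiplicity. -/
def Curve.degree (D : Curve) : ℕ := (Multiset.map IrreducibleCurve.degree D).sum

/-- The set of points of a curve. -/
def Curve.support (D : Curve) : Set P3 := {Q | ∃ C ∈ D, Q ∈ C.carrier}

/-! ### The blow-up in a finite set of points, strict transforms and normal bundles

Let `S` be a finite set of points of `ℙ³`. A point of the blow-up of `ℙ³` in `S` is a point outside
`S`, or a point `P ∈ S` with a tangent direction at `P`. Every basis `b` of `ℂ⁴` gives a chart of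
the blow-up whose origin is `[b₀]` if `[b₀] ∉ S`, and otherwise `[b₀]` with the direction of the
line from `[b₀]` to `[b₁]`. All points of the blow-up arise as such origins. -/

open Classical in
/-- The chart of the blow-up of `ℙ³` in `S` attached to `b`, composed with the blow-down map
(in homogeneous coordinates). It is the affine chart if `[b₀] ∉ S`, and
`(x, u, v) ↦ [b₀ + x b₁ + x u b₂ + x v b₃]` if `[b₀] ∈ S`; the exceptional divisor is then `x = 0`.
Only its behaviour near the origin is used. -/
def blowUpChart (S : Set P3) (b : Module.Basis (Fin 4) ℂ (Fin 4 → ℂ)) (i : Fin 4) :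
    MvPolynomial (Fin 3) ℂ :=
  if Projectivization.mk ℂ (b 0) (b.ne_zero 0) ∈ S then
    MvPolynomial.C (b 0 i) + MvPolynomial.X 0 * (MvPolynomial.C (b 1 i)
      + MvPolynomial.X 1 * MvPolynomial.C (b 2 i) + MvPolynomial.X 2 * MvPolynomial.C (b 3 i))
  else affineChart b i

/-- `f` is the equation, in the chart attached to `b`, of the strict transform of the surface
`{F = 0}`, which has points of multiplicity three in `S`: the pulled back equation `F`, divided by
the third power of the equation of the exceptional divisor if there is one in the chart. -/
def IsStrictTransformEquation (F : MvPolynomial (Fin 4) ℂ) (S : Set P3)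
    (b : Module.Basis (Fin 4) ℂ (Fin 4 → ℂ)) (f : MvPolynomial (Fin 3) ℂ) : Prop :=
  (Projectivization.mk ℂ (b 0) (b.ne_zero 0) ∈ S →
    MvPolynomial.X 0 ^ 3 * f = MvPolynomial.aeval (blowUpChart S b) F) ∧
  (Projectivization.mk ℂ (b 0) (b.ne_zero 0) ∉ S →
    f = MvPolynomial.aeval (blowUpChart S b) F)

/-- The expansion `G (τ + s τ')` of a binary form `G` as a power series in the local parameter `s`
of the projective line at `[τ]`. -/
def expansion (τ τ' : Fin 2 → ℂ) (G : MvPolynomial (Fin 2) ℂ) : PowerSeries ℂ :=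
  MvPolynomial.aeval
    (fun j => PowerSeries.C (τ j) + PowerSeries.C (τ' j) * (PowerSeries.X : PowerSeries ℂ)) G

/-- Let the binary forms `φ` define a morphism from `ℙ¹` to `ℙ³`. Its lift to the blow-up of `ℙ³` in
`S` maps `[τ]` to the origin of the chart attached to `b`, and the lift is
given in this chart by the power series `γ` in the local parameter `s` at `[τ]`. -/
structure IsLocalLift (S : Set P3) (φ : Fin 4 → MvPolynomial (Fin 2) ℂ) (τ τ' : Fin 2 → ℂ)
    (b : Module.Basis (Fin 4) ℂ (Fin 4 → ℂ)) (γ : Fin 3 → PowerSeries ℂ) : Prop where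
  parameter : LinearIndependent ℂ ![τ, τ']
  centred : ∀ j, PowerSeries.constantCoeff (γ j) = 0
  lifts : ∃ c : (PowerSeries ℂ)ˣ, ∀ i,
    MvPolynomial.aeval γ (blowUpChart S b i) = (c : PowerSeries ℂ) * expansion τ τ' (φ i)

/-- The binary forms `φ` of degree `e` define a morphism from `ℙ¹` onto the curve `C`, whose lift to
the blow-up of `ℙ³` in `S` is an injective immersion, hence a closed embedding. So the lift
identifies `ℙ¹` with the strict transform of `C`, which is a smooth rational curve. -/
structure ParametrizesStrictTransform (S C : Set P3) (e : ℕ)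
    (φ : Fin 4 → MvPolynomial (Fin 2) ℂ) : Prop where
  homogeneous : ∀ i, (φ i).IsHomogeneous e
  base_point_free : ∀ τ : Fin 2 → ℂ, τ ≠ 0 → (fun i => MvPolynomial.eval τ (φ i)) ≠ 0
  image : ∀ Q : P3, Q ∈ C ↔ ∃ (τ : Fin 2 → ℂ) (h : τ ≠ 0),
    Q = Projectivization.mk ℂ (fun i => MvPolynomial.eval τ (φ i)) (base_point_free τ h)
  injective : ∀ (τ₁ τ₂ τ₁' τ₂' : Fin 2 → ℂ) (b : Module.Basis (Fin 4) ℂ (Fin 4 → ℂ))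
    (γ₁ γ₂ : Fin 3 → PowerSeries ℂ), IsLocalLift S φ τ₁ τ₁' b γ₁ → IsLocalLift S φ τ₂ τ₂' b γ₂ →
    ¬ LinearIndependent ℂ ![τ₁, τ₂]
  immersion : ∀ (τ τ' : Fin 2 → ℂ) (b : Module.Basis (Fin 4) ℂ (Fin 4 → ℂ))
    (γ : Fin 3 → PowerSeries ℂ), IsLocalLift S φ τ τ' b γ →
    (fun j => PowerSeries.coeff 1 (γ j)) ≠ 0

/-- Let `φ` parametrize the strict transform of a curve on the surface `{F = 0}`, and let `w` be a
vector of binary forms of degree `m`, regarded as a first order deformation `φ + ε w` of `φ` (up to a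
twist). The image of `w` in the normal bundle `N` of the strict transform of the curve in the strict
transform of the surface has order `k` at `[τ]`.

Near `[τ]`, the bundle `N` is freely generated by a vector field `η` along the lifted curve `γ` that
is tangent to the surface `{f = 0}` and is not tangent to the curve at the centre. The image of `η`
under the differential of the chart is a deformation of `φ`. The last condition says that
`w = (A / B) η` modulo the radial vector `φ` and the vector `dφ/ds` tangent to the curve. -/
def HasNormalOrder (F : MvPolynomial (Fin 4) ℂ) (S : Set P3) (φ w : Fin 4 → MvPolynomial (Fin 2) ℂ)
    (τ : Fin 2 → ℂ) (k : ℤ) : Prop :=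
  ∃ (τ' : Fin 2 → ℂ) (b : Module.Basis (Fin 4) ℂ (Fin 4 → ℂ)) (γ : Fin 3 → PowerSeries ℂ)
    (f : MvPolynomial (Fin 3) ℂ) (η : Fin 3 → PowerSeries ℂ) (A B M N : PowerSeries ℂ),
    IsLocalLift S φ τ τ' b γ ∧
    IsStrictTransformEquation F S b f ∧
    ∑ j, MvPolynomial.aeval γ (MvPolynomial.pderiv j f) * η j = 0 ∧
    LinearIndependent ℂ ![fun j => PowerSeries.constantCoeff (η j),
      fun j => PowerSeries.coeff 1 (γ j)] ∧
    A ≠ 0 ∧ B ≠ 0 ∧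
    (∀ i, B * expansion τ τ' (w i) =
      A * ∑ j, MvPolynomial.aeval γ (MvPolynomial.pderiv j (blowUpChart S b i)) * η j
        + M * expansion τ τ' (φ i) + N * PowerSeries.derivative ℂ (expansion τ τ' (φ i))) ∧
    k = (A.order.toNat : ℤ) - (B.order.toNat : ℤ)

/-- The normal bundle of the strict transform (parametrized by the forms `φ` of degree `e`) of a
curve in the strict transform of the surface `{F = 0}` has degree `n`. This degree is computed from
any meromorphic section: forms `w` of degree `m` give a meromorphic section of the normal bundle
twisted by `𝒪(m - e)`, which has degree `n + (m - e)`. -/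
def HasNormalDegree (F : MvPolynomial (Fin 4) ℂ) (S : Set P3) (e : ℕ)
    (φ : Fin 4 → MvPolynomial (Fin 2) ℂ) (n : ℤ) : Prop :=
  ∃ (m : ℕ) (w : Fin 4 → MvPolynomial (Fin 2) ℂ) (o : P1 →₀ ℤ),
    (∀ i, (w i).IsHomogeneous m) ∧
    (∀ p : P1, HasNormalOrder F S φ w p.rep (o p)) ∧
    o.sum (fun _ k => k) = n + ((m : ℤ) - (e : ℤ))

/-- `C` is a `(-1)`-curve on the surface `X = {F = 0}`, whose only singularities are ordinary triple
points: its strict transform on the blow-up of `X` in its singular points is a smooth rational curve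
of self-intersection `-1`. The self-intersection number of a smooth curve on a smooth surface
is the degree of its normal bundle. -/
def IsMinusOneCurve (F : MvPolynomial (Fin 4) ℂ) (C : Set P3) : Prop :=
  C ⊆ surface F ∧ ∃ (e : ℕ) (φ : Fin 4 → MvPolynomial (Fin 2) ℂ),
    ParametrizesStrictTransform (singularLocus F) C e φ ∧
    HasNormalDegree F (singularLocus F) e φ (-1)

end TripleSextic

end

/-!
# Triple points of sextic surfaces on cubic curves

At an ordinary triple point `P` all second derivatives of the equation `F` vanish, and the tangent
cone is a smooth plane cubic (`isTripleVector_of_analytic`). Consequently every first derivative of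
`F`, a form of degree five, is singular at all triple points of the surface. The proofs of both
assertions compare the number of zeros of such forms on a curve with Bézout's bound.

*Bézout's theorem.* If a form `G` of degree `g` does not vanish on an irreducible curve of degree
`d`, then at most `d g` points of the curve are zeros of `G`, and zeros at which `G` vanishes to order
two along a tangent direction count twice (`IrreducibleCurve.two_mul_card_le`). This follows from the
Hilbert function: the values of forms of large degree, and their derivatives in tangent directions,
at these points are independent functionals that kill the forms vanishing on the curve and the
multiples of `G`, and modulo these forms there remains a space of dimension `d g`. A tangent vector
exists at every point of the curve, since otherwise the point would be isolated
(`IrreducibleCurve.exists_tangentVector`).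

*Polars.* For a smooth point `P` of the surface on the curve `C`, the polar `D_P F` is singular at the
triple points, and by Euler's identity it touches `C` at `P`. If `C` contains too many triple points,
then `D_P F` therefore vanishes on `C` for every `P ∈ C`. So every tangent plane of the surface along
`C` contains `C`. As the surface is not singular along `C`, the curve lies in a plane, which is
tangent to the surface along `C` unless `C` is a line. The plane section of the surface then has the
equation `c² h`, where `c` is the equation of `C` in the plane (`exists_isDoublePlaneSection`).

*Cubics.* For an irreducible cubic, `h` is a constant and the vanishing second derivatives of `c²` at
the triple points show that the first derivatives of `c`, which are quadratic forms, vanish there.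
Another application of Bézout's theorem shows that they vanish on `C`, which is impossible. This is
`false_of_cubic`, where the two applications of Bézout's theorem are kept as hypotheses.

*At most six triple points.* An irreducible cubic with seven triple points satisfies these hypotheses,
because `2 · 7 + 2 > 3 · 5` and `7 > 3 · 2`. A line contains at most two triple points and a conic at
most five, which leaves only the case of a conic with five triple points and a line with two more. In
this case the polars and Bézout's theorem show that the plane section is three times the conic, so
that the line meets the plane in a point of the conic, which is necessarily a third triple point on
the line (`exists_triple_on_conic_inter_line`).

*No `(-1)`-curves.* Let the strict transform of a cubic `C` be a smooth rational curve with
`C̃² = -1`, parametrized by binary forms `φ` of degree `e`. Along the curve both the gradient of `F` and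
the cross product of the two partial derivatives of `φ` with a deformation `w` of `φ` are normal to
the surface. The orders of their quotient are given by the order of `w` as a section of the normal
bundle and by the order of contact with the exceptional divisor (`exists_normalForm_eq`); comparison
of degrees gives the total contact `2 e + 1` (`HasNormalDegree.exists_contact`). A form through the
triple points pulls back to a binary form with at least `2 e + 1` zeros, and with at least
`2 (2 e + 1)` zeros if it is singular at the triple points. Since `e ≤ 3`, as a general plane section
shows (`ParametrizesStrictTransform.le_degree`), one has `2 (2 e + 1) + 2 > 5 e`, and also
`2 e + 1 > 2 e`, so that the hypotheses of `false_of_cubic` hold again.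
-/

open MvPolynomial
open scoped Topology

noncomputable section

namespace TripleSextic

/-! ### Directional derivatives and forms at points of projective space -/

section DirectionalDerivative

variable {σ : Type*}

/-- The derivative of polynomials in the direction of the constant vector `w`. -/
def dirDeriv (w : σ → ℂ) : Derivation ℂ (MvPolynomial σ ℂ) (MvPolynomial σ ℂ) :=
  mkDerivation ℂ fun i => C (w i)

theorem dirDeriv_X (w : σ → ℂ) (i : σ) : dirDeriv w (X i) = C (w i) := by
  simp [dirDeriv]

theorem aeval_mul_of_isHomogeneous {B : Type*} [CommRing B] [Algebra ℂ B]
    {G : MvPolynomial σ ℂ} {n : ℕ} (hG : G.IsHomogeneous n) (c : B) (x : σ → B) :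
    aeval (fun i => c * x i) G = c ^ n * aeval x G := by
  simp only [aeval_def, eval₂_eq, Finset.mul_sum]
  refine Finset.sum_congr rfl fun m hm => ?_
  have hdeg : ∑ i ∈ m.support, m i = n := by
    have := hG (mem_support_iff.mp hm)
    simpa [Finsupp.weight_apply, Finsupp.sum] using this
  simp only [mul_pow, Finset.prod_mul_distrib, Finset.prod_pow_eq_pow_sum, hdeg]
  ring

theorem eval_smul_of_isHomogeneous {G : MvPolynomial σ ℂ} {n : ℕ} (hG : G.IsHomogeneous n)
    (a : ℂ) (p : σ → ℂ) : eval (a • p) G = a ^ n * eval p G := by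
  have := aeval_mul_of_isHomogeneous hG a p
  simpa [aeval_eq_eval, Pi.smul_def] using this

theorem dirDeriv_comm (v w : σ → ℂ) (G : MvPolynomial σ ℂ) :
    dirDeriv v (dirDeriv w G) = dirDeriv w (dirDeriv v G) := by
  have h : ⁅dirDeriv v, dirDeriv w⁆ = 0 := by
    apply derivation_ext
    intro j
    simp [Derivation.commutator_apply, dirDeriv_X]
  have h2 := congrArg (fun d => d G) h
  simpa [Derivation.commutator_apply, sub_eq_zero] using h2

variable [Fintype σ]

/-- The chain rule for a derivation applied to a polynomial expression. -/
theorem derivation_aeval {B : Type*} [CommRing B] [Algebra ℂ B] (d : Derivation ℂ B B)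
    (x : σ → B) (G : MvPolynomial σ ℂ) :
    d (aeval x G) = ∑ i, aeval x (pderiv i G) * d (x i) := by
  classical
  induction G using MvPolynomial.induction_on with
  | C a => simp
  | add p q hp hq => simp [hp, hq, add_mul, Finset.sum_add_distrib]
  | mul_X p i hp =>
    simp only [map_mul, aeval_X, Derivation.leibniz, hp, smul_eq_mul, map_add, add_mul,
      Finset.sum_add_distrib, pderiv_X, Finset.mul_sum]
    congr 1
    · rw [Finset.sum_eq_single i]
      · simp
      · intro j _ hj
        simp [hj]
      · simp
    · exact Finset.sum_congr rfl fun j _ => by ring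

theorem dirDeriv_eq_sum (w : σ → ℂ) (G : MvPolynomial σ ℂ) :
    dirDeriv w G = ∑ i, C (w i) * pderiv i G := by
  have h := derivation_aeval (dirDeriv w) X G
  simp only [aeval_X_left_apply, dirDeriv_X] at h
  rw [h]
  exact Finset.sum_congr rfl fun i _ => mul_comm _ _

theorem eval_dirDeriv (p w : σ → ℂ) (G : MvPolynomial σ ℂ) :
    eval p (dirDeriv w G) = ∑ i, w i * eval p (pderiv i G) := by
  simp [dirDeriv_eq_sum]

theorem dirDeriv_add_left (v w : σ → ℂ) (G : MvPolynomial σ ℂ) :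
    dirDeriv (v + w) G = dirDeriv v G + dirDeriv w G := by
  simp [dirDeriv_eq_sum, add_mul, Finset.sum_add_distrib]

theorem dirDeriv_smul_left (a : ℂ) (w : σ → ℂ) (G : MvPolynomial σ ℂ) :
    dirDeriv (a • w) G = C a * dirDeriv w G := by
  simp [dirDeriv_eq_sum, Finset.mul_sum, mul_assoc]

theorem dirDeriv_single [DecidableEq σ] (i : σ) (G : MvPolynomial σ ℂ) :
    dirDeriv (Pi.single i 1) G = pderiv i G := by
  rw [dirDeriv_eq_sum, Finset.sum_eq_single i]
  · simp
  · intro j _ hj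
    simp [hj]
  · simp

theorem isHomogeneous_dirDeriv {G : MvPolynomial σ ℂ} {n : ℕ} (hG : G.IsHomogeneous n)
    (w : σ → ℂ) : (dirDeriv w G).IsHomogeneous (n - 1) := by
  rw [dirDeriv_eq_sum]
  refine IsHomogeneous.sum _ _ _ fun i _ => ?_
  exact hG.pderiv.C_mul _

/-- Euler's identity. -/
theorem eval_dirDeriv_self {G : MvPolynomial σ ℂ} {n : ℕ} (hG : G.IsHomogeneous n)
    (p : σ → ℂ) : eval p (dirDeriv p G) = n * eval p G := by
  have h := congrArg (eval p) hG.sum_X_mul_pderiv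
  rw [eval_dirDeriv]
  simpa using h

/-- The polar of `G` with respect to `p` touches `G` at `p`. -/
theorem eval_dirDeriv_polar {G : MvPolynomial σ ℂ} {n : ℕ} (hG : G.IsHomogeneous n)
    (p w : σ → ℂ) :
    eval p (dirDeriv w (dirDeriv p G)) = ((n - 1 : ℕ) : ℂ) * eval p (dirDeriv w G) := by
  rw [dirDeriv_comm, eval_dirDeriv_self (isHomogeneous_dirDeriv hG w)]

theorem aeval_dirDeriv {B : Type*} [CommRing B] [Algebra ℂ B] (x : σ → B) (w : σ → ℂ)
    (G : MvPolynomial σ ℂ) :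
    aeval x (dirDeriv w G) = ∑ i, algebraMap ℂ B (w i) * aeval x (pderiv i G) := by
  simp [dirDeriv_eq_sum]

/-- The first order Taylor expansion of `G` at `p`, modulo `x ^ 2`. -/
theorem sq_dvd_aeval_sub {B : Type*} [CommRing B] [Algebra ℂ B] (p : σ → ℂ) (x : B) (y : σ → B)
    (G : MvPolynomial σ ℂ) :
    x ^ 2 ∣ aeval (fun i => algebraMap ℂ B (p i) + x * y i) G -
      (algebraMap ℂ B (eval p G) + x * ∑ i, algebraMap ℂ B (eval p (pderiv i G)) * y i) := by
  classical
  induction G using MvPolynomial.induction_on with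
  | C a => simp
  | add P Q hP hQ =>
    have := dvd_add hP hQ
    convert this using 1
    simp only [map_add, add_mul, Finset.sum_add_distrib]
    ring
  | mul_X P i hP =>
    obtain ⟨r, hr⟩ := hP
    rw [sub_eq_iff_eq_add] at hr
    simp only [map_mul, aeval_X, hr, eval_X, Derivation.leibniz, smul_eq_mul, map_add, pderiv_X]
    have hs : ∑ j, (algebraMap ℂ B (eval p P) *
          algebraMap ℂ B (eval p (Pi.single (M := fun _ => MvPolynomial σ ℂ) j 1 i)) +
          algebraMap ℂ B (p i) * algebraMap ℂ B (eval p (pderiv j P))) * y j =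
        algebraMap ℂ B (eval p P) * y i +
          algebraMap ℂ B (p i) * ∑ j, algebraMap ℂ B (eval p (pderiv j P)) * y j := by
      simp only [add_mul, Finset.sum_add_distrib, Finset.mul_sum]
      congr 1
      · rw [Finset.sum_eq_single i]
        · simp
        · intro j _ hj
          simp [Ne.symm hj]
        · simp
      · exact Finset.sum_congr rfl fun j _ => by ring
    rw [hs]
    refine ⟨r * (algebraMap ℂ B (p i) + x * y i) +
      (∑ j, algebraMap ℂ B (eval p (pderiv j P)) * y j) * y i, ?_⟩
    ring

theorem dvd_aeval_of_eval_eq_zero {B : Type*} [CommRing B] [Algebra ℂ B] {p : σ → ℂ} (x : B)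
    (y : σ → B) {G : MvPolynomial σ ℂ} (hG : eval p G = 0) :
    x ∣ aeval (fun i => algebraMap ℂ B (p i) + x * y i) G := by
  obtain ⟨r, hr⟩ := sq_dvd_aeval_sub p x y G
  rw [sub_eq_iff_eq_add] at hr
  rw [hr, hG, map_zero, zero_add]
  exact dvd_add ((dvd_pow_self x two_ne_zero).mul_right r) (dvd_mul_right x _)

theorem sq_dvd_aeval_of_eval_eq_zero {B : Type*} [CommRing B] [Algebra ℂ B] {p : σ → ℂ} (x : B)
    (y : σ → B) {G : MvPolynomial σ ℂ} (hG : eval p G = 0)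
    (hG' : ∀ i, eval p (pderiv i G) = 0) :
    x ^ 2 ∣ aeval (fun i => algebraMap ℂ B (p i) + x * y i) G := by
  simpa [hG, hG'] using sq_dvd_aeval_sub p x y G

theorem exists_rep_mk_eq_smul {n : ℕ} (v : Fin n → ℂ) (hv : v ≠ 0) :
    ∃ a : ℂ, a ≠ 0 ∧ (Projectivization.mk ℂ v hv).rep = a • v := by
  obtain ⟨a, ha⟩ := Projectivization.exists_smul_eq_mk_rep ℂ v hv
  exact ⟨a, a.ne_zero, ha.symm⟩

theorem eval_rep_mk_eq_zero_iff {n m : ℕ} {G : MvPolynomial (Fin n) ℂ} (hG : G.IsHomogeneous m)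
    (v : Fin n → ℂ) (hv : v ≠ 0) :
    eval (Projectivization.mk ℂ v hv).rep G = 0 ↔ eval v G = 0 := by
  obtain ⟨a, ha, h⟩ := exists_rep_mk_eq_smul v hv
  rw [h, eval_smul_of_isHomogeneous hG]
  simp [ha]

theorem mk_mem_singularLocus_iff {F : MvPolynomial (Fin 4) ℂ} {n : ℕ} (hF : F.IsHomogeneous n)
    (v : Fin 4 → ℂ) (hv : v ≠ 0) :
    Projectivization.mk ℂ v hv ∈ singularLocus F ↔
      eval v F = 0 ∧ ∀ i, eval v (pderiv i F) = 0 := by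
  simp only [singularLocus, Set.mem_ofPred_eq, eval_rep_mk_eq_zero_iff hF,
    eval_rep_mk_eq_zero_iff hF.pderiv]

theorem eval_dirDeriv_eq_zero_of_pderiv {G : MvPolynomial σ ℂ} {p : σ → ℂ}
    (h : ∀ i, eval p (pderiv i G) = 0) (w : σ → ℂ) : eval p (dirDeriv w G) = 0 := by
  simp [eval_dirDeriv, h]

end DirectionalDerivative

/-! ### Ordinary triple points -/

/-- The cubic form of an ordinary triple point. -/
def hesseCubic (l : ℂ) (x : Fin 3 → ℂ) : ℂ := x 0 ^ 3 + x 1 ^ 3 + x 2 ^ 3 + l * x 0 * x 1 * x 2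

theorem eq_zero_of_hesse_gradient {l a b c : ℂ} (hl : l ^ 3 ≠ -27) (h₁ : 3 * a ^ 2 + l * b * c = 0)
    (h₂ : 3 * b ^ 2 + l * a * c = 0) (h₃ : 3 * c ^ 2 + l * a * b = 0) : a = 0 ∧ b = 0 ∧ c = 0 := by
  have hm : (l ^ 3 + 27) * (a * b * c) ^ 2 = 0 := by
    linear_combination (9 * b ^ 2 * c ^ 2) * h₁ - 3 * c ^ 2 * (l * b * c) * h₂ +
      (l * b * c) * (l * a * c) * h₃
  have hm' : a * b * c = 0 := by
    rcases mul_eq_zero.mp hm with h | h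
    · exact absurd (eq_neg_of_add_eq_zero_left h) hl
    · exact pow_eq_zero_iff two_ne_zero |>.mp h
  refine ⟨?_, ?_, ?_⟩ <;> refine pow_eq_zero_iff (n := 3) (by norm_num) |>.mp ?_
  · linear_combination (a / 3) * h₁ - l / 3 * hm'
  · linear_combination (b / 3) * h₂ - l / 3 * hm'
  · linear_combination (c / 3) * h₃ - l / 3 * hm'

/-- Comparison of the leading term of a polynomial at the origin with a limit. -/
theorem coeff_of_tendsto (n : ℕ) (q : Polynomial ℂ) (L : ℂ)
    (h : Filter.Tendsto (fun t : ℂ => t⁻¹ ^ n * q.eval t) (𝓝[≠] 0) (𝓝 L)) :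
    (∀ k < n, q.coeff k = 0) ∧ q.coeff n = L := by
  induction n generalizing q with
  | zero =>
    refine ⟨by simp, ?_⟩
    have h2 : Filter.Tendsto (fun t : ℂ => q.eval t) (𝓝[≠] 0) (𝓝 (q.eval 0)) :=
      (q.continuous.tendsto 0).mono_left nhdsWithin_le_nhds
    rw [Polynomial.coeff_zero_eq_eval_zero]
    exact tendsto_nhds_unique h2 (by simpa using h)
  | succ n ih =>
    have h0 : q.coeff 0 = 0 := by
      have h1 : Filter.Tendsto (fun t : ℂ => t ^ (n + 1)) (𝓝[≠] 0) (𝓝 (0 ^ (n + 1))) :=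
        ((continuous_pow (n + 1)).tendsto 0).mono_left nhdsWithin_le_nhds
      have h2 := h1.mul h
      have h3 : Filter.Tendsto (fun t : ℂ => q.eval t) (𝓝[≠] 0) (𝓝 (q.eval 0)) :=
        (q.continuous.tendsto 0).mono_left nhdsWithin_le_nhds
      rw [Polynomial.coeff_zero_eq_eval_zero]
      have h4 : Filter.Tendsto (fun t : ℂ => q.eval t) (𝓝[≠] 0) (𝓝 (0 ^ (n + 1) * L)) := by
        refine h2.congr' ?_
        filter_upwards [self_mem_nhdsWithin] with t ht
        have ht' : t ≠ 0 := ht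
        rw [← mul_assoc, ← mul_pow, mul_inv_cancel₀ ht', one_pow, one_mul]
      simpa using tendsto_nhds_unique h3 h4
    have hq : q = Polynomial.X * q.divX := by
      conv_lhs => rw [← Polynomial.divX_mul_X_add q, h0]
      simp [mul_comm]
    have := ih q.divX (by
      refine h.congr' ?_
      filter_upwards [self_mem_nhdsWithin] with t ht
      have ht' : t ≠ 0 := ht
      conv_lhs => rw [hq]
      rw [Polynomial.eval_mul, Polynomial.eval_X, pow_succ]
      field_simp)
    refine ⟨fun k hk => ?_, by simpa using this.2⟩
    rcases k with _ | k
    · exact h0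
    · simpa using this.1 k (by omega)

/-- The restriction of `F` to the parametrized line `t ↦ p + t w`. -/
def lineRestriction (F : MvPolynomial (Fin 4) ℂ) (p w : Fin 4 → ℂ) : Polynomial ℂ :=
  aeval (fun i => Polynomial.C (p i) + Polynomial.X * Polynomial.C (w i)) F

theorem eval_lineRestriction (F : MvPolynomial (Fin 4) ℂ) (p w : Fin 4 → ℂ) (t : ℂ) :
    (lineRestriction F p w).eval t = eval (p + t • w) F := by
  have h := MvPolynomial.map_aeval
    (fun i => Polynomial.C (p i) + Polynomial.X * Polynomial.C (w i)) (Polynomial.evalRingHom t) F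
  rw [Polynomial.coe_evalRingHom] at h
  rw [lineRestriction, h, MvPolynomial.eval, MvPolynomial.coe_eval₂Hom, MvPolynomial.coe_eval₂Hom]
  congr 1
  · ext; simp
  · ext i
    rw [Polynomial.eval_add, Polynomial.eval_mul, Polynomial.eval_C, Polynomial.eval_C,
      Polynomial.eval_X]
    rfl

theorem derivative_lineRestriction (F : MvPolynomial (Fin 4) ℂ) (p w : Fin 4 → ℂ) :
    Polynomial.derivative (lineRestriction F p w) = lineRestriction (dirDeriv w F) p w := by
  have h := derivation_aeval (Polynomial.derivative' (R := ℂ))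
    (fun i => Polynomial.C (p i) + Polynomial.X * Polynomial.C (w i)) F
  simp only [Polynomial.derivative'_apply] at h
  rw [lineRestriction, h, lineRestriction, aeval_dirDeriv]
  refine Finset.sum_congr rfl fun i _ => ?_
  rw [mul_comm]
  simp

theorem hasDerivAt_lineRestriction (F : MvPolynomial (Fin 4) ℂ) (p w : Fin 4 → ℂ) :
    HasDerivAt (fun t : ℂ => eval (p + t • w) F) (eval p (dirDeriv w F)) 0 := by
  have h := (lineRestriction F p w).hasDerivAt 0
  rw [derivative_lineRestriction] at h
  simpa [eval_lineRestriction] using h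

/-- The point `b₀ + v₀ b₁ + v₁ b₂ + v₂ b₃` of the affine chart attached to `b`. -/
def chartPoint (b : Module.Basis (Fin 4) ℂ (Fin 4 → ℂ)) (v : Fin 3 → ℂ) : Fin 4 → ℂ :=
  b 0 + ∑ j : Fin 3, v j • b j.succ

theorem eval_aeval_affineChart (F : MvPolynomial (Fin 4) ℂ)
    (b : Module.Basis (Fin 4) ℂ (Fin 4 → ℂ)) (v : Fin 3 → ℂ) :
    eval v (aeval (affineChart b) F) = eval (chartPoint b v) F := by
  have h := MvPolynomial.map_aeval (affineChart b) (eval v) F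
  rw [h, MvPolynomial.eval, MvPolynomial.coe_eval₂Hom]
  congr 1
  · ext; simp
  · ext i; simp [affineChart, chartPoint]

/-- The algebraic content of an ordinary triple point at the vector `p`: the derivatives up to
order two vanish, and the tangent cone, given by the third derivatives, is singular only along the
line spanned by `p`. -/
structure IsTripleVector (F : MvPolynomial (Fin 4) ℂ) (p : Fin 4 → ℂ) : Prop where
  second : ∀ w z, eval p (dirDeriv w (dirDeriv z F)) = 0
  cone : ∀ w, (∀ z, eval p (dirDeriv w (dirDeriv w (dirDeriv z F))) = 0) → ∃ a : ℂ, w = a • p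

theorem tendsto_hesse {x : Fin 3 → (Fin 3 → ℂ) → ℂ} {u : (Fin 3 → ℂ) → ℂ} {l : ℂ}
    (hx : ∀ j, AnalyticAt ℂ (x j) 0) (hx0 : ∀ j, x j 0 = 0) (hu : AnalyticAt ℂ u 0)
    (v : Fin 3 → ℂ) :
    Filter.Tendsto (fun t : ℂ => t⁻¹ ^ 3 * (u (t • v) * hesseCubic l (fun j => x j (t • v))))
      (𝓝[≠] 0) (𝓝 (u 0 * hesseCubic l (fun j => fderiv ℂ (x j) 0 v))) := by
  have h1 : ∀ j, Filter.Tendsto (fun t : ℂ => t⁻¹ * x j (t • v)) (𝓝[≠] 0)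
      (𝓝 (fderiv ℂ (x j) 0 v)) := by
    intro j
    have hd : HasDerivAt (fun t : ℂ => x j (t • v)) (fderiv ℂ (x j) 0 v) 0 := by
      have h2 : HasFDerivAt (x j) (fderiv ℂ (x j) 0) ((0 : ℂ) • v) := by
        simpa using (hx j).differentiableAt.hasFDerivAt
      have h3 : HasDerivAt (fun t : ℂ => t • v) v 0 := by
        simpa using (hasDerivAt_id (0 : ℂ)).smul_const v
      exact h2.comp_hasDerivAt 0 h3
    have := hasDerivAt_iff_tendsto_slope_zero.mp hd
    simpa [hx0] using this
  have h2 : Filter.Tendsto (fun t : ℂ => u (t • v)) (𝓝[≠] 0) (𝓝 (u 0)) := by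
    have h3 : Filter.Tendsto (fun t : ℂ => t • v) (𝓝[≠] 0) (𝓝 0) := by
      have : Continuous (fun t : ℂ => t • v) := by fun_prop
      simpa using (this.tendsto 0).mono_left nhdsWithin_le_nhds
    exact hu.continuousAt.tendsto.comp h3
  have h3 := h2.mul (((((h1 0).pow 3).add ((h1 1).pow 3)).add ((h1 2).pow 3)).add
    (((h1 0).const_mul l |>.mul (h1 1)).mul (h1 2)))
  refine h3.congr fun t => ?_
  simp only [hesseCubic]
  ring

/-- The tangent vector `v₀ b₁ + v₁ b₂ + v₂ b₃` of the affine chart attached to `b`. -/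
def chartVector (b : Module.Basis (Fin 4) ℂ (Fin 4 → ℂ)) (v : Fin 3 → ℂ) : Fin 4 → ℂ :=
  ∑ j : Fin 3, v j • b j.succ

theorem chartVector_add_smul (b : Module.Basis (Fin 4) ℂ (Fin 4 → ℂ)) (v y : Fin 3 → ℂ) (s : ℂ) :
    chartVector b (v + s • y) = chartVector b v + s • chartVector b y := by
  simp [chartVector, add_smul, Finset.sum_add_distrib, Finset.smul_sum, mul_smul]

theorem chartPoint_add_smul (b : Module.Basis (Fin 4) ℂ (Fin 4 → ℂ)) (v y : Fin 3 → ℂ) (s : ℂ) :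
    chartPoint b (v + s • y) = chartPoint b v + s • chartVector b y := by
  simp only [chartPoint, chartVector, Pi.add_apply, Pi.smul_apply, add_smul,
    Finset.sum_add_distrib, Finset.smul_sum, smul_eq_mul, mul_smul, add_assoc]

theorem exists_eq_smul_add_chartVector (b : Module.Basis (Fin 4) ℂ (Fin 4 → ℂ)) (w : Fin 4 → ℂ) :
    w = b.repr w 0 • b 0 + chartVector b (fun j => b.repr w j.succ) := by
  conv_lhs => rw [← b.sum_repr w, Fin.sum_univ_succ]
  rfl

theorem coeff_lineRestriction_two (F : MvPolynomial (Fin 4) ℂ) (p w : Fin 4 → ℂ) :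
    eval p (dirDeriv w (dirDeriv w F)) = 2 * (lineRestriction F p w).coeff 2 := by
  have h : (lineRestriction (dirDeriv w (dirDeriv w F)) p w).eval 0 =
      eval p (dirDeriv w (dirDeriv w F)) := by simp [eval_lineRestriction]
  rw [← h, ← derivative_lineRestriction, ← derivative_lineRestriction,
    ← Polynomial.coeff_zero_eq_eval_zero]
  simp only [Polynomial.coeff_derivative]
  push_cast
  ring

theorem coeff_lineRestriction_three (F : MvPolynomial (Fin 4) ℂ) (p w : Fin 4 → ℂ) :
    eval p (dirDeriv w (dirDeriv w (dirDeriv w F))) = 6 * (lineRestriction F p w).coeff 3 := by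
  rw [coeff_lineRestriction_two, ← derivative_lineRestriction, Polynomial.coeff_derivative]
  push_cast
  ring

theorem coeff_lineRestriction_one (F : MvPolynomial (Fin 4) ℂ) (p w : Fin 4 → ℂ) :
    eval p (dirDeriv w F) = (lineRestriction F p w).coeff 1 := by
  have h : (lineRestriction (dirDeriv w F) p w).eval 0 = eval p (dirDeriv w F) := by
    simp [eval_lineRestriction]
  rw [← h, ← derivative_lineRestriction, ← Polynomial.coeff_zero_eq_eval_zero]
  simp [Polynomial.coeff_derivative]

theorem coeff_lineRestriction_zero (F : MvPolynomial (Fin 4) ℂ) (p w : Fin 4 → ℂ) :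
    eval p F = (lineRestriction F p w).coeff 0 := by
  simp [Polynomial.coeff_zero_eq_eval_zero, eval_lineRestriction]

theorem eval_dirDeriv_cube (F : MvPolynomial (Fin 4) ℂ) (p w z : Fin 4 → ℂ) (s : ℂ) :
    eval p (dirDeriv (w + s • z) (dirDeriv (w + s • z) (dirDeriv (w + s • z) F))) =
      eval p (dirDeriv w (dirDeriv w (dirDeriv w F))) +
      3 * s * eval p (dirDeriv w (dirDeriv w (dirDeriv z F))) +
      3 * s ^ 2 * eval p (dirDeriv w (dirDeriv z (dirDeriv z F))) +
      s ^ 3 * eval p (dirDeriv z (dirDeriv z (dirDeriv z F))) := by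
  simp only [dirDeriv_add_left, dirDeriv_smul_left, map_add, Derivation.leibniz, derivation_C,
    smul_eq_mul, mul_zero, add_zero, map_mul, eval_C, dirDeriv_comm z w]
  ring

theorem eval_dirDeriv_square (F : MvPolynomial (Fin 4) ℂ) (p w z : Fin 4 → ℂ) :
    eval p (dirDeriv (w + z) (dirDeriv (w + z) F)) =
      eval p (dirDeriv w (dirDeriv w F)) + 2 * eval p (dirDeriv w (dirDeriv z F)) +
      eval p (dirDeriv z (dirDeriv z F)) := by
  simp only [dirDeriv_add_left, map_add, dirDeriv_comm z w]
  ring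

theorem bijective_of_linearIndependent {x : Fin 3 → (Fin 3 → ℂ) →L[ℂ] ℂ}
    (hx : LinearIndependent ℂ x) : Function.Bijective (ContinuousLinearMap.pi x) := by
  have hfin : Module.finrank ℂ ((Fin 3 → ℂ) →L[ℂ] ℂ) = 3 := by
    rw [← (LinearMap.toContinuousLinearMap (𝕜 := ℂ) (E := Fin 3 → ℂ) (F' := ℂ)).finrank_eq]
    simp
  have hspan := hx.span_eq_top_of_card_eq_finrank (by simp [hfin])
  have hinj : Function.Injective (ContinuousLinearMap.pi x : (Fin 3 → ℂ) →ₗ[ℂ] (Fin 3 → ℂ)) := by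
    rw [← LinearMap.ker_eq_bot, LinearMap.ker_eq_bot']
    intro v hv
    have hv' : ∀ j, x j v = 0 := fun j => congrFun hv j
    have h : ∀ g : (Fin 3 → ℂ) →L[ℂ] ℂ, g v = 0 := by
      intro g
      have hg : g ∈ Submodule.span ℂ (Set.range x) := hspan ▸ Submodule.mem_top
      induction hg using Submodule.span_induction with
      | mem g hg => obtain ⟨j, rfl⟩ := hg; exact hv' j
      | zero => simp
      | add a b _ _ ha hb => simp [ha, hb]
      | smul c a _ ha => simp [ha]
    ext k
    exact h (ContinuousLinearMap.proj k)
  exact ⟨hinj, LinearMap.surjective_of_injective hinj⟩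

/-- The gradient of the cubic form of an ordinary triple point, paired with a vector. -/
def hesseGradient (l : ℂ) (x y : Fin 3 → ℂ) : ℂ :=
  (3 * x 0 ^ 2 + l * x 1 * x 2) * y 0 + (3 * x 1 ^ 2 + l * x 0 * x 2) * y 1 +
    (3 * x 2 ^ 2 + l * x 0 * x 1) * y 2

theorem eq_zero_of_hesseGradient {l : ℂ} (hl : l ^ 3 ≠ -27) {x : Fin 3 → ℂ}
    (h : ∀ y, hesseGradient l x y = 0) : x = 0 := by
  have h0 := h ![1, 0, 0]
  have h1 := h ![0, 1, 0]
  have h2 := h ![0, 0, 1]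
  simp [hesseGradient] at h0 h1 h2
  obtain ⟨ha, hb, hc⟩ := eq_zero_of_hesse_gradient hl h0 h1 h2
  ext i
  fin_cases i <;> simp [ha, hb, hc]

/-- An ordinary triple point is a triple point whose tangent cone is smooth. The Taylor
coefficients of the equation along the lines through the point are found by comparing limits. -/
theorem isTripleVector_of_analytic {F : MvPolynomial (Fin 4) ℂ} {n : ℕ} (hF : F.IsHomogeneous n)
    (b : Module.Basis (Fin 4) ℂ (Fin 4 → ℂ)) {l : ℂ} {x : Fin 3 → (Fin 3 → ℂ) → ℂ}
    {u : (Fin 3 → ℂ) → ℂ} (hl : l ^ 3 ≠ -27) (hx : ∀ j, AnalyticAt ℂ (x j) 0)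
    (hx0 : ∀ j, x j 0 = 0) (hind : LinearIndependent ℂ (fun j => fderiv ℂ (x j) 0))
    (hu : AnalyticAt ℂ u 0) (hu0 : u 0 ≠ 0)
    (heq : ∀ᶠ v in 𝓝 (0 : Fin 3 → ℂ),
      eval (chartPoint b v) F = u v * hesseCubic l (fun j => x j v)) :
    IsTripleVector F (b 0) := by
  have hbij := bijective_of_linearIndependent hind
  set ℓ := ContinuousLinearMap.pi (fun j => fderiv ℂ (x j) 0) with hℓ
  have key : ∀ v : Fin 3 → ℂ,
      (∀ k < 3, (lineRestriction F (b 0) (chartVector b v)).coeff k = 0) ∧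
      (lineRestriction F (b 0) (chartVector b v)).coeff 3 = u 0 * hesseCubic l (ℓ v) := by
    intro v
    apply coeff_of_tendsto
    refine (tendsto_hesse (l := l) hx hx0 hu v).congr' ?_
    have ht : Filter.Tendsto (fun t : ℂ => t • v) (𝓝[≠] 0) (𝓝 0) := by
      have : Continuous (fun t : ℂ => t • v) := by fun_prop
      simpa using (this.tendsto 0).mono_left nhdsWithin_le_nhds
    filter_upwards [ht.eventually heq] with t hh
    rw [eval_lineRestriction, ← hh]
    have h := chartPoint_add_smul b 0 v t
    rw [zero_add] at h
    rw [h]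
    simp [chartPoint]
  have h0 : eval (b 0) F = 0 := by
    rw [coeff_lineRestriction_zero F _ (chartVector b 0)]
    exact (key 0).1 0 (by norm_num)
  have h1 : ∀ z, eval (b 0) (dirDeriv z F) = 0 := by
    intro z
    rw [exists_eq_smul_add_chartVector b z, dirDeriv_add_left, dirDeriv_smul_left, map_add, map_mul,
      eval_dirDeriv_self hF, h0, coeff_lineRestriction_one, (key _).1 1 (by norm_num)]
    simp
  have h2' : ∀ v y, eval (b 0) (dirDeriv (chartVector b v) (dirDeriv (chartVector b y) F)) = 0 := by
    intro v y
    have hsq : ∀ v, eval (b 0) (dirDeriv (chartVector b v) (dirDeriv (chartVector b v) F)) = 0 := by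
      intro v
      rw [coeff_lineRestriction_two, (key v).1 2 (by norm_num), mul_zero]
    have h := eval_dirDeriv_square F (b 0) (chartVector b v) (chartVector b y)
    have hvy := chartVector_add_smul b v y 1
    rw [one_smul, one_smul] at hvy
    rw [← hvy, hsq, hsq, hsq] at h
    linear_combination -h / 2
  have h2b : ∀ z, eval (b 0) (dirDeriv (b 0) (dirDeriv z F)) = 0 := by
    intro z
    rw [eval_dirDeriv_self (isHomogeneous_dirDeriv hF z), h1, mul_zero]
  have h2 : ∀ w z, eval (b 0) (dirDeriv w (dirDeriv z F)) = 0 := by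
    intro w z
    rw [exists_eq_smul_add_chartVector b w, dirDeriv_add_left, dirDeriv_smul_left, map_add, map_mul,
      h2b, mul_zero, zero_add, dirDeriv_comm, exists_eq_smul_add_chartVector b z, dirDeriv_add_left,
      dirDeriv_smul_left, map_add, map_mul, h2b, mul_zero, zero_add, dirDeriv_comm, h2']
  refine ⟨h2, fun w hw => ?_⟩
  have h3b : ∀ y z, eval (b 0) (dirDeriv (b 0) (dirDeriv y (dirDeriv z F))) = 0 := by
    intro y z
    rw [eval_dirDeriv_self (isHomogeneous_dirDeriv (isHomogeneous_dirDeriv hF z) y), h2, mul_zero]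
  set v : Fin 3 → ℂ := fun j => b.repr w j.succ with hv
  have hwv : w = b.repr w 0 • b 0 + chartVector b v := exists_eq_smul_add_chartVector b w
  have hw' : ∀ z, eval (b 0) (dirDeriv (chartVector b v) (dirDeriv (chartVector b v)
      (dirDeriv z F))) = 0 := by
    intro z
    have h := hw z
    rw [hwv, dirDeriv_add_left, dirDeriv_smul_left, map_add, map_mul, h3b, mul_zero, zero_add,
      dirDeriv_comm, dirDeriv_add_left, dirDeriv_smul_left, map_add, map_mul, h3b, mul_zero,
      zero_add] at h
    exact h
  have hgrad : ∀ y, hesseGradient l (ℓ v) (ℓ y) = 0 := by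
    intro y
    obtain ⟨A, B, D, hc⟩ : ∃ A B D : ℂ, ∀ s : ℂ,
        6 * (u 0 * hesseCubic l (ℓ v + s • ℓ y)) = A + 3 * s ^ 2 * B + s ^ 3 * D := by
      refine ⟨eval (b 0) (dirDeriv (chartVector b v) (dirDeriv (chartVector b v)
          (dirDeriv (chartVector b v) F))),
        eval (b 0) (dirDeriv (chartVector b v) (dirDeriv (chartVector b y)
          (dirDeriv (chartVector b y) F))),
        eval (b 0) (dirDeriv (chartVector b y) (dirDeriv (chartVector b y)
          (dirDeriv (chartVector b y) F))), fun s => ?_⟩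
      have h := eval_dirDeriv_cube F (b 0) (chartVector b v) (chartVector b y) s
      rw [← chartVector_add_smul, coeff_lineRestriction_three, (key _).2, map_add, map_smul,
        hw' (chartVector b y), mul_zero, add_zero] at h
      exact h
    have e0 := hc 0
    have e1 := hc 1
    have e2 := hc (-1)
    have e3 := hc 2
    have hne : (6 : ℂ) * u 0 ≠ 0 := mul_ne_zero (by norm_num) hu0
    refine (mul_eq_zero.mp ?_).resolve_left hne
    simp only [hesseCubic, Pi.add_apply, Pi.smul_apply, smul_eq_mul] at e0 e1 e2 e3
    simp only [hesseGradient]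
    linear_combination (-1 / 2) * e0 + e1 - (1 / 3) * e2 - (1 / 6) * e3
  have hℓv : ℓ v = 0 := eq_zero_of_hesseGradient hl fun y => by
    obtain ⟨y', rfl⟩ := hbij.2 y
    exact hgrad y'
  have hv0 : v = 0 := hbij.1 (by rw [hℓv, map_zero])
  refine ⟨b.repr w 0, ?_⟩
  conv_lhs => rw [hwv, hv0]
  simp [chartVector]

theorem hasDerivAt_hesse {l : ℂ} {X : ℂ → Fin 3 → ℂ} {X' : Fin 3 → ℂ} (hX : HasDerivAt X X' 0) :
    HasDerivAt (fun t => hesseCubic l (X t)) (hesseGradient l (X 0) X') 0 := by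
  rw [hasDerivAt_pi] at hX
  have h := ((((hX 0).pow 3).add ((hX 1).pow 3)).add ((hX 2).pow 3)).add
    (((hX 0).const_mul l |>.mul (hX 1)).mul (hX 2))
  refine h.congr_deriv ?_
  simp only [hesseGradient]
  norm_num
  ring

/-- An ordinary triple point is an isolated singular point. -/
theorem eventually_eq_zero_of_analytic {F : MvPolynomial (Fin 4) ℂ}
    (b : Module.Basis (Fin 4) ℂ (Fin 4 → ℂ)) {l : ℂ} {x : Fin 3 → (Fin 3 → ℂ) → ℂ}
    {u : (Fin 3 → ℂ) → ℂ} (hl : l ^ 3 ≠ -27) (hx : ∀ j, AnalyticAt ℂ (x j) 0)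
    (hx0 : ∀ j, x j 0 = 0) (hind : LinearIndependent ℂ (fun j => fderiv ℂ (x j) 0))
    (hu : AnalyticAt ℂ u 0) (hu0 : u 0 ≠ 0)
    (heq : ∀ᶠ v in 𝓝 (0 : Fin 3 → ℂ),
      eval (chartPoint b v) F = u v * hesseCubic l (fun j => x j v)) :
    ∀ᶠ v in 𝓝 (0 : Fin 3 → ℂ), eval (chartPoint b v) F = 0 →
      (∀ i, eval (chartPoint b v) (pderiv i F) = 0) → v = 0 := by
  have hbij := bijective_of_linearIndependent hind
  set X : (Fin 3 → ℂ) → (Fin 3 → ℂ) := fun v j => x j v with hX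
  have hXan : AnalyticAt ℂ X 0 := by
    rw [hX, analyticAt_pi_iff]
    exact hx
  have hXd : fderiv ℂ X 0 = ContinuousLinearMap.pi (fun j => fderiv ℂ (x j) 0) :=
    fderiv_pi fun j => (hx j).differentiableAt
  let e : (Fin 3 → ℂ) ≃L[ℂ] (Fin 3 → ℂ) :=
    (LinearEquiv.ofBijective (ContinuousLinearMap.pi (fun j => fderiv ℂ (x j) 0) :
      (Fin 3 → ℂ) →ₗ[ℂ] (Fin 3 → ℂ)) hbij).toContinuousLinearEquiv
  have he : (e : (Fin 3 → ℂ) →L[ℂ] (Fin 3 → ℂ)) = fderiv ℂ X 0 := by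
    rw [hXd]; rfl
  have hstrict : HasStrictFDerivAt X (e : (Fin 3 → ℂ) →L[ℂ] (Fin 3 → ℂ)) 0 := by
    rw [he]; exact hXan.hasStrictFDerivAt
  have hsource := (hstrict.toOpenPartialHomeomorph X).open_source.mem_nhds
    hstrict.mem_toOpenPartialHomeomorph_source
  have hequiv : ∀ᶠ v in 𝓝 (0 : Fin 3 → ℂ), fderiv ℂ X v ∈
      Set.range ((↑) : ((Fin 3 → ℂ) ≃L[ℂ] (Fin 3 → ℂ)) → _) :=
    hXan.fderiv.continuousAt.eventually (he ▸ ContinuousLinearEquiv.nhds e)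
  filter_upwards [eventually_eventually_nhds.mpr heq, hu.eventually_analyticAt,
    hXan.eventually_analyticAt, hu.continuousAt.eventually_ne hu0, hequiv, hsource]
    with v h1 h2 h3 h4 h5 h6 hF hF'
  have hv : hesseCubic l (X v) = 0 := by
    have := h1.self_of_nhds
    rw [hF] at this
    exact (mul_eq_zero.mp this.symm).resolve_left h4
  have hgrad : ∀ y, hesseGradient l (X v) (fderiv ℂ X v y) = 0 := by
    intro y
    have hline : HasDerivAt (fun t : ℂ => v + t • y) y 0 := by
      simpa using ((hasDerivAt_id (0 : ℂ)).smul_const y).const_add v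
    have hv0 : v + (0 : ℂ) • y = v := by simp
    have d1 : HasDerivAt (fun t : ℂ => X (v + t • y)) (fderiv ℂ X v y) 0 := by
      have : HasFDerivAt X (fderiv ℂ X v) (v + (0 : ℂ) • y) := by
        rw [hv0]; exact h3.differentiableAt.hasFDerivAt
      exact this.comp_hasDerivAt 0 hline
    have d2 : HasDerivAt (fun t : ℂ => u (v + t • y)) (fderiv ℂ u v y) 0 := by
      have : HasFDerivAt u (fderiv ℂ u v) (v + (0 : ℂ) • y) := by
        rw [hv0]; exact h2.differentiableAt.hasFDerivAt
      exact this.comp_hasDerivAt 0 hline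
    have d3 := d2.mul (hasDerivAt_hesse (l := l) d1)
    have d4 := hasDerivAt_lineRestriction F (chartPoint b v) (chartVector b y)
    rw [eval_dirDeriv_eq_zero_of_pderiv hF'] at d4
    have hcont : Filter.Tendsto (fun t : ℂ => v + t • y) (𝓝 0) (𝓝 v) := by
      have := hline.continuousAt.tendsto
      rwa [hv0] at this
    have d5 := d3.congr_of_eventuallyEq (f₁ := fun t : ℂ =>
      eval (chartPoint b v + t • chartVector b y) F) (by
        filter_upwards [hcont.eventually h1] with t ht
        rw [← chartPoint_add_smul, ht]
        rfl)
    have := d5.unique d4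
    rw [hv0, hv, mul_zero, zero_add] at this
    exact (mul_eq_zero.mp this).resolve_left h4
  have hXv : X v = 0 := eq_zero_of_hesseGradient hl fun y => by
    obtain ⟨g, hg⟩ := h5
    obtain ⟨y', rfl⟩ := g.surjective y
    have := hgrad y'
    rwa [← hg] at this
  have hX0 : X 0 = 0 := by
    ext j
    exact hx0 j
  exact (hstrict.toOpenPartialHomeomorph X).injOn h6 hstrict.mem_toOpenPartialHomeomorph_source
    (by simpa using hXv.trans hX0.symm)

theorem IsOrdinaryTriplePoint.exists_basis {F : MvPolynomial (Fin 4) ℂ} {n : ℕ}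
    (hF : F.IsHomogeneous n) {P : P3} (hP : IsOrdinaryTriplePoint F P) :
    ∃ b : Module.Basis (Fin 4) ℂ (Fin 4 → ℂ), Projectivization.mk ℂ (b 0) (b.ne_zero 0) = P ∧
      IsTripleVector F (b 0) ∧ ∀ᶠ v in 𝓝 (0 : Fin 3 → ℂ), eval (chartPoint b v) F = 0 →
        (∀ i, eval (chartPoint b v) (pderiv i F) = 0) → v = 0 := by
  obtain ⟨b, hb, l, x, u, hl, hx, hx0, hind, hu, hu0, heq⟩ := hP
  simp only [eval_aeval_affineChart] at heq
  exact ⟨b, hb, isTripleVector_of_analytic hF b hl hx hx0 hind hu hu0 heq,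
    eventually_eq_zero_of_analytic b hl hx hx0 hind hu hu0 heq⟩

theorem IsTripleVector.smul {F : MvPolynomial (Fin 4) ℂ} {n : ℕ} (hF : F.IsHomogeneous n)
    {p : Fin 4 → ℂ} (hp : IsTripleVector F p) {a : ℂ} (ha : a ≠ 0) : IsTripleVector F (a • p) where
  second w z := by
    rw [eval_smul_of_isHomogeneous (isHomogeneous_dirDeriv (isHomogeneous_dirDeriv hF _) _),
      hp.second, mul_zero]
  cone w hw := by
    obtain ⟨c, hc⟩ := hp.cone w fun z => by
      have h := hw z
      rw [eval_smul_of_isHomogeneous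
        (isHomogeneous_dirDeriv (isHomogeneous_dirDeriv (isHomogeneous_dirDeriv hF _) _) _)] at h
      exact (mul_eq_zero.mp h).resolve_left (pow_ne_zero _ ha)
    exact ⟨c * a⁻¹, by rw [hc, smul_smul, mul_assoc, inv_mul_cancel₀ ha, mul_one]⟩

theorem IsTripleVector.first {F : MvPolynomial (Fin 4) ℂ} {p : Fin 4 → ℂ}
    (hF : F.IsHomogeneous 6) (hp : IsTripleVector F p) (w : Fin 4 → ℂ) :
    eval p (dirDeriv w F) = 0 := by
  have h := eval_dirDeriv_self (isHomogeneous_dirDeriv hF w) p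
  rw [hp.second] at h
  norm_num at h
  exact h

theorem IsTripleVector.eval_eq_zero {F : MvPolynomial (Fin 4) ℂ} {p : Fin 4 → ℂ}
    (hF : F.IsHomogeneous 6) (hp : IsTripleVector F p) : eval p F = 0 := by
  have h := eval_dirDeriv_self hF p
  rw [hp.first hF] at h
  norm_num at h
  exact h

theorem IsOrdinaryTriplePoint.isTripleVector_rep {F : MvPolynomial (Fin 4) ℂ} {n : ℕ}
    (hF : F.IsHomogeneous n) {P : P3} (hP : IsOrdinaryTriplePoint F P) :
    IsTripleVector F P.rep := by
  obtain ⟨b, rfl, hb, -⟩ := hP.exists_basis hF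
  obtain ⟨a, ha, h⟩ := exists_rep_mk_eq_smul (b 0) (b.ne_zero 0)
  rw [h]
  exact hb.smul hF ha

theorem IsOrdinaryTriplePoint.mem_singularLocus {F : MvPolynomial (Fin 4) ℂ}
    (hF : F.IsHomogeneous 6) {P : P3} (hP : IsOrdinaryTriplePoint F P) : P ∈ singularLocus F := by
  have h := hP.isTripleVector_rep hF
  refine ⟨h.eval_eq_zero hF, fun i => ?_⟩
  rw [← dirDeriv_single]
  exact h.first hF _

/-- The singular locus is compact, so it is finite if its points are isolated. -/
theorem finite_singularLocus {F : MvPolynomial (Fin 4) ℂ} (hF : F.IsHomogeneous 6)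
    (hsing : ∀ P ∈ singularLocus F, IsOrdinaryTriplePoint F P) : (singularLocus F).Finite := by
  set K : Set (Fin 4 → ℂ) := Metric.sphere 0 1 ∩
    {v | eval v F = 0 ∧ ∀ i, eval v (pderiv i F) = 0} with hK
  have hKc : IsCompact K := by
    refine (isCompact_sphere 0 1).inter_right ?_
    refine IsClosed.and (isClosed_eq (MvPolynomial.continuous_eval F) continuous_const) ?_
    simp only [Set.ofPred_forall]
    exact isClosed_iInter fun i =>
      isClosed_eq (MvPolynomial.continuous_eval _) continuous_const
  have hlocal : ∀ p ∈ K, {v : Fin 4 → ℂ | (eval v F = 0 ∧ ∀ i, eval v (pderiv i F) = 0) →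
      ∃ a : ℂ, v = a • p} ∈ 𝓝 p := by
    rintro p ⟨hp1, hp2⟩
    have hp0 : p ≠ 0 := by
      rintro rfl
      simp at hp1
    obtain ⟨b, hb, -, hiso⟩ := (hsing _ ((mk_mem_singularLocus_iff hF p hp0).mpr hp2)).exists_basis
      hF
    obtain ⟨a, ha⟩ := (Projectivization.mk_eq_mk_iff' ℂ _ _ _ _).mp hb
    have ha0 : a ≠ 0 := by
      rintro rfl
      exact b.ne_zero 0 (by rw [← ha, zero_smul])
    have hpa : p = a⁻¹ • b 0 := by rw [← ha, smul_smul, inv_mul_cancel₀ ha0, one_smul]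
    have hc : ∀ j, Continuous fun v : Fin 4 → ℂ => b.repr v j := fun j =>
      (b.coord j).continuous_of_finiteDimensional
    have hr0 : b.repr p 0 ≠ 0 := by
      rw [hpa]; simp [ha0]
    have hrj : ∀ j : Fin 3, b.repr p j.succ = 0 := by
      intro j
      rw [hpa]; simp
    have hlim : Filter.Tendsto (fun v => fun j : Fin 3 => (b.repr v 0)⁻¹ * b.repr v j.succ) (𝓝 p)
        (𝓝 0) := by
      rw [tendsto_pi_nhds]
      intro j
      have := (((hc 0).tendsto p).inv₀ hr0).mul ((hc j.succ).tendsto p)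
      simpa [hrj] using this
    filter_upwards [hlim.eventually hiso, (hc 0).continuousAt.eventually_ne hr0] with v hv hv0 hvK
    have hvc : chartPoint b (fun j : Fin 3 => (b.repr v 0)⁻¹ * b.repr v j.succ) =
        (b.repr v 0)⁻¹ • v := by
      conv_rhs => rw [← b.sum_repr v, Fin.sum_univ_succ]
      simp [chartPoint, Finset.smul_sum, smul_smul, hv0]
    rw [hvc] at hv
    have hz := hv (by rw [eval_smul_of_isHomogeneous hF, hvK.1, mul_zero])
      (fun i => by rw [eval_smul_of_isHomogeneous hF.pderiv, hvK.2, mul_zero])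
    rw [hz] at hvc
    refine ⟨b.repr v 0 * a, ?_⟩
    have : v = b.repr v 0 • chartPoint b 0 := by
      rw [hvc, smul_smul, mul_inv_cancel₀ hv0, one_smul]
    rw [mul_smul, ha]
    conv_lhs => rw [this]
    simp [chartPoint]
  obtain ⟨t, htK, ht⟩ := hKc.elim_nhds_subcover _ hlocal
  classical
  refine (t.finite_toSet.biUnion (t := fun p => {Q : P3 | ∃ h : p ≠ 0,
    Q = Projectivization.mk ℂ p h}) fun p _ => ?_).subset ?_
  · refine Set.Subsingleton.finite ?_
    rintro _ ⟨_, rfl⟩ _ ⟨_, rfl⟩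
    rfl
  · intro Q hQ
    have hQ0 : ‖Q.rep‖ ≠ 0 := by simpa using Q.rep_nonzero
    have hQK : ((‖Q.rep‖⁻¹ : ℝ) : ℂ) • Q.rep ∈ K := by
      refine ⟨by simp [norm_smul, hQ0], ?_, fun i => ?_⟩
      · rw [eval_smul_of_isHomogeneous hF, hQ.1, mul_zero]
      · rw [eval_smul_of_isHomogeneous hF.pderiv, hQ.2, mul_zero]
    obtain ⟨p, hpt, hp⟩ := Set.mem_iUnion₂.mp (ht hQK)
    obtain ⟨a, ha⟩ := hp hQK.2
    refine Set.mem_iUnion₂.mpr ⟨p, hpt, ?_⟩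
    have hp0 : p ≠ 0 := by
      rintro rfl
      have := (htK _ hpt).1
      simp at this
    refine ⟨hp0, ?_⟩
    rw [← Q.mk_rep, Projectivization.mk_eq_mk_iff']
    have hn : ((‖Q.rep‖⁻¹ : ℝ) : ℂ) ≠ 0 := by simpa using Q.rep_nonzero
    exact ⟨((‖Q.rep‖⁻¹ : ℝ) : ℂ)⁻¹ * a, by rw [mul_smul, ← ha, smul_smul, inv_mul_cancel₀ hn,
      one_smul]⟩

/-! ### Linear forms -/

/-- The linear form, as a polynomial, of a linear functional. -/
def linForm {n : ℕ} (f : Module.Dual ℂ (Fin n → ℂ)) : MvPolynomial (Fin n) ℂ :=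
  ∑ i, C (f (Pi.single i 1)) * X i

theorem dual_apply_eq_sum {n : ℕ} (f : Module.Dual ℂ (Fin n → ℂ)) (q : Fin n → ℂ) :
    f q = ∑ i, f (Pi.single i 1) * q i := by
  conv_lhs => rw [pi_eq_sum_univ' q, map_sum]
  refine Finset.sum_congr rfl fun i _ => ?_
  rw [map_smul, smul_eq_mul, mul_comm]

theorem eval_linForm {n : ℕ} (f : Module.Dual ℂ (Fin n → ℂ)) (q : Fin n → ℂ) :
    eval q (linForm f) = f q := by
  rw [dual_apply_eq_sum]
  simp [linForm]

theorem isHomogeneous_linForm {n : ℕ} (f : Module.Dual ℂ (Fin n → ℂ)) :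
    (linForm f).IsHomogeneous 1 :=
  IsHomogeneous.sum _ _ _ fun i _ => isHomogeneous_C_mul_X _ i

theorem dirDeriv_linForm {n : ℕ} (f : Module.Dual ℂ (Fin n → ℂ)) (w : Fin n → ℂ) :
    dirDeriv w (linForm f) = C (f w) := by
  rw [dual_apply_eq_sum]
  simp [linForm, dirDeriv_X]

theorem exists_dual_apply_eq {n : ℕ} {p w : Fin n → ℂ} (h : LinearIndependent ℂ ![p, w])
    (α β : ℂ) : ∃ f : Module.Dual ℂ (Fin n → ℂ), f p = α ∧ f w = β := by
  have h1 : w ∉ Submodule.span ℂ {p} := by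
    rw [Submodule.mem_span_singleton]
    rintro ⟨a, ha⟩
    exact (LinearIndependent.pair_iff' (h.ne_zero 0)).mp h a ha
  have h2 : p ∉ Submodule.span ℂ {w} := by
    rw [Submodule.mem_span_singleton]
    rintro ⟨a, ha⟩
    exact (LinearIndependent.pair_iff' (h.ne_zero 1)).mp (LinearIndependent.pair_symm_iff.mp h) a ha
  obtain ⟨f, hf, hfp⟩ := Submodule.exists_le_ker_of_notMem h1
  obtain ⟨g, hg, hgw⟩ := Submodule.exists_le_ker_of_notMem h2
  have hfp' : f p = 0 := hfp (Submodule.mem_span_singleton_self p)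
  have hgw' : g w = 0 := hgw (Submodule.mem_span_singleton_self w)
  refine ⟨(α / g p) • g + (β / f w) • f, ?_, ?_⟩
  · simp [hfp', hg]
  · simp [hgw', hf]

theorem exists_dual_apply_eq_one {n : ℕ} {p : Fin n → ℂ} (hp : p ≠ 0) :
    ∃ f : Module.Dual ℂ (Fin n → ℂ), f p = 1 := by
  obtain ⟨f, hf, -⟩ := Submodule.exists_le_ker_of_notMem (p := (⊥ : Submodule ℂ (Fin n → ℂ)))
    (v := p) (by simpa using hp)
  exact ⟨(f p)⁻¹ • f, by simp [hf]⟩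

theorem linearIndependent_rep_pair {P Q : P3} (h : P ≠ Q) :
    LinearIndependent ℂ ![P.rep, Q.rep] := by
  rw [LinearIndependent.pair_iff' P.rep_nonzero]
  intro a ha
  apply h
  rw [← P.mk_rep, ← Q.mk_rep]
  refine ((Projectivization.mk_eq_mk_iff' ℂ _ _ _ _).mpr ⟨a, ha⟩).symm

/-! ### Forms on an irreducible curve -/

/-- The form `G` vanishes at all points of `V`. -/
def VanishesOn (G : MvPolynomial (Fin 4) ℂ) (V : Set P3) : Prop := ∀ Q ∈ V, eval Q.rep G = 0

/-- The vector `w` is tangent to (the cone over) `V` at `p`. -/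
def IsTangentVector (V : Set P3) (p w : Fin 4 → ℂ) : Prop :=
  ∀ (n : ℕ) (H : MvPolynomial (Fin 4) ℂ), H.IsHomogeneous n → VanishesOn H V →
    eval p (dirDeriv w H) = 0

theorem IrreducibleCurve.vanishesOn_or (C : IrreducibleCurve) {m n : ℕ}
    {G H : MvPolynomial (Fin 4) ℂ} (hG : G.IsHomogeneous m) (hH : H.IsHomogeneous n)
    (h : VanishesOn (G * H) C.carrier) : VanishesOn G C.carrier ∨ VanishesOn H C.carrier :=
  C.irreducible m n G H hG hH h

instance finite_homogeneousSubmodule {n m : ℕ} :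
    Module.Finite ℂ (homogeneousSubmodule (Fin n) ℂ m) :=
  Module.Finite.iff_fg.mpr (homogeneousSubmodule_fg _ _ m)

theorem hilbertFunction_le_of_ker {V : Set P3} {n : ℕ} {W : Type*} [AddCommGroup W] [Module ℂ W]
    [FiniteDimensional ℂ W] (Λ : homogeneousSubmodule (Fin 4) ℂ n →ₗ[ℂ] W)
    (h : ∀ A, Λ A = 0 → VanishesOn (A : MvPolynomial (Fin 4) ℂ) V) :
    hilbertFunction V n ≤ Module.finrank ℂ W := by
  have hle : LinearMap.ker Λ ≤ vanishingForms V n := fun A hA => h A hA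
  have h1 : hilbertFunction V n ≤
      Module.finrank ℂ (homogeneousSubmodule (Fin 4) ℂ n ⧸ LinearMap.ker Λ) :=
    LinearMap.finrank_le_finrank_of_surjective (f := Submodule.factor hle)
      (Submodule.factor_surjective hle)
  have h2 := Λ.quotKerEquivRange.finrank_eq
  exact h1.trans (h2.le.trans (Submodule.finrank_le _))

theorem hilbertFunction_le_card {V : Set P3} {n : ℕ} {ι : Type*} [Fintype ι]
    (p : ι → (Fin 4 → ℂ))
    (h : ∀ A : MvPolynomial (Fin 4) ℂ, A.IsHomogeneous n → (∀ i, eval (p i) A = 0) →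
      VanishesOn A V) : hilbertFunction V n ≤ Fintype.card ι := by
  have := hilbertFunction_le_of_ker (V := V) (n := n)
    (LinearMap.pi fun i => (aeval (R := ℂ) (p i)).toLinearMap ∘ₗ
      (homogeneousSubmodule (Fin 4) ℂ n).subtype) (fun A hA => h A A.2 fun i => by
        simpa [aeval_eq_eval] using congrFun hA i)
  simpa using this

theorem IrreducibleCurve.infinite (C : IrreducibleCurve) : C.carrier.Infinite := by
  intro hfin
  obtain ⟨k, hk⟩ := C.hilbert
  have : Fintype C.carrier := hfin.fintype
  have hle : ∀ n, hilbertFunction C.carrier n ≤ Fintype.card C.carrier := fun n =>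
    hilbertFunction_le_card (fun Q : C.carrier => Q.1.rep) fun A _ hA Q hQ => hA ⟨Q, hQ⟩
  obtain ⟨n₀, hn₀⟩ := Filter.eventually_atTop.mp hk
  have hd : (1 : ℤ) ≤ C.degree := by exact_mod_cast C.degree_pos
  set N : ℕ := n₀ + (Fintype.card C.carrier + 1 + k.natAbs) with hN
  have h1 := hn₀ N (by omega)
  have h2 : (hilbertFunction C.carrier N : ℤ) ≤ Fintype.card C.carrier := by exact_mod_cast hle N
  have h3 : (N : ℤ) ≤ C.degree * N := le_mul_of_one_le_left (by positivity) hd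
  have h4 : -k ≤ k.natAbs := by omega
  omega

/-- Multiplication by a form `G` that does not vanish on the irreducible curve `C` is injective on
its coordinate ring; so functionals that kill the multiples of `G` are few. -/
theorem IrreducibleCurve.finrank_add_hilbertFunction_le (C : IrreducibleCurve)
    {G : MvPolynomial (Fin 4) ℂ} {g m : ℕ} (hG : G.IsHomogeneous g)
    (hGC : ¬ VanishesOn G C.carrier) {W : Type*} [AddCommGroup W] [Module ℂ W]
    [FiniteDimensional ℂ W] (Λ : homogeneousSubmodule (Fin 4) ℂ (g + m) →ₗ[ℂ] W)
    (hΛ : Function.Surjective Λ)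
    (h1 : ∀ A : homogeneousSubmodule (Fin 4) ℂ (g + m),
      VanishesOn (A : MvPolynomial (Fin 4) ℂ) C.carrier → Λ A = 0)
    (h2 : ∀ A : homogeneousSubmodule (Fin 4) ℂ (g + m), ∀ B : MvPolynomial (Fin 4) ℂ,
      (A : MvPolynomial (Fin 4) ℂ) = G * B → Λ A = 0) :
    Module.finrank ℂ W + hilbertFunction C.carrier m ≤ hilbertFunction C.carrier (g + m) := by
  let μ : homogeneousSubmodule (Fin 4) ℂ m →ₗ[ℂ] homogeneousSubmodule (Fin 4) ℂ (g + m) :=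
    ((LinearMap.mulLeft ℂ G).comp (homogeneousSubmodule (Fin 4) ℂ m).subtype).codRestrict _
      fun B => hG.mul B.2
  have hμ : ∀ B, ((μ B : homogeneousSubmodule (Fin 4) ℂ (g + m)) : MvPolynomial (Fin 4) ℂ) =
      G * B := fun B => rfl
  have hmem : ∀ B, B ∈ vanishingForms C.carrier m ↔ μ B ∈ vanishingForms C.carrier (g + m) := by
    intro B
    constructor
    · intro hB Q hQ
      rw [hμ, map_mul, hB Q hQ, mul_zero]
    · intro hB
      exact (C.vanishesOn_or hG B.2 hB).resolve_left hGC
  let μ' := Submodule.mapQ (vanishingForms C.carrier m) (vanishingForms C.carrier (g + m)) μ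
    fun B hB => (hmem B).mp hB
  let Λ' := (vanishingForms C.carrier (g + m)).liftQ Λ fun A hA => h1 A hA
  have hμ' : Function.Injective μ' := by
    rw [← LinearMap.ker_eq_bot, LinearMap.ker_eq_bot']
    intro x hx
    obtain ⟨B, rfl⟩ := Submodule.mkQ_surjective _ x
    have : Submodule.Quotient.mk (p := vanishingForms C.carrier (g + m)) (μ B) = 0 := hx
    rw [Submodule.Quotient.mk_eq_zero] at this
    exact (Submodule.Quotient.mk_eq_zero _).mpr ((hmem B).mpr this)
  have hΛ' : LinearMap.range Λ' = ⊤ := by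
    refine LinearMap.range_eq_top.mpr fun y => ?_
    obtain ⟨A, rfl⟩ := hΛ y
    exact ⟨Submodule.Quotient.mk A, rfl⟩
  have hle : LinearMap.range μ' ≤ LinearMap.ker Λ' := by
    rintro _ ⟨x, rfl⟩
    obtain ⟨B, rfl⟩ := Submodule.mkQ_surjective _ x
    exact h2 (μ B) B rfl
  have e1 := LinearMap.finrank_range_add_finrank_ker Λ'
  rw [hΛ', finrank_top] at e1
  have e2 := Submodule.finrank_mono hle
  rw [LinearMap.finrank_range_of_inj hμ'] at e2
  have e3 : Module.finrank ℂ (homogeneousSubmodule (Fin 4) ℂ m ⧸ vanishingForms C.carrier m) =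
    hilbertFunction C.carrier m := rfl
  have e4 : Module.finrank ℂ (homogeneousSubmodule (Fin 4) ℂ (g + m) ⧸
    vanishingForms C.carrier (g + m)) = hilbertFunction C.carrier (g + m) := rfl
  omega

/-! ### Tangent vectors of irreducible curves -/

/-- A form of degree `r + 1` that is singular at `p` is a combination of the linear forms
`X j - p j M` vanishing at `p`, with coefficients vanishing at `p`. Here `M` is a linear form with
`M p = 1`. -/
theorem exists_eq_sum_of_pderiv_eq_zero {p : Fin 4 → ℂ} {M : MvPolynomial (Fin 4) ℂ}
    (hM : M.IsHomogeneous 1) (r : ℕ) (B : MvPolynomial (Fin 4) ℂ)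
    (hB : B.IsHomogeneous (r + 1)) (hB' : ∀ i, eval p (pderiv i B) = 0) :
    ∃ a : Fin 4 → MvPolynomial (Fin 4) ℂ, (∀ j, (a j).IsHomogeneous r) ∧ (∀ j, eval p (a j) = 0) ∧
      B = ∑ j, a j * (X j - C (p j) * M) := by
  induction r generalizing B with
  | zero =>
    refine ⟨0, fun j => isHomogeneous_zero _ _ _, by simp, ?_⟩
    have h0 : ∀ i, pderiv i B = 0 := by
      intro i
      have h := (hB.pderiv (i := i))
      have h1 := totalDegree_eq_zero_iff_eq_C.mp (Nat.le_zero.mp h.totalDegree_le)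
      have h2 := hB' i
      rw [h1, eval_C] at h2
      rw [h1, h2, C_0]
    have := hB.sum_X_mul_pderiv
    simp only [h0, mul_zero, Finset.sum_const_zero, zero_add, one_smul] at this
    rw [← this]; simp
  | succ r ih =>
    obtain ⟨a, ha, hap, hBa⟩ := ih (dirDeriv p B) (isHomogeneous_dirDeriv hB p) fun i => by
      rw [← dirDeriv_single, eval_dirDeriv_polar hB, dirDeriv_single, hB', mul_zero]
    have hr : ((r + 1 + 1 : ℕ) : ℂ) ≠ 0 := Nat.cast_ne_zero.mpr (Nat.succ_ne_zero _)
    refine ⟨fun j => C (((r + 1 + 1 : ℕ) : ℂ)⁻¹) * (pderiv j B + M * a j), fun j => ?_, fun j => ?_,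
      ?_⟩
    · refine IsHomogeneous.C_mul (IsHomogeneous.add hB.pderiv ?_) _
      rw [add_comm]
      exact hM.mul (ha j)
    · simp [hB', hap]
    · have hE := hB.sum_X_mul_pderiv
      rw [nsmul_eq_mul] at hE
      have h1 : B = C (((r + 1 + 1 : ℕ) : ℂ)⁻¹) * ∑ i, X i * pderiv i B := by
        rw [hE, ← mul_assoc, ← map_natCast (C : ℂ →+* MvPolynomial (Fin 4) ℂ), ← C_mul,
          inv_mul_cancel₀ hr, C_1, one_mul]
      have h2 : ∑ i, X i * pderiv i B =
          ∑ j, pderiv j B * (X j - C (p j) * M) + M * dirDeriv p B := by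
        rw [dirDeriv_eq_sum, Finset.mul_sum, ← Finset.sum_add_distrib]
        exact Finset.sum_congr rfl fun j _ => by ring
      rw [hBa, Finset.mul_sum, ← Finset.sum_add_distrib] at h2
      rw [h2, Finset.mul_sum] at h1
      exact h1.trans (Finset.sum_congr rfl fun j _ => by ring)

theorem pderiv_linForm {n : ℕ} (f : Module.Dual ℂ (Fin n → ℂ)) (i : Fin n) :
    pderiv i (linForm f) = C (f (Pi.single i 1)) := by
  rw [← dirDeriv_single, dirDeriv_linForm]

/-- The gradients at `p` of forms of all large degrees that vanish on `V`. -/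
def gradients (V : Set P3) (p : Fin 4 → ℂ) : Submodule ℂ (Fin 4 → ℂ) where
  carrier := {y | ∃ r₀ : ℕ, ∀ r ≥ r₀, ∃ H : MvPolynomial (Fin 4) ℂ, H.IsHomogeneous r ∧
    VanishesOn H V ∧ ∀ i, eval p (pderiv i H) = y i}
  zero_mem' := ⟨0, fun r _ => ⟨0, isHomogeneous_zero _ _ _, fun _ _ => by simp, by simp⟩⟩
  add_mem' := by
    rintro y z ⟨r₀, hy⟩ ⟨s₀, hz⟩
    refine ⟨max r₀ s₀, fun r hr => ?_⟩
    obtain ⟨H, hH, hHV, hHy⟩ := hy r (le_trans (le_max_left _ _) hr)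
    obtain ⟨K, hK, hKV, hKz⟩ := hz r (le_trans (le_max_right _ _) hr)
    exact ⟨H + K, hH.add hK, fun Q hQ => by rw [map_add, hHV Q hQ, hKV Q hQ, add_zero],
      fun i => by simp [hHy, hKz]⟩
  smul_mem' := by
    rintro c y ⟨r₀, hy⟩
    refine ⟨r₀, fun r hr => ?_⟩
    obtain ⟨H, hH, hHV, hHy⟩ := hy r hr
    exact ⟨C c * H, hH.C_mul c, fun Q hQ => by rw [map_mul, hHV Q hQ, mul_zero],
      fun i => by simp [hHy]⟩

theorem gradient_mem_gradients {V : Set P3} {P : P3} (hP : P ∈ V)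
    {f : Module.Dual ℂ (Fin 4 → ℂ)} (hf : f P.rep = 1) {n : ℕ} {H : MvPolynomial (Fin 4) ℂ}
    (hH : H.IsHomogeneous n) (hHV : VanishesOn H V) :
    (fun i => eval P.rep (pderiv i H)) ∈ gradients V P.rep := by
  refine ⟨n, fun r hr => ⟨linForm f ^ (r - n) * H, ?_, fun Q hQ => ?_, fun i => ?_⟩⟩
  · have := ((isHomogeneous_linForm f).pow (r - n)).mul hH
    rwa [one_mul, Nat.sub_add_cancel hr] at this
  · rw [map_mul, hHV Q hQ, mul_zero]
  · simp [hHV P hP, eval_linForm, hf]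

/-- An irreducible curve has a tangent line at every point. Otherwise, by Nakayama's lemma (in the
form of the determinant trick), all linear forms vanishing at `P` vanish on the curve. -/
theorem IrreducibleCurve.exists_tangentVector (C : IrreducibleCurve) {P : P3}
    (hP : P ∈ C.carrier) :
    ∃ w, LinearIndependent ℂ ![P.rep, w] ∧ IsTangentVector C.carrier P.rep w := by
  set p := P.rep with hp
  obtain ⟨f, hf⟩ : ∃ f : Module.Dual ℂ (Fin 4 → ℂ), f p = 1 :=
    exists_dual_apply_eq_one P.rep_nonzero
  let y : Fin 4 → Fin 4 → ℂ := fun i k => Pi.single (M := fun _ => ℂ) i 1 k -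
    p i * f (Pi.single k 1)
  by_contra hno
  have hall : ∀ i, y i ∈ gradients C.carrier p := by
    by_contra hex
    obtain ⟨i, hi⟩ := not_forall.mp hex
    obtain ⟨g, hg, hgW⟩ := Submodule.exists_le_ker_of_notMem hi
    refine hno ⟨fun k => g (Pi.single k 1), ?_, ?_⟩
    · rw [LinearIndependent.pair_iff' P.rep_nonzero]
      intro a ha
      apply hg
      rw [dual_apply_eq_sum]
      have h1 : ∀ k, g (Pi.single k 1) = a * p k := fun k => (congrFun ha k).symm
      have h2 := dual_apply_eq_sum f p
      rw [hf] at h2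
      simp only [h1, y, mul_sub, Finset.sum_sub_distrib]
      have h3 : ∑ k, a * p k * (p i * f (Pi.single k 1)) =
          a * p i * ∑ k, f (Pi.single k 1) * p k := by
        rw [Finset.mul_sum]
        exact Finset.sum_congr rfl fun k _ => by ring
      rw [h3, ← h2]
      simp [Pi.single_apply]
    · intro n H hH hHV
      have h1 := hgW (gradient_mem_gradients hP hf hH hHV)
      rw [LinearMap.mem_ker, dual_apply_eq_sum] at h1
      rw [eval_dirDeriv]
      exact h1
  choose r₀ hr₀ using hall
  set r : ℕ := ∑ i, r₀ i with hr
  have hle : ∀ i, r₀ i ≤ r + 1 := fun i =>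
    (Finset.single_le_sum (f := r₀) (fun _ _ => Nat.zero_le _) (Finset.mem_univ i)).trans
      (Nat.le_succ _)
  choose H hH hHV hHy using fun i => hr₀ i (r + 1) (hle i)
  set M := linForm f with hM
  have hM1 : M.IsHomogeneous 1 := isHomogeneous_linForm f
  have hMp : eval p M = 1 := by rw [hM, eval_linForm, hf]
  have hℓ1 : ∀ i, (X i - MvPolynomial.C (p i) * M).IsHomogeneous 1 := fun i =>
    (isHomogeneous_X _ i).sub (hM1.C_mul _)
  have hB := fun i => exists_eq_sum_of_pderiv_eq_zero (p := p) hM1 r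
    (M ^ r * (X i - MvPolynomial.C (p i) * M) - H i)
    (by
      refine IsHomogeneous.sub ?_ (hH i)
      simpa using (hM1.pow r).mul (hℓ1 i))
    (fun k => by
      rw [map_sub, map_sub, hHy]
      simp only [Derivation.leibniz, smul_eq_mul, map_add, map_mul, map_sub, map_pow,
        eval_X, eval_C, pderiv_X, pderiv_C, hM, pderiv_linForm, y, mul_zero, add_zero]
      rw [← hM, hMp]
      by_cases hik : k = i
      · subst hik; simp
      · simp [hik, Ne.symm hik])
  choose a ha hap haB using hB
  let A : Matrix (Fin 4) (Fin 4) (MvPolynomial (Fin 4) ℂ) := Matrix.of fun i j =>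
    (if i = j then M ^ r else 0) - a i j
  have hA1 : ∀ i j, (A i j).IsHomogeneous r := by
    intro i j
    refine IsHomogeneous.sub ?_ (ha i j)
    split_ifs
    · simpa using hM1.pow r
    · exact isHomogeneous_zero _ _ _
  have hdet : A.det.IsHomogeneous (4 * r) := by
    rw [Matrix.det_apply]
    refine IsHomogeneous.sum _ _ _ fun σ _ => ?_
    have hprod : (∏ i, A (σ i) i).IsHomogeneous (4 * r) := by
      simpa using IsHomogeneous.prod Finset.univ (fun i => A (σ i) i) (fun _ => r)
        fun i _ => hA1 _ _
    rcases Int.units_eq_one_or (Equiv.Perm.sign σ) with h | h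
    · simpa [h] using hprod
    · simpa [h] using hprod.neg
  have hdetp : eval p A.det = 1 := by
    rw [RingHom.map_det]
    convert Matrix.det_one (n := Fin 4) (R := ℂ) using 2
    ext i j
    simp only [RingHom.mapMatrix_apply, Matrix.map_apply, A, Matrix.of_apply, map_sub, hap, sub_zero,
      Matrix.one_apply]
    split_ifs <;> simp [hMp]
  have hAℓ : A.mulVec (fun j => X j - MvPolynomial.C (p j) * M) = H := by
    ext1 i
    have h1 : A.mulVec (fun j => X j - MvPolynomial.C (p j) * M) i =
        M ^ r * (X i - MvPolynomial.C (p i) * M) -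
          ∑ j, a i j * (X j - MvPolynomial.C (p j) * M) := by
      simp only [A, Matrix.mulVec, dotProduct, Matrix.of_apply, sub_mul, Finset.sum_sub_distrib,
        ite_mul, zero_mul, Finset.sum_ite_eq, Finset.mem_univ, if_true]
    rw [h1, ← haB i]
    ring
  have hvan : ∀ j, VanishesOn (X j - MvPolynomial.C (p j) * M) C.carrier := by
    intro j
    refine (C.vanishesOn_or hdet (hℓ1 j) fun Q hQ => ?_).resolve_left fun h => ?_
    · have h1 := congrArg (fun v => A.adjugate.mulVec v) hAℓ
      simp only [Matrix.mulVec_mulVec, Matrix.adjugate_mul, Matrix.smul_mulVec,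
        Matrix.one_mulVec] at h1
      have h2 := congrFun h1 j
      simp only [Pi.smul_apply, smul_eq_mul] at h2
      rw [h2]
      simp only [Matrix.mulVec, dotProduct, map_sum, map_mul]
      exact Finset.sum_eq_zero fun i _ => by rw [hHV i Q hQ, mul_zero]
    · exact one_ne_zero (hdetp.symm.trans (h P hP))
  refine C.infinite ((Set.finite_singleton P).subset fun Q hQ => ?_)
  have h1 : Q.rep = f Q.rep • p := by
    ext j
    have := hvan j Q hQ
    simp only [map_sub, eval_X, map_mul, eval_C, hM, eval_linForm] at this
    simp only [Pi.smul_apply, smul_eq_mul]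
    linear_combination this
  rw [Set.mem_singleton_iff, ← Q.mk_rep, ← P.mk_rep]
  exact (Projectivization.mk_eq_mk_iff' ℂ _ _ _ _).mpr ⟨f Q.rep, h1.symm⟩

/-! ### Zeros of forms on irreducible curves -/

/-- Values and first derivatives at finitely many points can be prescribed for forms of large
degree. -/
theorem exists_form_apply_eq (T : Finset P3) (w : P3 → Fin 4 → ℂ)
    (hw : ∀ P ∈ T, LinearIndependent ℂ ![P.rep, w P]) {N : ℕ} (hN : 2 * T.card + 1 ≤ N)
    (α β : P3 → ℂ) : ∃ A : MvPolynomial (Fin 4) ℂ, A.IsHomogeneous N ∧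
      ∀ P ∈ T, eval P.rep A = α P ∧ eval P.rep (dirDeriv (w P) A) = β P := by
  classical
  have hsep : ∀ P Q : P3, ∃ f : Module.Dual ℂ (Fin 4 → ℂ), f P.rep = 1 ∧
      (P ≠ Q → f Q.rep = 0) := by
    intro P Q
    by_cases h : P = Q
    · obtain ⟨f, hf⟩ := exists_dual_apply_eq_one P.rep_nonzero
      exact ⟨f, hf, fun h' => absurd h h'⟩
    · obtain ⟨f, hf, hf'⟩ := exists_dual_apply_eq (linearIndependent_rep_pair h) 1 0
      exact ⟨f, hf, fun _ => hf'⟩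
  choose s hs hs' using hsep
  have hone : ∀ P ∈ T, ∃ A : MvPolynomial (Fin 4) ℂ, A.IsHomogeneous N ∧
      (eval P.rep A = α P ∧ eval P.rep (dirDeriv (w P) A) = β P) ∧
      ∀ Q ∈ T, Q ≠ P → eval Q.rep A = 0 ∧ eval Q.rep (dirDeriv (w Q) A) = 0 := by
    intro P hP
    set E : MvPolynomial (Fin 4) ℂ := linForm (s P P) ^ (N - 1 - 2 * (T.erase P).card) *
      ∏ Q ∈ T.erase P, linForm (s P Q) ^ 2 with hE
    have hcard : 2 * (T.erase P).card ≤ N - 1 := by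
      have := Finset.card_erase_le (s := T) (a := P)
      omega
    have hEh : E.IsHomogeneous (N - 1) := by
      have h1 : (∏ Q ∈ T.erase P, linForm (s P Q) ^ 2).IsHomogeneous (2 * (T.erase P).card) := by
        have := IsHomogeneous.prod (T.erase P) (fun Q => linForm (s P Q) ^ 2) (fun _ => 2)
          fun Q _ => (isHomogeneous_linForm (s P Q)).pow 2
        simpa [mul_comm] using this
      have := ((isHomogeneous_linForm (s P P)).pow (N - 1 - 2 * (T.erase P).card)).mul h1
      rwa [one_mul, Nat.sub_add_cancel hcard] at this
    have hEP : eval P.rep E = 1 := by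
      simp [hE, map_prod, eval_linForm, hs]
    obtain ⟨f, hf1, hf2⟩ := exists_dual_apply_eq (hw P hP) (α P)
      (β P - α P * eval P.rep (dirDeriv (w P) E))
    refine ⟨E * linForm f, ?_, ⟨?_, ?_⟩, fun Q hQ hQP => ?_⟩
    · have := hEh.mul (isHomogeneous_linForm f)
      rwa [Nat.sub_add_cancel (by omega)] at this
    · rw [map_mul, hEP, eval_linForm, hf1, one_mul]
    · rw [Derivation.leibniz, dirDeriv_linForm]
      simp only [smul_eq_mul, map_add, map_mul, hEP, eval_C, hf2, eval_linForm, hf1]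
      ring
    · obtain ⟨R, hR⟩ : linForm (s P Q) ^ 2 ∣ E * linForm f := by
        refine Dvd.dvd.mul_right (Dvd.dvd.mul_left ?_ _) _
        exact Finset.dvd_prod_of_mem (fun Q => linForm (s P Q) ^ 2)
          (Finset.mem_erase.mpr ⟨hQP, hQ⟩)
      have h0 : eval Q.rep (linForm (s P Q)) = 0 := by
        rw [eval_linForm, hs' P Q hQP.symm]
      rw [hR]
      constructor
      · simp [h0]
      · rw [sq, mul_assoc, Derivation.leibniz, Derivation.leibniz]
        simp [h0]
  choose! A hA hAP hAQ using hone
  refine ⟨∑ P ∈ T, A P, IsHomogeneous.sum _ _ _ hA, fun P hP => ?_⟩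
  rw [map_sum, map_sum, map_sum, Finset.sum_eq_single_of_mem P hP, Finset.sum_eq_single_of_mem P hP]
  · exact hAP P hP
  · exact fun Q hQ hQP => (hAQ Q hQ P hP hQP.symm).2
  · exact fun Q hQ hQP => (hAQ Q hQ P hP hQP.symm).1

/-- Zeros of order two, in the tangent directions of the curve, of a form count twice. -/
theorem IrreducibleCurve.two_mul_card_le (C : IrreducibleCurve) {G : MvPolynomial (Fin 4) ℂ}
    {g : ℕ} (hG : G.IsHomogeneous g) (hGC : ¬ VanishesOn G C.carrier) (T : Finset P3)
    (hT : ∀ P ∈ T, P ∈ C.carrier) (hT0 : ∀ P ∈ T, eval P.rep G = 0)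
    (hT1 : ∀ P ∈ T, ∀ w, IsTangentVector C.carrier P.rep w → eval P.rep (dirDeriv w G) = 0) :
    2 * T.card ≤ C.degree * g := by
  choose! w hw hwt using fun (P : P3) (hP : P ∈ T) => C.exists_tangentVector (hT P hP)
  obtain ⟨k, hk⟩ := C.hilbert
  obtain ⟨n₀, hn₀⟩ := Filter.eventually_atTop.mp hk
  set m := n₀ + 2 * T.card + 1 with hm
  let Λ : homogeneousSubmodule (Fin 4) ℂ (g + m) →ₗ[ℂ] (T → ℂ × ℂ) :=
    LinearMap.pi fun P => ((aeval (R := ℂ) P.1.rep).toLinearMap.prod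
      ((aeval (R := ℂ) P.1.rep).toLinearMap ∘ₗ (dirDeriv (w P)).toLinearMap)) ∘ₗ
      (homogeneousSubmodule (Fin 4) ℂ (g + m)).subtype
  have hΛ : ∀ A P, Λ A P = (eval P.1.rep (A : MvPolynomial (Fin 4) ℂ),
      eval P.1.rep (dirDeriv (w P) (A : MvPolynomial (Fin 4) ℂ))) := by
    intro A P
    simp [Λ, aeval_eq_eval]
  have key := C.finrank_add_hilbertFunction_le hG hGC Λ ?_ ?_ ?_
  · have e1 := hn₀ m (by omega)
    have e2 := hn₀ (g + m) (by omega)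
    have e3 : Module.finrank ℂ (T → ℂ × ℂ) = 2 * T.card := by
      simp [Module.finrank_pi_fintype, mul_comm]
    rw [e3] at key
    zify at key ⊢
    rw [e1, e2] at key
    push_cast at key
    linarith
  · intro y
    classical
    obtain ⟨A, hA, hAP⟩ := exists_form_apply_eq T w hw (N := g + m) (by omega)
      (fun P => if h : P ∈ T then (y ⟨P, h⟩).1 else 0)
      (fun P => if h : P ∈ T then (y ⟨P, h⟩).2 else 0)
    refine ⟨⟨A, hA⟩, funext fun P => ?_⟩
    rw [hΛ, (hAP P.1 P.2).1, (hAP P.1 P.2).2]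
    simp
  · intro A hA
    ext1 P
    rw [hΛ, hA P.1 (hT P.1 P.2), hwt P.1 P.2 _ _ A.2 hA]
    rfl
  · intro A B hAB
    ext1 P
    rw [hΛ, hAB, Derivation.leibniz]
    simp [hT0 P.1 P.2, hT1 P.1 P.2 _ (hwt P.1 P.2)]

/-- A weak form of Bézout's theorem. -/
theorem IrreducibleCurve.card_le (C : IrreducibleCurve) {G : MvPolynomial (Fin 4) ℂ}
    {g : ℕ} (hG : G.IsHomogeneous g) (hGC : ¬ VanishesOn G C.carrier) (T : Finset P3)
    (hT : ∀ P ∈ T, P ∈ C.carrier) (hT0 : ∀ P ∈ T, eval P.rep G = 0) :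
    T.card ≤ C.degree * g := by
  have h2 : ¬ VanishesOn (G * G) C.carrier := fun h => hGC ((C.vanishesOn_or hG hG h).elim id id)
  have := C.two_mul_card_le (hG.mul hG) h2 T hT (fun P hP => by simp [hT0 P hP])
    fun P hP w _ => by simp [Derivation.leibniz, hT0 P hP]
  nlinarith

/-! ### Homogeneous polynomials: divisors and dimensions -/

/-- Substituting `T X i` for `X i`, with a new variable `T`, gives the polynomial in `T` whose
coefficients are the homogeneous components. -/
theorem coeff_aeval_C_X_mul_X {σ : Type*} (x : MvPolynomial σ ℂ) (k : ℕ) :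
    (aeval (fun i => (Polynomial.X : Polynomial (MvPolynomial σ ℂ)) * Polynomial.C (X i)) x).coeff k
      = homogeneousComponent k x := by
  induction x using MvPolynomial.induction_on' with
  | monomial m a =>
    have h := aeval_mul_of_isHomogeneous (isHomogeneous_monomial (d := m) a rfl)
      (Polynomial.X : Polynomial (MvPolynomial σ ℂ)) (fun i => Polynomial.C (X i))
    rw [h]
    have h2 : aeval (fun i => (Polynomial.C (X i) : Polynomial (MvPolynomial σ ℂ))) (monomial m a) =
        Polynomial.C (monomial m a) := by
      have := MvPolynomial.map_aeval (fun i => (X i : MvPolynomial σ ℂ))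
        (Polynomial.C : MvPolynomial σ ℂ →+* _) (monomial m a)
      rw [aeval_X_left_apply] at this
      rw [this]
      rfl
    rw [h2, mul_comm, Polynomial.coeff_C_mul_X_pow]
    rw [homogeneousComponent_of_mem (isHomogeneous_monomial (d := m) a rfl)]
  | add p q hp hq => rw [map_add, Polynomial.coeff_add, hp, hq, map_add]

/-- Divisors of nonzero forms are forms. -/
theorem isHomogeneous_of_mul_left {σ : Type*} {x y : MvPolynomial σ ℂ} {n : ℕ}
    (h : (x * y).IsHomogeneous n) (h0 : x * y ≠ 0) : ∃ k ≤ n, x.IsHomogeneous k ∧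
      y.IsHomogeneous (n - k) := by
  set θ : MvPolynomial σ ℂ →ₐ[ℂ] Polynomial (MvPolynomial σ ℂ) :=
    aeval (fun i => (Polynomial.X : Polynomial (MvPolynomial σ ℂ)) * Polynomial.C (X i)) with hθ
  have hθc : ∀ z k, (θ z).coeff k = homogeneousComponent k z := coeff_aeval_C_X_mul_X
  have hθ0 : ∀ z, z ≠ 0 → θ z ≠ 0 := by
    intro z hz hz'
    apply hz
    rw [← sum_homogeneousComponent z]
    exact Finset.sum_eq_zero fun i _ => by rw [← hθc, hz', Polynomial.coeff_zero]
  have hxy : θ x * θ y = Polynomial.C (x * y) * Polynomial.X ^ n := by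
    rw [← map_mul]
    ext1 k
    rw [hθc, homogeneousComponent_of_mem h, Polynomial.coeff_C_mul_X_pow]
  have hx := hθ0 x (left_ne_zero_of_mul h0)
  have hy := hθ0 y (right_ne_zero_of_mul h0)
  have hd := Polynomial.natDegree_mul hx hy
  have ht := Polynomial.natTrailingDegree_mul hx hy
  rw [hxy, Polynomial.natDegree_C_mul_X_pow n _ h0] at hd
  rw [hxy, Polynomial.natTrailingDegree_mul_X_pow (by simpa using h0),
    Polynomial.natTrailingDegree_C, zero_add] at ht
  have h1 := (θ x).natTrailingDegree_le_natDegree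
  have h2 := (θ y).natTrailingDegree_le_natDegree
  have hhom : ∀ z k, (θ z).natDegree = k → (θ z).natTrailingDegree = k → z.IsHomogeneous k := by
    intro z k hk hk'
    have : z = homogeneousComponent k z := by
      conv_lhs => rw [← sum_homogeneousComponent z]
      by_cases hkz : k ∈ Finset.range (z.totalDegree + 1)
      · refine Finset.sum_eq_single_of_mem k hkz fun i _ hik => ?_
        rw [← hθc]
        rcases lt_or_gt_of_ne hik with h | h
        · exact Polynomial.coeff_eq_zero_of_lt_natTrailingDegree (hk' ▸ h)
        · exact Polynomial.coeff_eq_zero_of_natDegree_lt (hk ▸ h)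
      · rw [homogeneousComponent_eq_zero k z (by simpa [Nat.lt_succ_iff] using hkz)]
        refine Finset.sum_eq_zero fun i hi => ?_
        rw [← hθc]
        refine Polynomial.coeff_eq_zero_of_lt_natTrailingDegree ?_
        rw [hk']
        simp only [Finset.mem_range] at hi hkz
        omega
    rw [this]
    exact homogeneousComponent_isHomogeneous k z
  refine ⟨(θ x).natDegree, by omega, hhom x _ rfl (by omega), hhom y _ (by omega) (by omega)⟩

theorem isHomogeneous_of_mul_right {σ : Type*} {x y : MvPolynomial σ ℂ} {k n : ℕ}
    (h : (x * y).IsHomogeneous n) (hx : x.IsHomogeneous k) (h0 : x * y ≠ 0) :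
    k ≤ n ∧ y.IsHomogeneous (n - k) := by
  obtain ⟨j, hj, hxj, hy⟩ := isHomogeneous_of_mul_left h h0
  obtain rfl := hx.inj_right hxj (left_ne_zero_of_mul h0)
  exact ⟨hj, hy⟩

/-- The ternary forms of degree `n`. -/
abbrev ternaryForms (n : ℕ) : Submodule ℂ (MvPolynomial (Fin 3) ℂ) :=
  homogeneousSubmodule (Fin 3) ℂ n

theorem two_mul_finrank_ternary (n : ℕ) :
    2 * Module.finrank ℂ (ternaryForms n) = (n + 1) * (n + 2) := by
  have h1 : Module.finrank ℂ (ternaryForms n) =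
      Nat.card {d : Fin 3 →₀ ℕ | d.degree = n} := by
    rw [ternaryForms, homogeneousSubmodule_eq_finsupp_supported,
      (AddMonoidAlgebra.supportedEquivFinsupp {d : Fin 3 →₀ ℕ | d.degree = n}).finrank_eq]
    exact Module.finrank_eq_nat_card_basis Finsupp.basisSingleOne
  have h2 : {d : Fin 3 →₀ ℕ | d.degree = n} =
      ((Finset.univ : Finset (Fin 3)).finsuppAntidiag n : Set (Fin 3 →₀ ℕ)) := by
    ext d
    simp [Finsupp.degree_eq_sum]
  rw [h1, h2, Nat.card_eq_card_toFinset, Finset.toFinset_coe,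
    Finset.card_finsuppAntidiag_nat_eq_choose]
  have h3 : (Finset.univ : Finset (Fin 3)).card + n - 1 = n + 2 := by simp; omega
  rw [h3, Nat.choose_symm_add, Nat.choose_two_right,
    Nat.mul_div_cancel' (Nat.even_mul_pred_self _).two_dvd, mul_comm]
  rfl

/-! ### Plane curves -/

/-- Linear substitution, i.e. composition of polynomial functions with the linear map `L`. -/
def linSubst {n m : ℕ} (L : (Fin n → ℂ) →ₗ[ℂ] (Fin m → ℂ)) :
    MvPolynomial (Fin m) ℂ →ₐ[ℂ] MvPolynomial (Fin n) ℂ :=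
  aeval fun i => linForm (LinearMap.proj i ∘ₗ L)

theorem eval_linSubst {n m : ℕ} (L : (Fin n → ℂ) →ₗ[ℂ] (Fin m → ℂ)) (q : Fin n → ℂ)
    (G : MvPolynomial (Fin m) ℂ) : eval q (linSubst L G) = eval (L q) G := by
  have h := MvPolynomial.map_aeval (fun i => linForm (LinearMap.proj i ∘ₗ L)) (eval q) G
  rw [linSubst, h, MvPolynomial.eval, MvPolynomial.coe_eval₂Hom]
  congr 1
  · ext; simp
  · ext i
    exact eval_linForm _ _

theorem isHomogeneous_linSubst {n m k : ℕ} (L : (Fin n → ℂ) →ₗ[ℂ] (Fin m → ℂ))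
    {G : MvPolynomial (Fin m) ℂ} (hG : G.IsHomogeneous k) : (linSubst L G).IsHomogeneous k := by
  have := hG.aeval (n := 1) (fun i => linForm (LinearMap.proj i ∘ₗ L))
    fun i => isHomogeneous_linForm _
  rwa [one_mul] at this

theorem dirDeriv_linSubst {n m : ℕ} (L : (Fin n → ℂ) →ₗ[ℂ] (Fin m → ℂ)) (w : Fin n → ℂ)
    (G : MvPolynomial (Fin m) ℂ) :
    dirDeriv w (linSubst L G) = linSubst L (dirDeriv (L w) G) := by
  rw [linSubst, derivation_aeval, aeval_dirDeriv]
  refine Finset.sum_congr rfl fun i _ => ?_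
  rw [dirDeriv_linForm, mul_comm]
  rfl

/-- The ternary forms of degree `n` that vanish on the curve `V` contained in a plane. The map `π`
gives coordinates on the plane. -/
def planeForms (V : Set P3) (π : (Fin 4 → ℂ) →ₗ[ℂ] (Fin 3 → ℂ)) (n : ℕ) :
    Submodule ℂ (ternaryForms n) where
  carrier := {g | VanishesOn (linSubst π (g : MvPolynomial (Fin 3) ℂ)) V}
  add_mem' {a b} ha hb Q hQ := by
    simp [map_add, ha Q hQ, hb Q hQ]
  zero_mem' Q _ := by simp
  smul_mem' c a ha Q hQ := by
    simp [ha Q hQ]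

theorem hilbertFunction_add_finrank_planeForms {V : Set P3} {ι : (Fin 3 → ℂ) →ₗ[ℂ] (Fin 4 → ℂ)}
    {π : (Fin 4 → ℂ) →ₗ[ℂ] (Fin 3 → ℂ)} (h : ∀ Q ∈ V, ι (π Q.rep) = Q.rep) (n : ℕ) :
    hilbertFunction V n + Module.finrank ℂ (planeForms V π n) =
      Module.finrank ℂ (ternaryForms n) := by
  let μ : ternaryForms n →ₗ[ℂ] homogeneousSubmodule (Fin 4) ℂ n :=
    ((linSubst π).toLinearMap.comp (ternaryForms n).subtype).codRestrict _
      fun g => isHomogeneous_linSubst π g.2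
  let Λ := (vanishingForms V n).mkQ ∘ₗ μ
  have hker : LinearMap.ker Λ = planeForms V π n := by
    ext g
    simp only [Λ, LinearMap.mem_ker, LinearMap.comp_apply, Submodule.mkQ_apply,
      Submodule.Quotient.mk_eq_zero]
    rfl
  have hrange : LinearMap.range Λ = ⊤ := by
    refine LinearMap.range_eq_top.mpr fun x => ?_
    obtain ⟨G, rfl⟩ := Submodule.mkQ_surjective _ x
    refine ⟨⟨linSubst ι (G : MvPolynomial (Fin 4) ℂ), isHomogeneous_linSubst ι G.2⟩, ?_⟩
    refine (Submodule.Quotient.eq _).mpr fun Q hQ => ?_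
    have : eval Q.rep (linSubst π (linSubst ι (G : MvPolynomial (Fin 4) ℂ)) -
        (G : MvPolynomial (Fin 4) ℂ)) = 0 := by
      rw [map_sub, eval_linSubst, eval_linSubst, h Q hQ, sub_self]
    exact this
  have := LinearMap.finrank_range_add_finrank_ker Λ
  rw [hrange, hker, finrank_top] at this
  exact this

/-- If all forms on `V` are multiples of a form `c` of degree `a`, their dimension is bounded by that
of the space of cofactors. -/
theorem finrank_le_of_multiples {V : Set P3} {π : (Fin 4 → ℂ) →ₗ[ℂ] (Fin 3 → ℂ)} {a n : ℕ}
    {c : MvPolynomial (Fin 3) ℂ} (hc : c.IsHomogeneous a)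
    (h : ∀ g ∈ planeForms V π (a + n), c ∣ (g : MvPolynomial (Fin 3) ℂ)) :
    Module.finrank ℂ (planeForms V π (a + n)) ≤
      Module.finrank ℂ (ternaryForms n) := by
  let μ : ternaryForms n →ₗ[ℂ] ternaryForms (a + n) :=
    ((LinearMap.mulLeft ℂ c).comp (ternaryForms n).subtype).codRestrict _
      fun g => hc.mul g.2
  have hle : planeForms V π (a + n) ≤ LinearMap.range μ := by
    intro g hg
    obtain ⟨r, hr⟩ := h g hg
    by_cases hg0 : (g : MvPolynomial (Fin 3) ℂ) = 0
    · exact ⟨0, by rw [map_zero]; exact Subtype.ext hg0.symm⟩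
    · have h1 := isHomogeneous_of_mul_right (hr ▸ g.2) hc (hr ▸ hg0)
      exact ⟨⟨r, by simpa using h1.2⟩, Subtype.ext hr.symm⟩
  exact (Submodule.finrank_mono hle).trans (LinearMap.finrank_range_le μ)

theorem finrank_multiples_le {V : Set P3} {π : (Fin 4 → ℂ) →ₗ[ℂ] (Fin 3 → ℂ)} {a n : ℕ}
    {c : MvPolynomial (Fin 3) ℂ} (hc : c.IsHomogeneous a) (hc0 : c ≠ 0)
    (hcV : VanishesOn (linSubst π c) V) :
    Module.finrank ℂ (ternaryForms n) ≤
      Module.finrank ℂ (planeForms V π (a + n)) := by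
  let μ : ternaryForms n →ₗ[ℂ] planeForms V π (a + n) :=
    (((LinearMap.mulLeft ℂ c).comp (ternaryForms n).subtype).codRestrict
      (ternaryForms (a + n)) fun g => hc.mul g.2).codRestrict _
      fun g Q hQ => by
        have : eval Q.rep (linSubst π (c * (g : MvPolynomial (Fin 3) ℂ))) = 0 := by
          rw [map_mul, map_mul, hcV Q hQ, zero_mul]
        exact this
  refine LinearMap.finrank_le_finrank_of_injective (f := μ) ?_
  intro g g' hgg
  have h1 : c * (g : MvPolynomial (Fin 3) ℂ) = c * (g' : MvPolynomial (Fin 3) ℂ) :=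
    congrArg (fun x : planeForms V π (a + n) =>
      ((x : ternaryForms (a + n)) : MvPolynomial (Fin 3) ℂ)) hgg
  exact Subtype.ext (mul_left_cancel₀ hc0 h1)

/-- If two ternary forms without common factor vanish on `V` then there are many such forms. -/
theorem finrank_add_le_of_not_dvd {V : Set P3} {π : (Fin 4 → ℂ) →ₗ[ℂ] (Fin 3 → ℂ)} {a b n : ℕ}
    {c g : MvPolynomial (Fin 3) ℂ} (hc : c.IsHomogeneous a) (hg : g.IsHomogeneous b)
    (hcp : Prime c) (hcg : ¬ c ∣ g) (hcV : VanishesOn (linSubst π c) V)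
    (hgV : VanishesOn (linSubst π g) V) :
    Module.finrank ℂ (ternaryForms (b + n)) +
      Module.finrank ℂ (ternaryForms (a + n)) ≤
      Module.finrank ℂ (planeForms V π (a + b + n)) +
      Module.finrank ℂ (ternaryForms n) := by
  let ψ : (ternaryForms (b + n) × ternaryForms (a + n)) →ₗ[ℂ]
      MvPolynomial (Fin 3) ℂ :=
    LinearMap.coprod ((LinearMap.mulLeft ℂ c).comp (ternaryForms (b + n)).subtype)
      ((LinearMap.mulLeft ℂ g).comp (ternaryForms (a + n)).subtype)
  have hψ : ∀ x, ψ x = c * (x.1 : MvPolynomial (Fin 3) ℂ) + g * (x.2 : MvPolynomial (Fin 3) ℂ) :=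
    fun x => rfl
  have hψh : ∀ x, ψ x ∈ ternaryForms (a + b + n) := by
    intro x
    rw [hψ]
    refine Submodule.add_mem _ ?_ ?_
    · have := hc.mul x.1.2
      rwa [← add_assoc] at this
    · have := hg.mul x.2.2
      rwa [← add_assoc, add_comm b a] at this
  let μ : (ternaryForms (b + n) × ternaryForms (a + n)) →ₗ[ℂ]
      planeForms V π (a + b + n) :=
    (ψ.codRestrict (ternaryForms (a + b + n)) hψh).codRestrict _ fun x Q hQ => by
      have : eval Q.rep (linSubst π (ψ x)) = 0 := by
        rw [hψ, map_add, map_mul, map_mul, map_add, map_mul, map_mul, hcV Q hQ, hgV Q hQ, zero_mul,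
          zero_mul, add_zero]
      exact this
  have hμ : ∀ x, μ x = 0 → ψ x = 0 := fun x hx =>
    congrArg (fun x : planeForms V π (a + b + n) =>
      ((x : ternaryForms (a + b + n)) : MvPolynomial (Fin 3) ℂ)) hx
  have hker : Module.finrank ℂ (LinearMap.ker μ) ≤ Module.finrank ℂ (ternaryForms n) := by
    let ν : ternaryForms n →ₗ[ℂ] ternaryForms (b + n) × ternaryForms (a + n) :=
      LinearMap.prod
      (((LinearMap.mulLeft ℂ (-g)).comp (ternaryForms n).subtype).codRestrict (ternaryForms (b + n))
        fun u => hg.neg.mul u.2)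
      (((LinearMap.mulLeft ℂ c).comp (ternaryForms n).subtype).codRestrict (ternaryForms (a + n))
        fun u => hc.mul u.2)
    have hle : LinearMap.ker μ ≤ LinearMap.range ν := by
      rintro ⟨u, v⟩ hx
      have h1 := hμ _ hx
      rw [hψ] at h1
      have h2 : c ∣ (v : MvPolynomial (Fin 3) ℂ) := by
        refine (hcp.dvd_or_dvd ?_).resolve_left hcg
        exact ⟨-u, by linear_combination h1⟩
      obtain ⟨r, hr⟩ := h2
      have h3 : (u : MvPolynomial (Fin 3) ℂ) = -g * r := by
        apply mul_left_cancel₀ hcp.ne_zero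
        rw [hr] at h1
        linear_combination h1
      by_cases hv0 : (v : MvPolynomial (Fin 3) ℂ) = 0
      · have hr0 : r = 0 := by
          rw [hv0] at hr
          exact (mul_eq_zero.mp hr.symm).resolve_left hcp.ne_zero
        refine ⟨0, ?_⟩
        rw [map_zero]
        refine Prod.ext (Subtype.ext ?_) (Subtype.ext hv0.symm)
        rw [h3, hr0, mul_zero]
        rfl
      · have h4 := isHomogeneous_of_mul_right (hr ▸ v.2) hc (hr ▸ hv0)
        exact ⟨⟨r, by simpa using h4.2⟩, Prod.ext (Subtype.ext h3.symm) (Subtype.ext hr.symm)⟩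
    exact (Submodule.finrank_mono hle).trans (LinearMap.finrank_range_le ν)
  have e1 := LinearMap.finrank_range_add_finrank_ker (V := ternaryForms (b + n) ×
    ternaryForms (a + n)) (V₂ := planeForms V π (a + b + n)) μ
  have e2 := Submodule.finrank_le (LinearMap.range μ)
  rw [Module.finrank_prod] at e1
  omega

theorem IrreducibleCurve.exists_lt_hilbertFunction (C : IrreducibleCurve) (B : ℕ) :
    ∃ n₀, ∀ n ≥ n₀, B < hilbertFunction C.carrier n := by
  obtain ⟨k, hk⟩ := C.hilbert
  obtain ⟨n₀, hn₀⟩ := Filter.eventually_atTop.mp hk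
  refine ⟨n₀ + B + 1 + k.natAbs, fun n hn => ?_⟩
  have hd : (1 : ℤ) ≤ C.degree := by exact_mod_cast C.degree_pos
  have h1 := hn₀ n (by omega)
  have h3 : (n : ℤ) ≤ C.degree * n := le_mul_of_one_le_left (by positivity) hd
  omega

/-- The ideal of a plane curve is generated, in the plane, by an irreducible form whose degree is
the degree of the curve. -/
theorem IrreducibleCurve.exists_planeEquation (C : IrreducibleCurve)
    {ι : (Fin 3 → ℂ) →ₗ[ℂ] (Fin 4 → ℂ)} {π : (Fin 4 → ℂ) →ₗ[ℂ] (Fin 3 → ℂ)}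
    (h : ∀ Q ∈ C.carrier, ι (π Q.rep) = Q.rep) :
    ∃ c : MvPolynomial (Fin 3) ℂ, c.IsHomogeneous C.degree ∧ Prime c ∧
      ∀ (n : ℕ) (g : MvPolynomial (Fin 3) ℂ), g.IsHomogeneous n →
        (VanishesOn (linSubst π g) C.carrier ↔ c ∣ g) := by
  classical
  have hH := hilbertFunction_add_finrank_planeForms h
  have hN := two_mul_finrank_ternary
  obtain ⟨k, hk⟩ := C.hilbert
  obtain ⟨n₀, hn₀⟩ := Filter.eventually_atTop.mp hk
  have hex : ∃ a, ∃ c : MvPolynomial (Fin 3) ℂ, c.IsHomogeneous a ∧ c ≠ 0 ∧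
      VanishesOn (linSubst π c) C.carrier := by
    by_contra hno
    have h0 : ∀ n, Module.finrank ℂ (planeForms C.carrier π n) = 0 := by
      intro n
      have : planeForms C.carrier π n = ⊥ := by
        rw [Submodule.eq_bot_iff]
        intro g hg
        by_contra hg0
        exact hno ⟨n, g, g.2, fun hh => hg0 (Subtype.ext hh), hg⟩
      rw [this, finrank_bot]
    have e : ∀ n ≥ n₀, 2 * ((C.degree : ℤ) * n + k) = (n + 1) * (n + 2) := by
      intro n hn
      have h1 := hH n
      have h2 := hN n
      rw [h0, add_zero] at h1
      rw [← h1] at h2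
      rw [← hn₀ n hn]
      exact_mod_cast h2
    -- a linear function of `n` is not quadratic
    have e0 := e n₀ le_rfl
    have e1 := e (n₀ + 1) (by omega)
    have e2 := e (n₀ + 2) (by omega)
    push_cast at e0 e1 e2
    linarith
  obtain ⟨c, hc, hc0, hcV⟩ := Nat.find_spec hex
  set a := Nat.find hex with ha
  have hmin : ∀ {n : ℕ} {g : MvPolynomial (Fin 3) ℂ}, g.IsHomogeneous n → g ≠ 0 →
      VanishesOn (linSubst π g) C.carrier → a ≤ n := fun hg hg0 hgV =>
    Nat.find_min' hex ⟨_, hg, hg0, hgV⟩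
  obtain ⟨P, hP⟩ := C.infinite.nonempty
  have hunit : ∀ x : MvPolynomial (Fin 3) ℂ, x.IsHomogeneous 0 → x ≠ 0 → IsUnit x := by
    intro x hx hx0
    have h1 := totalDegree_eq_zero_iff_eq_C.mp (Nat.le_zero.mp hx.totalDegree_le)
    rw [h1]
    refine IsUnit.map _ (IsUnit.mk0 _ fun h0 => hx0 ?_)
    rw [h1, h0, C_0]
  have hirr : Irreducible c := by
    refine ⟨fun hu => ?_, fun x y hxy => ?_⟩
    · have h1 := (hu.map (linSubst π)).map (eval P.rep)
      rw [hcV P hP] at h1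
      exact not_isUnit_zero h1
    · subst hxy
      obtain ⟨j, hj, hx, hy⟩ := isHomogeneous_of_mul_left hc hc0
      have hx0 := left_ne_zero_of_mul hc0
      have hy0 := right_ne_zero_of_mul hc0
      rw [map_mul] at hcV
      rcases C.vanishesOn_or (isHomogeneous_linSubst π hx) (isHomogeneous_linSubst π hy) hcV
        with h1 | h1
      · have := hmin hx hx0 h1
        exact Or.inr (hunit y (by rwa [show a - j = 0 by omega] at hy) hy0)
      · have := hmin hy hy0 h1
        exact Or.inl (hunit x (by rwa [show j = 0 by omega] at hx) hx0)
  have hprime : Prime c := hirr.prime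
  have hdvd : ∀ (n : ℕ) (g : MvPolynomial (Fin 3) ℂ), g.IsHomogeneous n →
      VanishesOn (linSubst π g) C.carrier → c ∣ g := by
    intro b g hg hgV
    by_contra hcg
    obtain ⟨n₁, hn₁⟩ := C.exists_lt_hilbertFunction (a * b)
    have h1 := finrank_add_le_of_not_dvd (n := n₁) hc hg hprime hcg hcV hgV
    have h2 := hH (a + b + n₁)
    have h3 := hn₁ (a + b + n₁) (by omega)
    have f1 := hN (a + b + n₁)
    have f2 := hN (b + n₁)
    have f3 := hN (a + n₁)
    have f4 := hN n₁
    nlinarith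
  have hdeg : a = C.degree := by
    have e : ∀ n ≥ n₀, 2 * ((C.degree : ℤ) * (a + n) + k) + (n + 1) * (n + 2) =
        (a + n + 1) * (a + n + 2) := by
      intro n hn
      have h1 := hH (a + n)
      have h2 := hN (a + n)
      have h3 := hN n
      have h4 := finrank_multiples_le (n := n) hc hc0 hcV
      have h5 := finrank_le_of_multiples (V := C.carrier) (π := π) (n := n) hc
        fun g hg => hdvd _ _ g.2 hg
      have h6 := hn₀ (a + n) (by omega)
      have h7 : Module.finrank ℂ (planeForms C.carrier π (a + n)) =
        Module.finrank ℂ (ternaryForms n) := le_antisymm h5 h4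
      rw [h7] at h1
      rw [← h1] at h2
      zify at h2 h3
      rw [h6] at h2
      push_cast at h2
      linarith
    have e0 := e n₀ le_rfl
    have e1 := e (n₀ + 1) (by omega)
    push_cast at e0 e1
    have : (a : ℤ) = C.degree := by linarith
    exact_mod_cast this
  refine ⟨c, hdeg ▸ hc, hprime, fun n g hg => ⟨hdvd n g hg, ?_⟩⟩
  rintro ⟨r, rfl⟩ Q hQ
  rw [map_mul, map_mul, hcV Q hQ, zero_mul]

theorem exists_not_dvd_pderiv {d : ℕ} (hd : 0 < d) {c : MvPolynomial (Fin 3) ℂ}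
    (hc : c.IsHomogeneous d) (hc0 : c ≠ 0) : ∃ j, ¬ c ∣ pderiv j c := by
  by_contra! hno
  have h2 : ∀ j, pderiv j c = 0 := by
    intro j
    obtain ⟨r, hr⟩ := hno j
    by_contra h0
    have h3 := (hr ▸ hc.pderiv : (c * r).IsHomogeneous (d - 1))
    have h4 := (isHomogeneous_of_mul_right h3 hc (hr ▸ h0)).1
    omega
  have h3 := hc.sum_X_mul_pderiv
  simp only [h2, mul_zero, Finset.sum_const_zero, nsmul_eq_mul] at h3
  rcases mul_eq_zero.mp h3.symm with h4 | h4
  · exact hd.ne' (by exact_mod_cast h4)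
  · exact hc0 h4

/-- A ternary form that is singular along a plane curve is divisible by the square of its
equation. -/
theorem exists_eq_sq_mul {V : Set P3} {π : (Fin 4 → ℂ) →ₗ[ℂ] (Fin 3 → ℂ)} {d n : ℕ} (hd : 0 < d)
    {c f : MvPolynomial (Fin 3) ℂ} (hc : c.IsHomogeneous d) (hcp : Prime c)
    (hcV : ∀ (n : ℕ) (g : MvPolynomial (Fin 3) ℂ), g.IsHomogeneous n →
      (VanishesOn (linSubst π g) V ↔ c ∣ g))
    (hf : f.IsHomogeneous n) (hfV : ∀ j, VanishesOn (linSubst π (pderiv j f)) V)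
    (hfV0 : VanishesOn (linSubst π f) V) : ∃ h, f = c ^ 2 * h := by
  obtain ⟨g, rfl⟩ := (hcV _ _ hf).mp hfV0
  have h1 : ∀ j, c ∣ g * pderiv j c := by
    intro j
    have h2 := (hcV _ _ hf.pderiv).mp (hfV j)
    rw [Derivation.leibniz, smul_eq_mul, smul_eq_mul] at h2
    exact (dvd_add_right (dvd_mul_right c _)).mp h2
  obtain ⟨j, hj⟩ := exists_not_dvd_pderiv hd hc hcp.ne_zero
  obtain ⟨h, rfl⟩ := (hcp.dvd_or_dvd (h1 j)).resolve_right hj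
  exact ⟨h, by ring⟩

/-! ### Curves and lines -/

theorem natDegree_lineRestriction_le {G : MvPolynomial (Fin 4) ℂ} {n : ℕ} (hG : G.IsHomogeneous n)
    (u v : Fin 4 → ℂ) : (lineRestriction G u v).natDegree ≤ n := by
  have := aeval_natDegree_le (n := 1) G hG.totalDegree_le
    (fun i => Polynomial.C (u i) + Polynomial.X * Polynomial.C (v i)) fun i => by compute_degree
  rwa [mul_one] at this

theorem eval_eq_zero_of_lineRestriction {G : MvPolynomial (Fin 4) ℂ} {n : ℕ}
    (hG : G.IsHomogeneous n) {u v : Fin 4 → ℂ} (h : lineRestriction G u v = 0)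
    (hv : eval v G = 0) {q : Fin 4 → ℂ} (hq : q ∈ Submodule.span ℂ {u, v}) : eval q G = 0 := by
  obtain ⟨a, b, rfl⟩ := Submodule.mem_span_pair.mp hq
  by_cases ha : a = 0
  · rw [ha, zero_smul, zero_add, eval_smul_of_isHomogeneous hG, hv, mul_zero]
  · have h1 : a • u + b • v = a • (u + (b / a) • v) := by
      rw [smul_add, smul_smul, mul_div_cancel₀ b ha]
    rw [h1, eval_smul_of_isHomogeneous hG, ← eval_lineRestriction, h, Polynomial.eval_zero,
      mul_zero]

/-- A curve of degree at least two is not contained in a line. -/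
theorem IrreducibleCurve.exists_notMem_span (C : IrreducibleCurve) (hC : 2 ≤ C.degree)
    (u v : Fin 4 → ℂ) : ∃ A ∈ C.carrier, A.rep ∉ Submodule.span ℂ {u, v} := by
  by_contra! hno
  have hle : ∀ n, hilbertFunction C.carrier n ≤ n + 2 := by
    intro n
    have := hilbertFunction_le_card (V := C.carrier) (n := n) (ι := Option (Fin (n + 1)))
      (fun o => o.elim v fun i => u + (i : ℂ) • v) ?_
    · simpa using this
    · intro A hA hA0 Q hQ
      refine eval_eq_zero_of_lineRestriction hA ?_ (hA0 none) (hno Q hQ)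
      refine Polynomial.eq_zero_of_natDegree_lt_card_of_eval_eq_zero _
        (f := fun i : Fin (n + 1) => (i : ℂ)) ?_ ?_ ?_
      · intro i j hij
        exact Fin.ext (Nat.cast_injective (R := ℂ) hij)
      · intro i
        rw [eval_lineRestriction]
        exact hA0 (some i)
      · have := natDegree_lineRestriction_le hA u v
        simpa using Nat.lt_succ_of_le this
  obtain ⟨k, hk⟩ := C.hilbert
  obtain ⟨n₀, hn₀⟩ := Filter.eventually_atTop.mp hk
  have h1 := hn₀ (n₀ + 3 + k.natAbs) (by omega)
  have h2 := hle (n₀ + 3 + k.natAbs)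
  have hd : (2 : ℤ) ≤ C.degree := by exact_mod_cast hC
  have h3 : 2 * ((n₀ + 3 + k.natAbs : ℕ) : ℤ) ≤ C.degree * ((n₀ + 3 + k.natAbs : ℕ) : ℤ) :=
    mul_le_mul_of_nonneg_right hd (by positivity)
  omega

theorem IrreducibleCurve.exists_ne (C : IrreducibleCurve) :
    ∃ P ∈ C.carrier, ∃ Q ∈ C.carrier, P ≠ Q := by
  obtain ⟨P, hP⟩ := C.infinite.nonempty
  obtain ⟨Q, hQ, hQP⟩ := C.infinite.exists_notMem_finset {P}
  exact ⟨P, hP, Q, hQ, fun h => hQP (by simp [h])⟩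

/-- A curve of degree one is a line. -/
theorem IrreducibleCurve.exists_line (C : IrreducibleCurve) (hC : C.degree = 1) :
    ∃ u v : Fin 4 → ℂ, LinearIndependent ℂ ![u, v] ∧
      ∀ Q : P3, Q ∈ C.carrier ↔ Q.rep ∈ Submodule.span ℂ {u, v} := by
  classical
  obtain ⟨A, hA, B, hB, hAB⟩ := C.exists_ne
  refine ⟨A.rep, B.rep, linearIndependent_rep_pair hAB, fun Q => ?_⟩
  have hsub : ∀ Q ∈ C.carrier, Q.rep ∈ Submodule.span ℂ {A.rep, B.rep} := by
    intro Q hQ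
    by_contra hno
    obtain ⟨f, hf, hfs⟩ := Submodule.exists_le_ker_of_notMem hno
    have h1 := C.card_le (isHomogeneous_linForm f)
      (fun h => hf (by rw [← eval_linForm]; exact h Q hQ)) {A, B}
      (by simp [hA, hB]) (by
        intro P hP
        rw [eval_linForm]
        refine hfs (Submodule.subset_span ?_)
        rcases Finset.mem_insert.mp hP with rfl | hP
        · simp
        · rw [Finset.mem_singleton.mp hP]; simp)
    rw [Finset.card_pair hAB, hC] at h1
    omega
  refine ⟨hsub Q, fun hQ => C.closed Q fun n G hG hGC => ?_⟩
  refine eval_eq_zero_of_lineRestriction hG ?_ (hGC B hB) hQ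
  -- the points of the curve other than `B` give infinitely many roots
  by_contra h0
  have hratio : ∀ R ∈ C.carrier, R ≠ B → ∃ t : ℂ, (lineRestriction G A.rep B.rep).eval t = 0 ∧
      ∃ a : ℂ, R.rep = a • (A.rep + t • B.rep) := by
    intro R hR hRB
    obtain ⟨a, b, hab⟩ := Submodule.mem_span_pair.mp (hsub R hR)
    have ha : a ≠ 0 := by
      rintro rfl
      rw [zero_smul, zero_add] at hab
      apply hRB
      rw [← R.mk_rep, ← B.mk_rep]
      exact (Projectivization.mk_eq_mk_iff' ℂ _ _ _ _).mpr ⟨b, hab⟩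
    have h1 : R.rep = a • (A.rep + (b / a) • B.rep) := by
      rw [smul_add, smul_smul, mul_div_cancel₀ b ha, hab]
    refine ⟨b / a, ?_, a, h1⟩
    have h2 := hGC R hR
    rw [h1, eval_smul_of_isHomogeneous hG] at h2
    rw [eval_lineRestriction]
    exact (mul_eq_zero.mp h2).resolve_left (pow_ne_zero _ ha)
  choose! t ht a ha using hratio
  have hinf : (C.carrier \ {B}).Infinite := C.infinite.sdiff (Set.finite_singleton B)
  have hinj : Set.InjOn t (C.carrier \ {B}) := by
    rintro R ⟨hR, hRB⟩ R' ⟨hR', hRB'⟩ hRR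
    have e1 := ha R hR hRB
    have e2 := ha R' hR' hRB'
    rw [← hRR] at e2
    have ha0 : a R' ≠ 0 := by
      intro h
      rw [h, zero_smul] at e2
      exact R'.rep_nonzero e2
    rw [← R.mk_rep, ← R'.mk_rep]
    refine (Projectivization.mk_eq_mk_iff' ℂ _ _ _ _).mpr ⟨a R / a R', ?_⟩
    rw [e2, smul_smul, div_mul_cancel₀ _ ha0, ← e1]
  refine (hinf.image hinj) (Set.Finite.subset
    ((lineRestriction G A.rep B.rep).roots.toFinset.finite_toSet) ?_)
  rintro _ ⟨R, ⟨hR, hRB⟩, rfl⟩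
  simp only [Finset.mem_coe, Multiset.mem_toFinset]
  exact (Polynomial.mem_roots h0).mpr (ht R hR hRB)

/-! ### Polars of the surface along a curve -/

theorem mem_singularLocus_of_pderiv {F : MvPolynomial (Fin 4) ℂ} (hF : F.IsHomogeneous 6) {Q : P3}
    (h : ∀ i, eval Q.rep (pderiv i F) = 0) : Q ∈ singularLocus F := by
  refine ⟨?_, h⟩
  have h1 := eval_dirDeriv_self hF Q.rep
  rw [eval_dirDeriv_eq_zero_of_pderiv h] at h1
  norm_num at h1
  exact h1

theorem exists_not_vanishesOn_pderiv {F : MvPolynomial (Fin 4) ℂ} (hF : F.IsHomogeneous 6)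
    (hfin : (singularLocus F).Finite) (C : IrreducibleCurve) :
    ∃ i, ¬ VanishesOn (pderiv i F) C.carrier := by
  by_contra! hno
  exact C.infinite (hfin.subset fun Q hQ => mem_singularLocus_of_pderiv hF fun i => hno i Q hQ)

/-- The polar of `F` with respect to a point `P` of the curve vanishes to order two at `P`. -/
theorem eval_dirDeriv_polar_eq_zero {F : MvPolynomial (Fin 4) ℂ} (hF : F.IsHomogeneous 6)
    {V : Set P3} (hV : V ⊆ surface F) {P : P3} (hP : P ∈ V) :
    eval P.rep (dirDeriv P.rep F) = 0 ∧ ∀ w, IsTangentVector V P.rep w →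
      eval P.rep (dirDeriv w (dirDeriv P.rep F)) = 0 := by
  refine ⟨?_, fun w hw => ?_⟩
  · rw [eval_dirDeriv_self hF, hV hP, mul_zero]
  · rw [eval_dirDeriv_polar hF, hw 6 F hF fun Q hQ => hV hQ, mul_zero]

/-- If the polars with respect to the smooth points on `C` vanish on `C` then the span of `C` is
contained in all tangent planes along `C`. -/
theorem eval_dirDeriv_rep_eq_zero {F : MvPolynomial (Fin 4) ℂ} (hF : F.IsHomogeneous 6)
    (hfin : (singularLocus F).Finite) {C : IrreducibleCurve}
    (h : ∀ P ∈ C.carrier, P ∉ singularLocus F → VanishesOn (dirDeriv P.rep F) C.carrier)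
    {P Q : P3} (hP : P ∈ C.carrier) (hQ : Q ∈ C.carrier) :
    eval Q.rep (dirDeriv P.rep F) = 0 := by
  obtain ⟨i, hi⟩ := exists_not_vanishesOn_pderiv hF hfin C
  set L : MvPolynomial (Fin 4) ℂ := ∑ k, MvPolynomial.C (eval Q.rep (pderiv k F)) * X k with hL
  have hL1 : L.IsHomogeneous 1 := IsHomogeneous.sum _ _ _ fun k _ => isHomogeneous_C_mul_X _ k
  have hLe : ∀ R : P3, eval R.rep L = eval Q.rep (dirDeriv R.rep F) := by
    intro R
    rw [eval_dirDeriv, hL]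
    simp [mul_comm]
  rw [← hLe]
  refine (C.vanishesOn_or hL1 hF.pderiv (H := pderiv i F) fun R hR => ?_).resolve_right hi P hP
  rw [map_mul, hLe]
  by_cases hRS : R ∈ singularLocus F
  · rw [hRS.2 i, mul_zero]
  · rw [h R hR hRS Q hQ, zero_mul]

theorem exists_basis_extending {v : Fin 4 → Fin 4 → ℂ} (h : LinearIndependent ℂ v) :
    ∃ b : Module.Basis (Fin 4) ℂ (Fin 4 → ℂ), ∀ i, b i = v i :=
  ⟨basisOfLinearIndependentOfCardEqFinrank h (by simp), fun i => by simp⟩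

/-- In the situation of the previous lemma the curve lies in a plane, which is tangent to the
surface along the curve. Here the plane is spanned by the last three vectors of a basis. -/
theorem exists_plane {F : MvPolynomial (Fin 4) ℂ} (hF : F.IsHomogeneous 6)
    (hfin : (singularLocus F).Finite) {C : IrreducibleCurve} (hC : 2 ≤ C.degree)
    (h : ∀ P ∈ C.carrier, ∀ Q ∈ C.carrier, eval Q.rep (dirDeriv P.rep F) = 0) :
    ∃ b : Module.Basis (Fin 4) ℂ (Fin 4 → ℂ), (∀ Q ∈ C.carrier, b.repr Q.rep 0 = 0) ∧
      ∀ Q ∈ C.carrier, ∀ j : Fin 3, eval Q.rep (dirDeriv (b j.succ) F) = 0 := by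
  obtain ⟨i, hi⟩ := exists_not_vanishesOn_pderiv hF hfin C
  obtain ⟨Q₀, hQ₀, hQ₀i⟩ : ∃ Q₀ ∈ C.carrier, eval Q₀.rep (pderiv i F) ≠ 0 := by
    by_contra! hno
    exact hi hno
  obtain ⟨P, hP, Q, hQ, hPQ⟩ := C.exists_ne
  obtain ⟨A, hA, hAspan⟩ := C.exists_notMem_span hC P.rep Q.rep
  set m : Fin 4 → ℂ := Pi.single i 1 with hm
  let Z : Module.Dual ℂ (Fin 4 → ℂ) :=
    { toFun := fun w => eval Q₀.rep (dirDeriv w F)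
      map_add' := fun v w => by rw [dirDeriv_add_left, map_add]
      map_smul' := fun a w => by rw [dirDeriv_smul_left, map_mul, eval_C]; rfl }
  have hZ : ∀ w, Z w = eval Q₀.rep (dirDeriv w F) := fun w => rfl
  have hZm : Z m ≠ 0 := by rw [hZ, hm, dirDeriv_single]; exact hQ₀i
  have hind : LinearIndependent ℂ (Fin.cons m (Fin.cons A.rep ![P.rep, Q.rep]) : Fin 4 → _) := by
    rw [linearIndependent_finCons, linearIndependent_finCons]
    refine ⟨⟨linearIndependent_rep_pair hPQ, by simpa [Set.pair_comm] using hAspan⟩, fun hmem => hZm ?_⟩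
    have hle : Submodule.span ℂ (Set.range (Fin.cons A.rep ![P.rep, Q.rep] : Fin 3 → _)) ≤
        LinearMap.ker Z := by
      rw [Submodule.span_le]
      rintro _ ⟨j, rfl⟩
      refine LinearMap.mem_ker.mpr ?_
      fin_cases j
      · exact h A hA Q₀ hQ₀
      · exact h P hP Q₀ hQ₀
      · exact h Q hQ Q₀ hQ₀
    exact hle hmem
  obtain ⟨b, hb⟩ := exists_basis_extending hind
  have hb0 : b 0 = m := hb 0
  have hb1 : b (Fin.succ 0) = A.rep := hb 1
  have hb2 : b (Fin.succ 1) = P.rep := hb 2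
  have hb3 : b (Fin.succ 2) = Q.rep := hb 3
  have hgrad : ∀ R ∈ C.carrier, ∀ j : Fin 3, eval R.rep (dirDeriv (b j.succ) F) = 0 := by
    intro R hR j
    fin_cases j
    · exact hb1 ▸ h A hA R hR
    · exact hb2 ▸ h P hP R hR
    · exact hb3 ▸ h Q hQ R hR
  refine ⟨b, fun R hR => ?_, hgrad⟩
  have h1 : Z R.rep = 0 := h R hR Q₀ hQ₀
  rw [exists_eq_smul_add_chartVector b R.rep, map_add, map_smul, chartVector, map_sum] at h1
  have h2 : ∀ j : Fin 3, Z (b j.succ) = 0 := hgrad Q₀ hQ₀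
  simp only [map_smul, h2, mul_zero, Finset.sum_const_zero, add_zero, hb0, smul_eq_mul] at h1
  exact (mul_eq_zero.mp h1).resolve_right hZm

/-! ### Plane sections that are singular along a curve -/

/-- The parametrization of the plane spanned by the last three vectors of the basis `b`. -/
def planeMap (b : Module.Basis (Fin 4) ℂ (Fin 4 → ℂ)) : (Fin 3 → ℂ) →ₗ[ℂ] (Fin 4 → ℂ) where
  toFun := chartVector b
  map_add' v w := by simpa using chartVector_add_smul b v w 1
  map_smul' a w := by simpa [chartVector] using chartVector_add_smul b 0 w a

/-- The last three coordinates with respect to the basis `b`. -/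
def planeCoord (b : Module.Basis (Fin 4) ℂ (Fin 4 → ℂ)) : (Fin 4 → ℂ) →ₗ[ℂ] (Fin 3 → ℂ) :=
  LinearMap.pi fun j => b.coord j.succ

theorem planeMap_planeCoord (b : Module.Basis (Fin 4) ℂ (Fin 4 → ℂ)) {w : Fin 4 → ℂ}
    (hw : b.repr w 0 = 0) : planeMap b (planeCoord b w) = w := by
  conv_rhs => rw [exists_eq_smul_add_chartVector b w, hw, zero_smul, zero_add]
  rfl

theorem planeCoord_planeMap (b : Module.Basis (Fin 4) ℂ (Fin 4 → ℂ)) (x : Fin 3 → ℂ) :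
    planeCoord b (planeMap b x) = x := by
  ext j
  simp [planeCoord, planeMap, chartVector, Finsupp.single_apply]

theorem planeMap_single (b : Module.Basis (Fin 4) ℂ (Fin 4 → ℂ)) (j : Fin 3) :
    planeMap b (Pi.single j 1) = b j.succ := by
  simp [planeMap, chartVector, Pi.single_apply]

/-- If `G` does not vanish at `[q]`, then it has a zero on the line through `[q]` and any other point
`[y]`. -/
theorem exists_eval_add_smul_eq_zero {G : MvPolynomial (Fin 4) ℂ} {n : ℕ} (hG : G.IsHomogeneous n)
    (hn : 0 < n) {q : Fin 4 → ℂ} (hq : eval q G ≠ 0) (y : Fin 4 → ℂ) :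
    ∃ β : ℂ, eval (y + β • q) G = 0 := by
  by_contra! hno
  -- otherwise `G (y + β q)` is a constant `a`, so that `G (s y + q) = s ^ n a`, also for `s = 0`
  have h1 : (lineRestriction G y q).degree ≤ 0 := by
    by_contra! hdeg
    obtain ⟨β, hβ⟩ := Complex.exists_root hdeg
    exact hno β (by rw [← eval_lineRestriction]; exact hβ)
  have h2 : ∀ β : ℂ, eval (y + β • q) G = (lineRestriction G y q).coeff 0 := by
    intro β
    rw [← eval_lineRestriction]
    conv_lhs => rw [Polynomial.eq_C_of_degree_le_zero h1, Polynomial.eval_C]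
  have h3 : lineRestriction G q y =
      Polynomial.C ((lineRestriction G y q).coeff 0) * Polynomial.X ^ n := by
    refine Polynomial.eq_of_infinite_eval_eq _ _ (Set.Infinite.mono (s := {0}ᶜ) ?_
      (Set.finite_singleton (0 : ℂ)).infinite_compl)
    intro s hs
    have hs' : s ≠ 0 := hs
    have h4 : q + s • y = s • (y + s⁻¹ • q) := by
      rw [smul_add, smul_smul, mul_inv_cancel₀ hs', one_smul, add_comm]
    change Polynomial.eval s _ = Polynomial.eval s _
    rw [eval_lineRestriction, h4, eval_smul_of_isHomogeneous hG, h2, Polynomial.eval_mul, Polynomial.eval_C,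
      Polynomial.eval_pow, Polynomial.eval_X, mul_comm]
  apply hq
  have h4 := congrArg (Polynomial.eval 0) h3
  rw [eval_lineRestriction] at h4
  simpa [hn.ne'] using h4

/-- A surface containing a plane has infinitely many singular points. -/
theorem exists_eval_planeMap_ne_zero {F : MvPolynomial (Fin 4) ℂ} (hF : F.IsHomogeneous 6)
    (hfin : (singularLocus F).Finite) (b : Module.Basis (Fin 4) ℂ (Fin 4 → ℂ)) :
    linSubst (planeMap b) F ≠ 0 := by
  intro h0
  have hsing : ∀ x : Fin 3 → ℂ, eval (planeMap b x) (dirDeriv (b 0) F) = 0 →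
      ∀ i, eval (planeMap b x) (pderiv i F) = 0 := by
    intro x hx i
    rw [← dirDeriv_single, exists_eq_smul_add_chartVector b (Pi.single i 1), dirDeriv_add_left,
      dirDeriv_smul_left, map_add, map_mul, hx, mul_zero, zero_add]
    have := dirDeriv_linSubst (planeMap b) (fun j => b.repr (Pi.single i 1) j.succ) F
    rw [h0, map_zero] at this
    have h1 := congrArg (eval x) this
    rw [eval_linSubst, map_zero] at h1
    exact h1.symm
  have hG : (dirDeriv (b 0) F).IsHomogeneous 5 := isHomogeneous_dirDeriv hF _
  obtain ⟨A, hA⟩ : ∃ A : (Fin 3 → ℂ) ≃ₗ[ℂ] (Fin 3 → ℂ), ∀ t : ℂ, ∃ β : ℂ,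
      eval (planeMap b (A ![1, t, β])) (dirDeriv (b 0) F) = 0 := by
    by_cases hall : ∀ x, eval (planeMap b x) (dirDeriv (b 0) F) = 0
    · exact ⟨LinearEquiv.refl ℂ _, fun t => ⟨0, hall _⟩⟩
    · obtain ⟨x, hx⟩ := not_forall.mp hall
      have hx0 : x ≠ 0 := by
        rintro rfl
        apply hx
        rw [map_zero]
        have := eval_smul_of_isHomogeneous hG 0 0
        simpa using this
      obtain ⟨A, hA⟩ := SeparatingDual.exists_continuousLinearEquiv_apply_eq (R := ℂ)
        (x := (![0, 0, 1] : Fin 3 → ℂ)) (by simp) hx0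
      refine ⟨A.toLinearEquiv, fun t => ?_⟩
      obtain ⟨β, hβ⟩ := exists_eval_add_smul_eq_zero hG (by norm_num) hx
        (planeMap b (A ![1, t, 0]))
      refine ⟨β, ?_⟩
      have h1 : (![1, t, β] : Fin 3 → ℂ) = ![1, t, 0] + β • ![0, 0, 1] := by
        ext i
        fin_cases i <;> simp
      rw [← hβ, ← hA, ← map_smul, ← map_add, ← map_smul, ← map_add, ← h1]
      rfl
  choose β hβ using hA
  have hne : ∀ t, planeMap b (A ![1, t, β t]) ≠ 0 := by
    intro t h1
    have h2 := congrArg (planeCoord b) h1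
    rw [planeCoord_planeMap, map_zero] at h2
    have h3 := congrFun (A.map_eq_zero_iff.mp h2) 0
    simp at h3
  have hinj : Function.Injective fun t => Projectivization.mk ℂ _ (hne t) := by
    intro t t' htt
    obtain ⟨a, ha⟩ := (Projectivization.mk_eq_mk_iff' ℂ _ _ _ _).mp htt
    have h2 := congrArg (fun x => A.symm (planeCoord b x)) ha
    simp only [← map_smul, planeCoord_planeMap, LinearEquiv.symm_apply_apply] at h2
    have h3 := congrFun h2 0
    have h4 := congrFun h2 1
    simp at h3 h4
    rw [h3, one_mul] at h4
    exact h4.symm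
  refine (Set.infinite_range_of_injective hinj) (hfin.subset ?_)
  rintro _ ⟨t, rfl⟩
  have h1 := hsing _ (hβ t)
  refine (mk_mem_singularLocus_iff hF _ _).mpr ⟨?_, h1⟩
  have h2 := eval_dirDeriv_self hF (planeMap b (A ![1, t, β t]))
  rw [eval_dirDeriv_eq_zero_of_pderiv h1] at h2
  norm_num at h2
  exact h2

theorem eval_eq_eval_of_isHomogeneous_zero {n : ℕ} {G : MvPolynomial (Fin n) ℂ}
    (hG : G.IsHomogeneous 0) (p q : Fin n → ℂ) : eval p G = eval q G := by
  have h1 := eval_smul_of_isHomogeneous hG 0 p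
  have h2 := eval_smul_of_isHomogeneous hG 0 q
  rw [zero_smul, pow_zero, one_mul] at h1 h2
  rw [← h1, ← h2]

theorem eval_ne_zero_of_isHomogeneous_zero {n : ℕ} {G : MvPolynomial (Fin n) ℂ}
    (hG : G.IsHomogeneous 0) (h0 : G ≠ 0) (p : Fin n → ℂ) : eval p G ≠ 0 := by
  intro h
  apply h0
  refine MvPolynomial.funext fun q => ?_
  rw [eval_eq_eval_of_isHomogeneous_zero hG q p, h, map_zero]

/-- The curve `C` lies in the plane spanned by the last three vectors of the basis `b`, the surface
`{F = 0}` is tangent to this plane along `C`, the ternary form `c` generates the ideal of `C` in the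
plane, and the plane section of the surface has the equation `c² h`. -/
structure IsDoublePlaneSection (F : MvPolynomial (Fin 4) ℂ) (C : IrreducibleCurve)
    (b : Module.Basis (Fin 4) ℂ (Fin 4 → ℂ)) (c h : MvPolynomial (Fin 3) ℂ) : Prop where
  plane : ∀ Q ∈ C.carrier, b.repr Q.rep 0 = 0
  tangent : ∀ Q ∈ C.carrier, ∀ j : Fin 3, eval Q.rep (dirDeriv (b j.succ) F) = 0
  homogeneous : c.IsHomogeneous C.degree
  prime : Prime c
  ideal : ∀ (n : ℕ) (g : MvPolynomial (Fin 3) ℂ), g.IsHomogeneous n →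
    (VanishesOn (linSubst (planeCoord b) g) C.carrier ↔ c ∣ g)
  eq_mul : linSubst (planeMap b) F = c ^ 2 * h
  ne_zero : h ≠ 0
  homogeneous_cofactor : h.IsHomogeneous (6 - C.degree * 2)

theorem exists_isDoublePlaneSection {F : MvPolynomial (Fin 4) ℂ} (hF : F.IsHomogeneous 6)
    (hfin : (singularLocus F).Finite) {C : IrreducibleCurve} (hC : 2 ≤ C.degree)
    (hCF : C.carrier ⊆ surface F)
    (h : ∀ P ∈ C.carrier, P ∉ singularLocus F → VanishesOn (dirDeriv P.rep F) C.carrier) :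
    ∃ b c h, IsDoublePlaneSection F C b c h := by
  obtain ⟨b, hb, hbt⟩ := exists_plane hF hfin hC fun P hP Q hQ =>
    eval_dirDeriv_rep_eq_zero hF hfin h hP hQ
  have hplane : ∀ Q ∈ C.carrier, planeMap b (planeCoord b Q.rep) = Q.rep :=
    fun Q hQ => planeMap_planeCoord b (hb Q hQ)
  obtain ⟨c, hc, hcp, hcV⟩ := C.exists_planeEquation hplane
  have hf0 := exists_eval_planeMap_ne_zero hF hfin b
  have hfh := isHomogeneous_linSubst (planeMap b) hF
  obtain ⟨k, hk⟩ := exists_eq_sq_mul C.degree_pos hc hcp hcV hfh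
    (fun j Q hQ => by
      rw [← dirDeriv_single, dirDeriv_linSubst, eval_linSubst, eval_linSubst, hplane Q hQ,
        planeMap_single]
      exact hbt Q hQ j)
    (fun Q hQ => by
      rw [eval_linSubst, eval_linSubst, hplane Q hQ]
      exact hCF hQ)
  refine ⟨b, c, k, hb, hbt, hc, hcp, hcV, hk, ?_, ?_⟩
  · rintro rfl
    rw [mul_zero] at hk
    exact hf0 hk
  · exact (isHomogeneous_of_mul_right (hk ▸ hfh) (hc.pow 2) (hk ▸ hf0)).2

namespace IsDoublePlaneSection

variable {F : MvPolynomial (Fin 4) ℂ} {C : IrreducibleCurve}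
  {b : Module.Basis (Fin 4) ℂ (Fin 4 → ℂ)} {c h : MvPolynomial (Fin 3) ℂ}

theorem planeMap_planeCoord (H : IsDoublePlaneSection F C b c h) {Q : P3} (hQ : Q ∈ C.carrier) :
    planeMap b (planeCoord b Q.rep) = Q.rep :=
  TripleSextic.planeMap_planeCoord b (H.plane Q hQ)

theorem eval_eq_zero (H : IsDoublePlaneSection F C b c h) {Q : P3} (hQ : Q ∈ C.carrier) :
    eval (planeCoord b Q.rep) c = 0 := by
  rw [← eval_linSubst]
  exact (H.ideal _ c H.homogeneous).mpr dvd_rfl Q hQ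

theorem mem_carrier (H : IsDoublePlaneSection F C b c h) {Q : P3} (hQ : b.repr Q.rep 0 = 0)
    (hQc : eval (planeCoord b Q.rep) c = 0) : Q ∈ C.carrier := by
  refine C.closed Q fun n G hG hGC => ?_
  obtain ⟨k, hk⟩ := (H.ideal n (linSubst (planeMap b) G) (isHomogeneous_linSubst _ hG)).mp
    fun R hR => by
      rw [eval_linSubst, eval_linSubst, H.planeMap_planeCoord hR]
      exact hGC R hR
  rw [← TripleSextic.planeMap_planeCoord b hQ, ← eval_linSubst, hk, map_mul, hQc, zero_mul]

/-- The second derivatives of `c² h` vanish at a triple point. -/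
theorem eval_mul_sq_eq_zero (H : IsDoublePlaneSection F C b c h) {P : P3} (hP : P ∈ C.carrier)
    (hPF : IsTripleVector F P.rep) (w : Fin 3 → ℂ) :
    eval (planeCoord b P.rep) h * eval (planeCoord b P.rep) (dirDeriv w c) ^ 2 = 0 := by
  have h1 := hPF.second (planeMap b w) (planeMap b w)
  rw [← H.planeMap_planeCoord hP, ← eval_linSubst, ← dirDeriv_linSubst, ← dirDeriv_linSubst,
    H.eq_mul] at h1
  simp only [Derivation.leibniz, Derivation.leibniz_pow, map_add, map_mul, smul_eq_mul, map_pow,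
    H.eval_eq_zero hP, nsmul_eq_mul, map_natCast] at h1
  have h2 : (2 : ℂ) ≠ 0 := two_ne_zero
  refine (mul_eq_zero.mp (?_ : (2 : ℂ) * _ = 0)).resolve_left h2
  linear_combination h1

/-- A plane conic has no singular points, since a line through a singular point of the conic and
another point would be contained in the conic. -/
theorem exists_eval_dirDeriv_ne_zero (H : IsDoublePlaneSection F C b c h) (hC : C.degree = 2)
    {P : P3} (hP : P ∈ C.carrier) : ∃ w, eval (planeCoord b P.rep) (dirDeriv w c) ≠ 0 := by
  by_contra! hno
  obtain ⟨Q, hQ, hQP⟩ := C.infinite.exists_notMem_finset {P}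
  have hPQ : P ≠ Q := fun h => hQP (by simp [h])
  have hc2 : c.IsHomogeneous 2 := hC ▸ H.homogeneous
  set G := linSubst (planeCoord b) c with hGdef
  have hG : G.IsHomogeneous 2 := isHomogeneous_linSubst _ hc2
  have hGQ : eval Q.rep G = 0 := by rw [eval_linSubst]; exact H.eval_eq_zero hQ
  have hres : lineRestriction G P.rep Q.rep = 0 := by
    ext n
    rw [Polynomial.coeff_zero]
    obtain rfl | rfl | rfl | hn : n = 0 ∨ n = 1 ∨ n = 2 ∨ 2 < n := by omega
    · rw [← coeff_lineRestriction_zero, eval_linSubst]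
      exact H.eval_eq_zero hP
    · rw [← coeff_lineRestriction_one, dirDeriv_linSubst, eval_linSubst]
      exact hno _
    · have h1 := coeff_lineRestriction_two G P.rep Q.rep
      have hG1 := isHomogeneous_dirDeriv hG Q.rep
      rw [eval_eq_eval_of_isHomogeneous_zero (isHomogeneous_dirDeriv hG1 Q.rep) P.rep Q.rep,
        eval_dirDeriv_self hG1, eval_dirDeriv_self hG, hGQ, mul_zero, mul_zero] at h1
      exact (mul_eq_zero.mp h1.symm).resolve_left two_ne_zero
    · exact Polynomial.coeff_eq_zero_of_natDegree_lt
        ((natDegree_lineRestriction_le hG _ _).trans_lt hn)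
  have hind := linearIndependent_rep_pair hPQ
  have hr0 : P.rep + Q.rep ≠ 0 := by
    intro h0
    have := LinearIndependent.pair_iff.mp hind 1 1 (by simpa using h0)
    simp at this
  obtain ⟨a, ha, hR⟩ := exists_rep_mk_eq_smul _ hr0
  set R : P3 := Projectivization.mk ℂ _ hr0 with hRdef
  have hRspan : R.rep ∈ Submodule.span ℂ {P.rep, Q.rep} := by
    rw [hR]
    exact Submodule.mem_span_pair.mpr ⟨a, a, by rw [smul_add]⟩
  have hRC : R ∈ C.carrier := by
    refine H.mem_carrier ?_ ?_
    · rw [hR]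
      simp [H.plane P hP, H.plane Q hQ]
    · rw [← eval_linSubst]
      exact eval_eq_zero_of_lineRestriction hG hres hGQ hRspan
  have hRP : R ≠ P := by
    intro h0
    rw [h0] at hR
    have := LinearIndependent.pair_iff.mp hind (1 - a) (-a) (by
      funext i
      have h1 := congrFun hR i
      simp only [Pi.add_apply, Pi.smul_apply, smul_eq_mul, Pi.zero_apply] at h1 ⊢
      linear_combination h1)
    exact ha (by simpa using this.2)
  have hRQ : R ≠ Q := by
    intro h0
    rw [h0] at hR
    have := LinearIndependent.pair_iff.mp hind (-a) (1 - a) (by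
      funext i
      have h1 := congrFun hR i
      simp only [Pi.add_apply, Pi.smul_apply, smul_eq_mul, Pi.zero_apply] at h1 ⊢
      linear_combination h1)
    exact ha (by simpa using this.1)
  obtain ⟨A, hA, hAspan⟩ := C.exists_notMem_span hC.ge P.rep Q.rep
  obtain ⟨f, hf, hfs⟩ := Submodule.exists_le_ker_of_notMem hAspan
  classical
  have h1 := C.card_le (isHomogeneous_linForm f)
    (fun h => hf (by rw [← eval_linForm]; exact h A hA)) {R, P, Q}
    (by simp [hP, hQ, hRC]) (by
      intro T hT
      rw [eval_linForm]
      refine hfs ?_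
      simp only [Finset.mem_insert, Finset.mem_singleton] at hT
      rcases hT with rfl | rfl | rfl
      · exact hRspan
      · exact Submodule.subset_span (by simp)
      · exact Submodule.subset_span (by simp))
  rw [Finset.card_eq_three.mpr ⟨R, P, Q, hRP, hRQ, hPQ, rfl⟩, hC] at h1
  omega

end IsDoublePlaneSection

/-! ### Cubic curves with too many triple points -/

/-- A cubic curve on the surface such that every quintic form that is singular in the triple points
on the curve and touches the curve in a further point, and every quadratic form through the triple
points, vanishes on the curve. The polars of `F` are such quintics, so that the surface is tangent
to a plane along the cubic, and the derivatives of the equation of the cubic in this plane are such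
quadratic forms. -/
theorem false_of_cubic {F : MvPolynomial (Fin 4) ℂ} (hF : F.IsHomogeneous 6)
    (hsing : ∀ P ∈ singularLocus F, IsOrdinaryTriplePoint F P) (C : IrreducibleCurve)
    (hC : C.degree = 3) (hCF : C.carrier ⊆ surface F)
    (h5 : ∀ P ∈ C.carrier, P ∉ singularLocus F → ∀ G : MvPolynomial (Fin 4) ℂ, G.IsHomogeneous 5 →
      (∀ Q ∈ singularLocus F ∩ C.carrier,
        eval Q.rep G = 0 ∧ ∀ w, eval Q.rep (dirDeriv w G) = 0) →
      eval P.rep G = 0 →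
      (∀ w, IsTangentVector C.carrier P.rep w → eval P.rep (dirDeriv w G) = 0) →
      VanishesOn G C.carrier)
    (h2 : ∀ G : MvPolynomial (Fin 4) ℂ, G.IsHomogeneous 2 →
      (∀ Q ∈ singularLocus F ∩ C.carrier, eval Q.rep G = 0) → VanishesOn G C.carrier) :
    False := by
  have hfin := finite_singularLocus hF hsing
  obtain ⟨b, c, h, H⟩ := exists_isDoublePlaneSection hF hfin (by omega : 2 ≤ C.degree) hCF
    fun P hP hPS => by
      obtain ⟨e1, e2⟩ := eval_dirDeriv_polar_eq_zero hF hCF hP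
      refine h5 P hP hPS _ (isHomogeneous_dirDeriv hF _) (fun Q hQ => ?_) e1 e2
      exact ⟨eval_dirDeriv_eq_zero_of_pderiv hQ.1.2 _,
        fun w => ((hsing Q hQ.1).isTripleVector_rep hF).second w _⟩
  have hh : h.IsHomogeneous 0 := by simpa [hC] using H.homogeneous_cofactor
  have hc3 : c.IsHomogeneous 3 := by simpa [hC] using H.homogeneous
  obtain ⟨j, hj⟩ := exists_not_dvd_pderiv three_pos hc3 H.prime.ne_zero
  refine hj ((H.ideal 2 _ hc3.pderiv).mp ?_)
  refine h2 _ (isHomogeneous_linSubst _ hc3.pderiv) fun Q hQ => ?_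
  rw [eval_linSubst, ← dirDeriv_single]
  exact pow_eq_zero_iff two_ne_zero |>.mp ((mul_eq_zero.mp (H.eval_mul_sq_eq_zero hQ.2
    ((hsing Q hQ.1).isTripleVector_rep hF) _)).resolve_left
      (eval_ne_zero_of_isHomogeneous_zero hh H.ne_zero _))

section Count

variable {F : MvPolynomial (Fin 4) ℂ} (hF : F.IsHomogeneous 6)
  (hsing : ∀ P ∈ singularLocus F, IsOrdinaryTriplePoint F P)

include hF hsing

/-- Since the derivatives of `F` are singular in the triple points, a curve of degree `d` contains
at most `5 d / 2` of them. -/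
theorem two_mul_card_le_of_triple (C : IrreducibleCurve) (T : Finset P3)
    (hT : ∀ P ∈ T, P ∈ C.carrier) (hTS : ∀ P ∈ T, P ∈ singularLocus F) :
    2 * T.card ≤ C.degree * 5 := by
  obtain ⟨i, hi⟩ := exists_not_vanishesOn_pderiv hF (finite_singularLocus hF hsing) C
  refine C.two_mul_card_le hF.pderiv hi T hT (fun P hP => (hTS P hP).2 i) fun P hP w _ => ?_
  rw [← dirDeriv_single]
  exact ((hsing P (hTS P hP)).isTripleVector_rep hF).second w _

theorem card_le_six_of_cubic (C : IrreducibleCurve) (hC : C.degree = 3)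
    (hCF : C.carrier ⊆ surface F) (T : Finset P3)
    (hT : ∀ P ∈ T, P ∈ C.carrier) (hTS : ∀ P ∈ T, P ∈ singularLocus F) : T.card ≤ 6 := by
  classical
  by_contra! hcard
  refine false_of_cubic hF hsing C hC hCF (fun P hP hPS G hG hGS hGP hGw => ?_) fun G hG hGS => ?_
  · by_contra hGC
    have h1 := C.two_mul_card_le hG hGC (insert P T)
      (fun Q hQ => by
        rcases Finset.mem_insert.mp hQ with rfl | hQ
        exacts [hP, hT Q hQ])
      (fun Q hQ => by
        rcases Finset.mem_insert.mp hQ with rfl | hQ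
        exacts [hGP, (hGS Q ⟨hTS Q hQ, hT Q hQ⟩).1])
      (fun Q hQ w hw => by
        rcases Finset.mem_insert.mp hQ with rfl | hQ
        exacts [hGw w hw, (hGS Q ⟨hTS Q hQ, hT Q hQ⟩).2 w])
    rw [Finset.card_insert_of_notMem fun h => hPS (hTS P h), hC] at h1
    omega
  · by_contra hGC
    have h1 := C.card_le hG hGC T hT fun Q hQ => hGS Q ⟨hTS Q hQ, hT Q hQ⟩
    rw [hC] at h1
    omega

/-- If a conic contains five triple points then the surface is tangent to a plane along the conic
and intersects the plane in three times the conic. A line on the surface that is not contained in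
the plane intersects the plane in a point of the conic, and the surface is singular there because
its tangent space contains both the plane and the line. -/
theorem exists_triple_on_conic_inter_line (C L : IrreducibleCurve) (hC : C.degree = 2)
    (hL : L.degree = 1) (hCF : C.carrier ⊆ surface F) (hLF : L.carrier ⊆ surface F)
    (T : Finset P3) (hT : ∀ P ∈ T, P ∈ C.carrier) (hTS : ∀ P ∈ T, P ∈ singularLocus F)
    (hT5 : 5 ≤ T.card) {P₀ : P3} (hP₀ : P₀ ∈ L.carrier) (hP₀C : P₀ ∉ C.carrier) :
    ∃ R ∈ singularLocus F, R ∈ C.carrier ∧ R ∈ L.carrier := by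
  classical
  have hfin := finite_singularLocus hF hsing
  have htrip : ∀ P ∈ T, IsTripleVector F P.rep := fun P hP =>
    (hsing P (hTS P hP)).isTripleVector_rep hF
  obtain ⟨b, c, h, H⟩ := exists_isDoublePlaneSection hF hfin hC.ge hCF fun P hP hPS => by
    by_contra hGC
    obtain ⟨e1, e2⟩ := eval_dirDeriv_polar_eq_zero hF hCF hP
    have h1 := C.two_mul_card_le (isHomogeneous_dirDeriv hF _) hGC (insert P T)
      (fun Q hQ => by
        rcases Finset.mem_insert.mp hQ with rfl | hQ
        exacts [hP, hT Q hQ])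
      (fun Q hQ => by
        rcases Finset.mem_insert.mp hQ with rfl | hQ
        exacts [e1, (htrip Q hQ).first hF _])
      (fun Q hQ w hw => by
        rcases Finset.mem_insert.mp hQ with rfl | hQ
        exacts [e2 w hw, (htrip Q hQ).second _ _])
    rw [Finset.card_insert_of_notMem fun h => hPS (hTS P h), hC] at h1
    omega
  have hh : h.IsHomogeneous 2 := by simpa [hC] using H.homogeneous_cofactor
  obtain ⟨k, rfl⟩ : c ∣ h := by
    refine (H.ideal 2 h hh).mp ?_
    by_contra hGC
    have h1 := C.card_le (isHomogeneous_linSubst _ hh) hGC T hT fun P hP => by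
      obtain ⟨w, hw⟩ := H.exists_eval_dirDeriv_ne_zero hC (hT P hP)
      rw [eval_linSubst]
      exact (mul_eq_zero.mp (H.eval_mul_sq_eq_zero (hT P hP) (htrip P hP) w)).resolve_right
        (pow_ne_zero 2 hw)
    rw [hC] at h1
    omega
  have hk : k.IsHomogeneous 0 := (isHomogeneous_of_mul_right hh (hC ▸ H.homogeneous) H.ne_zero).2
  have hk0 : k ≠ 0 := right_ne_zero_of_mul H.ne_zero
  have hmem : ∀ Q : P3, Q ∈ surface F → b.repr Q.rep 0 = 0 → Q ∈ C.carrier := by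
    intro Q hQF hQ
    refine H.mem_carrier hQ ?_
    have h1 : eval Q.rep F = 0 := hQF
    rw [← planeMap_planeCoord b hQ, ← eval_linSubst, H.eq_mul] at h1
    simpa [eval_ne_zero_of_isHomogeneous_zero hk hk0] using h1
  obtain ⟨u, v, huv, hLmem⟩ := L.exists_line hL
  set r : Fin 4 → ℂ := b.repr v 0 • u + (-b.repr u 0) • v with hr
  have hspan : ∀ w ∈ Submodule.span ℂ {u, v}, eval w F = 0 := by
    intro w hw
    by_cases hw0 : w = 0
    · have := eval_smul_of_isHomogeneous hF 0 0
      simpa [hw0] using this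
    · rw [← eval_rep_mk_eq_zero_iff hF w hw0]
      refine hLF ((hLmem _).mpr ?_)
      obtain ⟨a, -, ha⟩ := exists_rep_mk_eq_smul w hw0
      rw [ha]
      exact Submodule.smul_mem _ _ hw
  have hcase : ∀ R : P3, R ∈ L.carrier → R ∉ singularLocus F → b.repr R.rep 0 = 0 →
      ∀ w ∈ Submodule.span ℂ {u, v}, b.repr w 0 = 0 := by
    intro R hR hRS hR0 w hw
    have hRC := hmem R (hLF hR) hR0
    have hD : eval R.rep (dirDeriv (b 0) F) ≠ 0 := by
      intro h0
      refine hRS (mem_singularLocus_of_pderiv hF fun i => ?_)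
      rw [← dirDeriv_single, ← b.sum_repr (Pi.single i 1), Fin.sum_univ_succ, dirDeriv_eq_sum]
      have hsum : ∀ z, eval R.rep (dirDeriv z F) = 0 := by
        intro z
        let Z : Module.Dual ℂ (Fin 4 → ℂ) :=
          { toFun := fun w => eval R.rep (dirDeriv w F)
            map_add' := fun v w => by rw [dirDeriv_add_left, map_add]
            map_smul' := fun a w => by rw [dirDeriv_smul_left, map_mul, eval_C]; rfl }
        have hZ : Z = 0 := b.ext fun j => by
          refine Fin.cases ?_ (fun j => ?_) j
          · exact h0
          · exact H.tangent R hRC j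
        exact LinearMap.congr_fun hZ z
      rw [← dirDeriv_eq_sum]
      exact hsum _
    have hw0 : eval R.rep (dirDeriv w F) = 0 := by
      rw [coeff_lineRestriction_one]
      have : lineRestriction F R.rep w = 0 := by
        refine Polynomial.funext fun t => ?_
        rw [eval_lineRestriction, Polynomial.eval_zero]
        exact hspan _ (Submodule.add_mem _ ((hLmem R).mp hR) (Submodule.smul_mem _ _ hw))
      rw [this, Polynomial.coeff_zero]
    have hpl : ∀ x : Fin 3 → ℂ, eval R.rep (dirDeriv (chartVector b x) F) = 0 := by
      intro x
      have h1 := H.tangent R hRC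
      simp only [chartVector, Fin.sum_univ_three, dirDeriv_add_left, dirDeriv_smul_left, map_add,
        map_mul, h1, mul_zero, add_zero]
    rw [exists_eq_smul_add_chartVector b w, dirDeriv_add_left, dirDeriv_smul_left, map_add, map_mul,
      hpl, add_zero, eval_C] at hw0
    exact (mul_eq_zero.mp hw0).resolve_right hD
  by_cases hr0 : r = 0
  · -- the line lies in the plane, so that it is contained in the conic
    obtain ⟨h1, h2⟩ := LinearIndependent.pair_iff.mp huv _ _ hr0
    refine absurd (hmem P₀ (hLF hP₀) ?_) hP₀C
    obtain ⟨x, y, hxy⟩ := Submodule.mem_span_pair.mp ((hLmem P₀).mp hP₀)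
    rw [← hxy]
    simp [h1, neg_eq_zero.mp h2]
  · obtain ⟨a, ha, haR⟩ := exists_rep_mk_eq_smul r hr0
    set R : P3 := Projectivization.mk ℂ r hr0 with hRdef
    have hRL : R ∈ L.carrier := by
      rw [hLmem, haR]
      exact Submodule.smul_mem _ _ (Submodule.mem_span_pair.mpr ⟨_, _, rfl⟩)
    have hR0 : b.repr R.rep 0 = 0 := by
      rw [haR, hr]
      simp [mul_comm]
    refine ⟨R, ?_, hmem R (hLF hRL) hR0, hRL⟩
    by_contra hRS
    refine hr0 ?_
    rw [hr, hcase R hRL hRS hR0 u (Submodule.subset_span (by simp)),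
      hcase R hRL hRS hR0 v (Submodule.subset_span (by simp))]
    simp

/-- The conic contains at most five triple points and the line at most two. If both bounds are
attained by disjoint sets then the line contains a third triple point on the conic. -/
theorem card_le_six_of_conic_line (C L : IrreducibleCurve) (hC : C.degree = 2)
    (hL : L.degree = 1) (hCF : C.carrier ⊆ surface F) (hLF : L.carrier ⊆ surface F)
    (T : Finset P3) (hT : ∀ P ∈ T, P ∈ C.carrier ∨ P ∈ L.carrier)
    (hTS : ∀ P ∈ T, P ∈ singularLocus F) : T.card ≤ 6 := by
  classical
  set A := T.filter (· ∈ C.carrier) with hA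
  set B := T.filter (· ∉ C.carrier) with hB
  have hcard : A.card + B.card = T.card := Finset.card_filter_add_card_filter_not _
  have hAC : ∀ P ∈ A, P ∈ C.carrier := fun P hP => (Finset.mem_filter.mp hP).2
  have hBL : ∀ P ∈ B, P ∈ L.carrier := fun P hP =>
    (hT P (Finset.mem_filter.mp hP).1).resolve_left (Finset.mem_filter.mp hP).2
  have hAS : ∀ P ∈ A, P ∈ singularLocus F := fun P hP => hTS P (Finset.mem_filter.mp hP).1
  have hBS : ∀ P ∈ B, P ∈ singularLocus F := fun P hP => hTS P (Finset.mem_filter.mp hP).1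
  have h1 := two_mul_card_le_of_triple hF hsing C A hAC hAS
  have h2 := two_mul_card_le_of_triple hF hsing L B hBL hBS
  rw [hC] at h1
  rw [hL] at h2
  by_contra! hno
  obtain ⟨P₀, hP₀⟩ : B.Nonempty := Finset.card_pos.mp (by omega)
  obtain ⟨R, hRS, hRC, hRL⟩ := exists_triple_on_conic_inter_line hF hsing C L hC hL hCF hLF A hAC
    hAS (by omega) (hBL P₀ hP₀) (Finset.mem_filter.mp hP₀).2
  have h3 := two_mul_card_le_of_triple hF hsing L (insert R B)
    (fun P hP => by
      rcases Finset.mem_insert.mp hP with rfl | hP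
      exacts [hRL, hBL P hP])
    (fun P hP => by
      rcases Finset.mem_insert.mp hP with rfl | hP
      exacts [hRS, hBS P hP])
  rw [Finset.card_insert_of_notMem fun h : R ∈ B => (Finset.mem_filter.mp h).2 hRC, hL] at h3
  omega

theorem card_le_six_of_lines (L : Fin 3 → IrreducibleCurve) (hL : ∀ i, (L i).degree = 1)
    (T : Finset P3) (hT : ∀ P ∈ T, ∃ i, P ∈ (L i).carrier)
    (hTS : ∀ P ∈ T, P ∈ singularLocus F) : T.card ≤ 6 := by
  classical
  have h1 : ∀ i, (T.filter (· ∈ (L i).carrier)).card ≤ 2 := by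
    intro i
    have := two_mul_card_le_of_triple hF hsing (L i) (T.filter (· ∈ (L i).carrier))
      (fun P hP => (Finset.mem_filter.mp hP).2) fun P hP => hTS P (Finset.mem_filter.mp hP).1
    rw [hL] at this
    omega
  have h2 : T ⊆ Finset.univ.biUnion fun i => T.filter (· ∈ (L i).carrier) := by
    intro P hP
    obtain ⟨i, hi⟩ := hT P hP
    exact Finset.mem_biUnion.mpr ⟨i, Finset.mem_univ _, Finset.mem_filter.mpr ⟨hP, hi⟩⟩
  calc T.card ≤ _ := Finset.card_le_card h2
    _ ≤ ∑ i : Fin 3, (T.filter (· ∈ (L i).carrier)).card := Finset.card_biUnion_le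
    _ ≤ ∑ _i : Fin 3, 2 := Finset.sum_le_sum fun i _ => h1 i
    _ = 6 := by simp

theorem card_le_six (D : Curve) (hD : D.degree = 3) (hDF : D.support ⊆ surface F)
    (T : Finset P3) (hT : ∀ P ∈ T, P ∈ D.support) (hTS : ∀ P ∈ T, P ∈ singularLocus F) :
    T.card ≤ 6 := by
  have hcard : D.card ≤ 3 := by
    rw [← hD, Curve.degree]
    have := Multiset.card_nsmul_le_sum (s := Multiset.map IrreducibleCurve.degree D) (a := 1)
      fun x hx => by
        obtain ⟨C, -, rfl⟩ := Multiset.mem_map.mp hx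
        exact C.degree_pos
    simpa using this
  obtain h | h | h | h : D.card = 0 ∨ D.card = 1 ∨ D.card = 2 ∨ D.card = 3 := by omega
  · rw [Multiset.card_eq_zero] at h
    simp [h, Curve.degree] at hD
  · obtain ⟨C, rfl⟩ := Multiset.card_eq_one.mp h
    simp only [Curve.degree, Multiset.map_singleton, Multiset.sum_singleton] at hD
    have hs : Curve.support {C} = C.carrier := by ext; simp [Curve.support]
    rw [hs] at hDF hT
    exact card_le_six_of_cubic hF hsing C hD hDF T hT hTS
  · obtain ⟨C, L, rfl⟩ := Multiset.card_eq_two.mp h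
    simp only [Curve.degree, Multiset.insert_eq_cons, Multiset.map_cons, Multiset.map_singleton,
      Multiset.sum_cons, Multiset.sum_singleton] at hD
    have hs : Curve.support {C, L} = C.carrier ∪ L.carrier := by ext; simp [Curve.support]
    rw [hs] at hDF hT
    obtain ⟨hCF, hLF⟩ := Set.union_subset_iff.mp hDF
    have h1 := C.degree_pos
    have h2 := L.degree_pos
    obtain h3 | h3 : C.degree = 2 ∨ L.degree = 2 := by omega
    · exact card_le_six_of_conic_line hF hsing C L h3 (by omega) hCF hLF T hT hTS
    · exact card_le_six_of_conic_line hF hsing L C h3 (by omega) hLF hCF T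
        (fun P hP => (hT P hP).symm) hTS
  · obtain ⟨C₀, C₁, C₂, rfl⟩ := Multiset.card_eq_three.mp h
    simp only [Curve.degree, Multiset.insert_eq_cons, Multiset.map_cons, Multiset.map_singleton,
      Multiset.sum_cons, Multiset.sum_singleton] at hD
    have h0 := C₀.degree_pos
    have h1 := C₁.degree_pos
    have h2 := C₂.degree_pos
    refine card_le_six_of_lines hF hsing ![C₀, C₁, C₂] (fun i => ?_) T (fun P hP => ?_) hTS
    · fin_cases i
      · change C₀.degree = 1; omega
      · change C₁.degree = 1; omega
      · change C₂.degree = 1; omega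
    · have := hT P hP
      simp only [Curve.support, Multiset.insert_eq_cons, Set.mem_ofPred_eq, Multiset.mem_cons,
        Multiset.mem_singleton] at this
      obtain ⟨C, rfl | rfl | rfl, hPC⟩ := this
      exacts [⟨0, hPC⟩, ⟨1, hPC⟩, ⟨2, hPC⟩]

/-- At most six triple points lie on a curve of degree three on the surface. -/
theorem encard_triple_le_six (D : Curve) (hD : D.degree = 3) (hDF : D.support ⊆ surface F) :
    {P : P3 | IsOrdinaryTriplePoint F P ∧ P ∈ D.support}.encard ≤ 6 := by
  have hsub : {P : P3 | IsOrdinaryTriplePoint F P ∧ P ∈ D.support} ⊆ singularLocus F :=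
    fun P hP => hP.1.mem_singularLocus hF
  have hfin := (finite_singularLocus hF hsing).subset hsub
  rw [hfin.encard_eq_coe_toFinset_card]
  exact_mod_cast card_le_six hF hsing D hD hDF hfin.toFinset
    (fun P hP => ((hfin.mem_toFinset).mp hP).2) fun P hP => hsub ((hfin.mem_toFinset).mp hP)

end Count

/-! ### Zeros of binary forms -/

/-- The linear form on the projective line that vanishes at `τ`. -/
def pointForm (τ : Fin 2 → ℂ) : MvPolynomial (Fin 2) ℂ := C (τ 1) * X 0 - C (τ 0) * X 1

theorem isHomogeneous_pointForm (τ : Fin 2 → ℂ) : (pointForm τ).IsHomogeneous 1 :=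
  (isHomogeneous_C_mul_X _ _).sub (isHomogeneous_C_mul_X _ _)

theorem eval_pointForm (τ σ : Fin 2 → ℂ) : eval σ (pointForm τ) = τ 1 * σ 0 - τ 0 * σ 1 := by
  simp [pointForm]

theorem linearIndependent_pair_iff (τ σ : Fin 2 → ℂ) :
    LinearIndependent ℂ ![τ, σ] ↔ τ 0 * σ 1 - τ 1 * σ 0 ≠ 0 := by
  have h := Matrix.linearIndependent_rows_iff_isUnit (A := Matrix.of ![τ, σ])
  rw [Matrix.isUnit_iff_isUnit_det, Matrix.det_fin_two, isUnit_iff_ne_zero] at h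
  exact h

/-- A binary form with a zero is divisible by the linear form of the zero. -/
theorem pointForm_dvd {G : MvPolynomial (Fin 2) ℂ} {n : ℕ} (hG : G.IsHomogeneous n)
    {τ : Fin 2 → ℂ} (hτ : τ ≠ 0) (h : eval τ G = 0) : pointForm τ ∣ G := by
  -- modulo the linear form the point `(X 0, X 1)` is a multiple of `τ`
  rw [← Ideal.mem_span_singleton, ← Ideal.Quotient.eq_zero_iff_mem]
  set q := Ideal.Quotient.mkₐ ℂ (Ideal.span {pointForm τ}) with hq
  have hq0 : q (pointForm τ) = 0 :=
    Ideal.Quotient.eq_zero_iff_mem.mpr (Ideal.mem_span_singleton_self _)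
  obtain ⟨i, hi⟩ := Function.ne_iff.mp hτ
  have hX : ∀ j, q (X j) = q (C (τ i)⁻¹ * X i) * algebraMap ℂ _ (τ j) := by
    intro j
    have h1 : q (C (τ j) * X i - C (τ i) * X j) = 0 := by
      fin_cases i <;> fin_cases j
      · simp
      · exact hq0
      · rw [← neg_eq_zero, ← map_neg, neg_sub]
        exact hq0
      · simp
    have h2 : (C (τ i)⁻¹ * X i) * C (τ j) - X j =
        C (τ i)⁻¹ * (C (τ j) * X i - C (τ i) * X j) := by
      have h3 : (C (τ i)⁻¹ * C (τ i) : MvPolynomial (Fin 2) ℂ) = 1 := by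
        rw [← C_mul, inv_mul_cancel₀ hi, C_1]
      linear_combination X j * h3
    have h3 := congrArg q h2
    rw [map_mul, h1, mul_zero, map_sub, map_mul, sub_eq_zero] at h3
    rw [← h3, ← algebraMap_eq, AlgHom.commutes]
  have h1 : q G = aeval (fun j => q (X j)) G := by
    rw [← comp_aeval_apply, aeval_X_left_apply]
  change q G = 0
  rw [h1, funext hX, aeval_mul_of_isHomogeneous hG]
  have h2 : aeval (fun j => algebraMap ℂ (MvPolynomial (Fin 2) ℂ ⧸ Ideal.span {pointForm τ}) (τ j))
      G = algebraMap ℂ _ (eval τ G) := by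
    exact (aeval_algebraMap_apply _ τ G).trans (by rw [aeval_eq_eval])
  rw [h2, h, map_zero, mul_zero]

theorem exists_eval_eq_zero {G : MvPolynomial (Fin 2) ℂ} {n : ℕ} (hG : G.IsHomogeneous n)
    (hn : 0 < n) : ∃ τ : Fin 2 → ℂ, τ ≠ 0 ∧ eval τ G = 0 := by
  let π : (Fin 4 → ℂ) →ₗ[ℂ] (Fin 2 → ℂ) := LinearMap.pi ![LinearMap.proj 0, LinearMap.proj 1]
  by_cases h : eval ![1, 0] G = 0
  · exact ⟨![1, 0], by simp, h⟩
  · have h1 : π ![1, 0, 0, 0] = ![1, 0] := by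
      ext i
      fin_cases i <;> simp [π]
    obtain ⟨β, hβ⟩ := exists_eval_add_smul_eq_zero (isHomogeneous_linSubst π hG) hn
      (q := ![1, 0, 0, 0]) (by rwa [eval_linSubst, h1]) ![0, 1, 0, 0]
    refine ⟨_, ?_, (eval_linSubst π _ G).symm.trans hβ⟩
    intro h2
    have h3 := congrFun h2 1
    simp [π] at h3

/-- `M` is the multiset of zeros of the (nonzero) binary form `G`. -/
def HasZeros (G : MvPolynomial (Fin 2) ℂ) (M : Multiset P1) : Prop :=
  ∃ a : ℂ, a ≠ 0 ∧ G = C a * (M.map fun p => pointForm p.rep).prod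

/-- The fundamental theorem of algebra for binary forms. -/
theorem exists_hasZeros {G : MvPolynomial (Fin 2) ℂ} {n : ℕ} (hG : G.IsHomogeneous n)
    (h0 : G ≠ 0) : ∃ M : Multiset P1, M.card = n ∧ HasZeros G M := by
  induction n generalizing G with
  | zero =>
    have h1 := eval_ne_zero_of_isHomogeneous_zero hG h0 0
    refine ⟨0, rfl, eval 0 G, h1, MvPolynomial.funext fun q => ?_⟩
    simp [eval_eq_eval_of_isHomogeneous_zero hG q 0]
  | succ n ih =>
    obtain ⟨τ, hτ, hτG⟩ := exists_eval_eq_zero hG n.succ_pos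
    set p : P1 := Projectivization.mk ℂ τ hτ with hp
    obtain ⟨H, rfl⟩ := pointForm_dvd hG p.rep_nonzero ((eval_rep_mk_eq_zero_iff hG τ hτ).mpr hτG)
    have hH := (isHomogeneous_of_mul_right hG (isHomogeneous_pointForm _) h0).2
    obtain ⟨M, hM, a, ha, rfl⟩ := ih hH (right_ne_zero_of_mul h0)
    refine ⟨p ::ₘ M, by simp [hM], a, ha, ?_⟩
    rw [Multiset.map_cons, Multiset.prod_cons]
    ring

theorem eval_pointForm_rep_eq_zero_iff (p q : P1) : eval q.rep (pointForm p.rep) = 0 ↔ q = p := by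
  constructor
  · intro h
    by_contra hne
    have h1 : ¬ LinearIndependent ℂ ![p.rep, q.rep] := by
      rw [linearIndependent_pair_iff, not_not]
      rw [eval_pointForm] at h
      linear_combination -h
    rw [LinearIndependent.pair_iff' p.rep_nonzero] at h1
    push Not at h1
    obtain ⟨a, ha⟩ := h1
    apply hne
    rw [← p.mk_rep, ← q.mk_rep]
    exact (Projectivization.mk_eq_mk_iff' ℂ _ _ _ _).mpr ⟨a, ha⟩
  · rintro rfl
    rw [eval_pointForm]
    ring

theorem HasZeros.mem_iff {G : MvPolynomial (Fin 2) ℂ} {M : Multiset P1} (h : HasZeros G M)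
    (p : P1) : p ∈ M ↔ eval p.rep G = 0 := by
  obtain ⟨a, ha, rfl⟩ := h
  rw [map_mul, eval_C, map_multiset_prod, mul_eq_zero, or_iff_right ha, Multiset.prod_eq_zero_iff]
  simp only [Multiset.mem_map, exists_exists_and_eq_and, eval_pointForm_rep_eq_zero_iff]
  simp

theorem HasZeros.eval_pderiv_eq_zero [DecidableEq P1] {G : MvPolynomial (Fin 2) ℂ}
    {M : Multiset P1} (h : HasZeros G M) {p : P1} (hp : 2 ≤ M.count p) (i : Fin 2) :
    eval p.rep (pderiv i G) = 0 := by
  obtain ⟨a, ha, rfl⟩ := h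
  obtain ⟨N, rfl⟩ := Multiset.le_iff_exists_add.mp (Multiset.le_count_iff_replicate_le.mp hp)
  have h1 : eval p.rep (pointForm p.rep) = 0 := (eval_pointForm_rep_eq_zero_iff p p).mpr rfl
  simp [Multiset.replicate_succ, Derivation.leibniz, h1]

theorem expansion_eq_C_add (τ τ' : Fin 2 → ℂ) (a b : ℂ) :
    expansion τ τ' (C a * X 0 + C b * X 1) =
      PowerSeries.C (a * τ 0 + b * τ 1) + PowerSeries.C (a * τ' 0 + b * τ' 1) * PowerSeries.X := by
  simp only [expansion, map_add, map_mul, aeval_X, MvPolynomial.aeval_C]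
  simp only [PowerSeries.algebraMap_apply, Algebra.algebraMap_self, RingHom.id_apply]
  ring

theorem constantCoeff_expansion (τ τ' : Fin 2 → ℂ) (G : MvPolynomial (Fin 2) ℂ) :
    PowerSeries.constantCoeff (expansion τ τ' G) = eval τ G := by
  rw [expansion, MvPolynomial.map_aeval, MvPolynomial.eval, MvPolynomial.coe_eval₂Hom,
    MvPolynomial.coe_eval₂Hom]
  congr 1
  ext a
  simp

/-- The multiplicity of a zero is the order of the expansion in a local parameter. -/
theorem HasZeros.exists_expansion_eq [DecidableEq P1] {G : MvPolynomial (Fin 2) ℂ}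
    {M : Multiset P1} (h : HasZeros G M) {p : P1} {τ' : Fin 2 → ℂ}
    (hp : LinearIndependent ℂ ![p.rep, τ']) :
    ∃ u : (PowerSeries ℂ)ˣ, expansion p.rep τ' G = (u : PowerSeries ℂ) * PowerSeries.X ^ M.count p := by
  obtain ⟨a, ha, rfl⟩ := h
  rw [linearIndependent_pair_iff] at hp
  induction M using Multiset.induction_on with
  | empty =>
    obtain ⟨u, hu⟩ := (isUnit_iff_ne_zero.mpr ha).map (PowerSeries.C (R := ℂ))
    exact ⟨u, by simp [hu, expansion]⟩
  | cons q M ih =>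
    obtain ⟨u, hu⟩ := ih
    have h1 : expansion p.rep τ'
        (C a * ((q ::ₘ M).map fun p => pointForm p.rep).prod) =
        expansion p.rep τ' (pointForm q.rep) *
          expansion p.rep τ' (C a * (M.map fun p => pointForm p.rep).prod) := by
      simp only [expansion, Multiset.map_cons, Multiset.prod_cons, map_mul]
      ring
    rw [h1, hu]
    by_cases hpq : p = q
    · subst hpq
      have h2 : p.rep 1 * τ' 0 - p.rep 0 * τ' 1 ≠ 0 := by
        intro h3
        apply hp
        linear_combination -h3
      obtain ⟨v, hv⟩ := (isUnit_iff_ne_zero.mpr h2).map (PowerSeries.C (R := ℂ))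
      refine ⟨v * u, ?_⟩
      have h3 : pointForm p.rep = C (p.rep 1) * X 0 + C (-p.rep 0) * X 1 := by
        rw [pointForm, C_neg]
        ring
      have h4 : p.rep 1 * p.rep 0 + -p.rep 0 * p.rep 1 = 0 := by ring
      have h5 : p.rep 1 * τ' 0 + -p.rep 0 * τ' 1 = p.rep 1 * τ' 0 - p.rep 0 * τ' 1 := by ring
      rw [h3, expansion_eq_C_add, h4, h5, Units.val_mul, hv, Multiset.count_cons_self, pow_succ,
        map_zero, zero_add]
      ring
    · have h2 : IsUnit (expansion p.rep τ' (pointForm q.rep)) := by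
        rw [PowerSeries.isUnit_iff_constantCoeff, constantCoeff_expansion, isUnit_iff_ne_zero]
        exact fun h => hpq ((eval_pointForm_rep_eq_zero_iff q p).mp h)
      obtain ⟨v, hv⟩ := h2
      refine ⟨v * u, ?_⟩
      rw [Multiset.count_cons_of_ne hpq, Units.val_mul, hv]
      ring

theorem exists_linearIndependent_pair (τ : Fin 2 → ℂ) (hτ : τ ≠ 0) :
    ∃ τ', LinearIndependent ℂ ![τ, τ'] := by
  by_cases h : τ 0 = 0
  · refine ⟨![1, 0], (linearIndependent_pair_iff _ _).mpr ?_⟩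
    have h1 : τ 1 ≠ 0 := fun h1 => hτ (by ext i; fin_cases i <;> simpa)
    simpa using h1
  · exact ⟨![0, 1], (linearIndependent_pair_iff _ _).mpr (by simpa using h)⟩

theorem expansion_ne_zero {G : MvPolynomial (Fin 2) ℂ} {n : ℕ} (hG : G.IsHomogeneous n)
    (h0 : G ≠ 0) {p : P1} {τ' : Fin 2 → ℂ} (hp : LinearIndependent ℂ ![p.rep, τ']) :
    expansion p.rep τ' G ≠ 0 := by
  classical
  obtain ⟨M, -, hM⟩ := exists_hasZeros hG h0
  obtain ⟨u, hu⟩ := hM.exists_expansion_eq hp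
  rw [hu]
  exact mul_ne_zero u.ne_zero (pow_ne_zero _ PowerSeries.X_ne_zero)

theorem derivative_expansion (τ τ' : Fin 2 → ℂ) (G : MvPolynomial (Fin 2) ℂ) :
    PowerSeries.derivative ℂ (expansion τ τ' G) =
      PowerSeries.C (τ' 0) * expansion τ τ' (pderiv 0 G) +
      PowerSeries.C (τ' 1) * expansion τ τ' (pderiv 1 G) := by
  rw [expansion, derivation_aeval, Fin.sum_univ_two]
  simp [expansion, Derivation.leibniz, PowerSeries.derivative_C]
  ring

/-- Euler's identity in terms of expansions. -/
theorem natCast_mul_expansion (τ τ' : Fin 2 → ℂ) {G : MvPolynomial (Fin 2) ℂ} {n : ℕ}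
    (hG : G.IsHomogeneous n) : (n : PowerSeries ℂ) * expansion τ τ' G =
      (PowerSeries.C (τ 0) + PowerSeries.C (τ' 0) * PowerSeries.X) *
        expansion τ τ' (pderiv 0 G) +
      (PowerSeries.C (τ 1) + PowerSeries.C (τ' 1) * PowerSeries.X) *
        expansion τ τ' (pderiv 1 G) := by
  have h := congrArg (expansion τ τ') hG.sum_X_mul_pderiv
  simp only [expansion, Fin.sum_univ_two, map_add, map_mul, aeval_X, nsmul_eq_mul,
    map_natCast] at h
  exact h.symm

/-- In a pencil of binary forms without common zeros all but finitely many members have only simple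
zeros. In a multiple zero of a member the Jacobian of the pencil vanishes. -/
theorem exists_simple_zeros {e : ℕ} (he : 0 < e) {A B : MvPolynomial (Fin 2) ℂ}
    (hA : A.IsHomogeneous e) (hB : B.IsHomogeneous e)
    (hAB : ∀ τ : Fin 2 → ℂ, τ ≠ 0 → eval τ B = 0 → eval τ A ≠ 0) (Z : Finset P1) :
    ∃ (c : ℂ) (M : Multiset P1), HasZeros (A + C c * B) M ∧ M.card = e ∧ M.Nodup ∧
      ∀ p ∈ M, p ∉ Z := by
  classical
  obtain ⟨τ, hτ, hτB⟩ := exists_eval_eq_zero hB he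
  set p : P1 := Projectivization.mk ℂ τ hτ with hp
  have hpB : eval p.rep B = 0 := (eval_rep_mk_eq_zero_iff hB τ hτ).mpr hτB
  have hpA : eval p.rep A ≠ 0 := hAB _ p.rep_nonzero hpB
  have hB0 : B ≠ 0 := by
    rintro rfl
    obtain ⟨σ, hσ, hσA⟩ := exists_eval_eq_zero hA he
    exact hAB σ hσ (map_zero _) hσA
  set W := pderiv 0 A * pderiv 1 B - pderiv 1 A * pderiv 0 B with hW
  have hWh : W.IsHomogeneous (e - 1 + (e - 1)) :=
    (hA.pderiv.mul hB.pderiv).sub (hA.pderiv.mul hB.pderiv)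
  -- otherwise `A B' = A' B` for the expansions at a zero `p` of `B`; here `A` is a unit, and the
  -- order of `B'` is less than that of `B`
  have hW0 : W ≠ 0 := by
    intro h0
    obtain ⟨τ', hτ'⟩ := exists_linearIndependent_pair p.rep p.rep_nonzero
    obtain ⟨MB, -, hMB⟩ := exists_hasZeros hB hB0
    obtain ⟨u, hu⟩ := hMB.exists_expansion_eq hτ'
    have hk : 1 ≤ MB.count p := Multiset.one_le_count_iff_mem.mpr ((hMB.mem_iff p).mpr hpB)
    obtain ⟨k, hk⟩ := Nat.exists_eq_add_of_le' hk
    rw [hk] at hu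
    have hWe : expansion p.rep τ' (pderiv 0 A) * expansion p.rep τ' (pderiv 1 B) -
        expansion p.rep τ' (pderiv 1 A) * expansion p.rep τ' (pderiv 0 B) = 0 := by
      have := congrArg (expansion p.rep τ') h0
      simpa only [hW, expansion, map_sub, map_mul, map_zero] using this
    have hEA := natCast_mul_expansion p.rep τ' hA
    have hEB := natCast_mul_expansion p.rep τ' hB
    have hDA := derivative_expansion p.rep τ' A
    have hDB := derivative_expansion p.rep τ' B
    have hAunit : IsUnit (expansion p.rep τ' A) := by
      rw [PowerSeries.isUnit_iff_constantCoeff, constantCoeff_expansion, isUnit_iff_ne_zero]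
      exact hpA
    have h1 : (e : PowerSeries ℂ) * (expansion p.rep τ' A * PowerSeries.derivative ℂ
        (expansion p.rep τ' B) - PowerSeries.derivative ℂ (expansion p.rep τ' A) *
          expansion p.rep τ' B) = 0 := by
      rw [hDA, hDB]
      linear_combination (PowerSeries.C (τ' 0) * expansion p.rep τ' (pderiv 0 B) +
        PowerSeries.C (τ' 1) * expansion p.rep τ' (pderiv 1 B)) * hEA -
        (PowerSeries.C (τ' 0) * expansion p.rep τ' (pderiv 0 A) +
        PowerSeries.C (τ' 1) * expansion p.rep τ' (pderiv 1 A)) * hEB +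
        ((PowerSeries.C (p.rep 0) + PowerSeries.C (τ' 0) * PowerSeries.X) * PowerSeries.C (τ' 1) -
        (PowerSeries.C (p.rep 1) + PowerSeries.C (τ' 1) * PowerSeries.X) * PowerSeries.C (τ' 0)) *
          hWe
    have he0 : (e : PowerSeries ℂ) ≠ 0 := by
      intro h
      have h2 := congrArg PowerSeries.constantCoeff h
      rw [map_natCast, map_zero] at h2
      exact he.ne' (by exact_mod_cast h2)
    have h2 := sub_eq_zero.mp ((mul_eq_zero.mp h1).resolve_left he0)
    rw [hu, Derivation.leibniz, Derivation.leibniz_pow, PowerSeries.derivative_X] at h2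
    simp only [smul_eq_mul, nsmul_eq_mul, mul_one, Nat.add_sub_cancel] at h2
    have hXk : (PowerSeries.X : PowerSeries ℂ) ^ k ≠ 0 := pow_ne_zero _ PowerSeries.X_ne_zero
    have h3 : (PowerSeries.X : PowerSeries ℂ) ∣
        expansion p.rep τ' A * (u * ((k + 1 : ℕ) : PowerSeries ℂ)) := by
      refine ⟨PowerSeries.derivative ℂ (expansion p.rep τ' A) * u -
        expansion p.rep τ' A * PowerSeries.derivative ℂ u.val, mul_left_cancel₀ hXk ?_⟩
      rw [pow_succ] at h2
      linear_combination h2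
    rw [PowerSeries.X_dvd_iff, map_mul, map_mul, constantCoeff_expansion] at h3
    have h4 : PowerSeries.constantCoeff (u : PowerSeries ℂ) ≠ 0 :=
      (PowerSeries.isUnit_iff_constantCoeff.mp u.isUnit).ne_zero
    have h5 : PowerSeries.constantCoeff (((k + 1 : ℕ) : PowerSeries ℂ)) ≠ 0 := by
      rw [map_natCast]
      exact_mod_cast k.succ_ne_zero
    exact mul_ne_zero hpA (mul_ne_zero h4 h5) h3
  obtain ⟨MW, -, hMW⟩ := exists_hasZeros hWh hW0
  -- avoid the members of the pencil through a point of `Z` or a zero of the Jacobian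
  obtain ⟨c, hc⟩ := Infinite.exists_notMem_finset
    ((MW.toFinset ∪ Z).image fun q => -(eval q.rep A / eval q.rep B))
  have hABh : (A + C c * B).IsHomogeneous e := hA.add (hB.C_mul c)
  have hAB0 : A + C c * B ≠ 0 := by
    intro h0
    have := congrArg (eval p.rep) h0
    simp [hpB, hpA] at this
  obtain ⟨M, hM, hMz⟩ := exists_hasZeros hABh hAB0
  have hmem : ∀ q ∈ M, q ∉ MW.toFinset ∪ Z := by
    intro q hq hqZ
    have h1 := (hMz.mem_iff q).mp hq
    rw [map_add, map_mul, eval_C] at h1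
    have h2 : eval q.rep B ≠ 0 := by
      intro h2
      rw [h2, mul_zero, add_zero] at h1
      exact hAB _ q.rep_nonzero h2 h1
    refine hc (Finset.mem_image.mpr ⟨q, hqZ, ?_⟩)
    field_simp
    linear_combination -h1
  refine ⟨c, M, hMz, hM, ?_, fun q hq hqZ => hmem q hq (Finset.mem_union_right _ hqZ)⟩
  rw [Multiset.nodup_iff_count_le_one]
  intro q
  by_contra! hq
  have hqM : q ∈ M := Multiset.count_pos.mp (by omega)
  refine hmem q hqM (Finset.mem_union_left _ (Multiset.mem_toFinset.mpr ((hMW.mem_iff q).mpr ?_)))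
  have h0 := hMz.eval_pderiv_eq_zero hq 0
  have h1 := hMz.eval_pderiv_eq_zero hq 1
  simp only [map_add, Derivation.leibniz, derivation_C, smul_eq_mul, mul_zero, add_zero, map_mul,
    eval_C] at h0 h1
  rw [hW, map_sub, map_mul, map_mul]
  linear_combination eval q.rep (pderiv 1 B) * h0 - eval q.rep (pderiv 0 B) * h1

/-! ### Determinants -/

section Determinant

variable {R : Type*} [CommRing R]

/-- The determinant of the `i`-th unit vector and three further vectors, that is, up to sign, the
`i`-th entry of their cross product. -/
def crossDet (i : Fin 4) (x y z : Fin 4 → R) : R := (Matrix.of ![Pi.single i 1, x, y, z]).det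

theorem crossDet_eq (i : Fin 4) (x y z : Fin 4 → R) : crossDet i x y z =
    (-1) ^ (i : ℕ) * (
      x (i.succAbove 0) * (y (i.succAbove 1) * z (i.succAbove 2) -
        y (i.succAbove 2) * z (i.succAbove 1)) -
      x (i.succAbove 1) * (y (i.succAbove 0) * z (i.succAbove 2) -
        y (i.succAbove 2) * z (i.succAbove 0)) +
      x (i.succAbove 2) * (y (i.succAbove 0) * z (i.succAbove 1) -
        y (i.succAbove 1) * z (i.succAbove 0))) := by
  rw [crossDet, Matrix.det_succ_row_zero, Finset.sum_eq_single i]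
  · rw [Matrix.det_fin_three]
    simp only [Matrix.of_apply, Matrix.cons_val_zero, Pi.single_eq_same, Matrix.submatrix_apply,
      Matrix.cons_val_succ, Matrix.cons_val_one, mul_one]
    simp
    ring
  · intro j _ hj
    simp [hj]
  · simp

theorem crossDet_smul (i : Fin 4) (r : R) (x y z : Fin 4 → R) :
    crossDet i (r • x) y z = r * crossDet i x y z := by
  simp only [crossDet_eq, Pi.smul_apply, smul_eq_mul]
  ring

theorem crossDet_smul_right (i : Fin 4) (r : R) (x y z : Fin 4 → R) :
    crossDet i x y (r • z) = r * crossDet i x y z := by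
  simp only [crossDet_eq, Pi.smul_apply, smul_eq_mul]
  ring

theorem crossDet_combination (i : Fin 4) (r s t u : R) (x y z : Fin 4 → R) :
    crossDet i (r • x + s • y) (t • x + u • y) z = (r * u - s * t) * crossDet i x y z := by
  simp only [crossDet_eq, Pi.smul_apply, smul_eq_mul, Pi.add_apply]
  ring

theorem crossDet_add_right (i : Fin 4) (r s t : R) (x y z : Fin 4 → R) :
    crossDet i x y (r • z + s • x + t • y) = r * crossDet i x y z := by
  simp only [crossDet_eq, Pi.smul_apply, smul_eq_mul, Pi.add_apply]
  ring

open scoped Matrix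

/-- If the rows of `K` have the products `0` and `ρ (a × b)` with `g`, then `g` is proportional to
the cross product of the row `K 0` and the combinations of the other rows with coefficients `a` and
`b`. -/
theorem mul_crossDet_eq [IsDomain R] {K : Matrix (Fin 4) (Fin 4) R} (hK : K.det ≠ 0)
    {g : Fin 4 → R} {a b : Fin 3 → R} {ρ : R} (h0 : (K *ᵥ g) 0 = 0)
    (h : ∀ j, (K *ᵥ g) j.succ = ρ * (a ⨯₃ b) j) (i : Fin 4) :
    ρ * crossDet i (K 0) (∑ j, a j • K j.succ) (∑ j, b j • K j.succ) = -(K.det * g i) := by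
  set y : Fin 4 → R := K.adjugate i with hy
  have hyK : y ᵥ* K = K.det • Pi.single i 1 := by
    have h1 := congrFun (Matrix.adjugate_mul K) i
    funext k
    have h2 := congrFun h1 k
    rw [Matrix.mul_apply_eq_vecMul] at h2
    rw [hy, h2, Matrix.smul_apply, Matrix.one_apply, Pi.smul_apply, Pi.single_apply]
    simp [eq_comm]
  have hyg : K.det * g i = ρ * (y 1 * (a ⨯₃ b) 0 + y 2 * (a ⨯₃ b) 1 + y 3 * (a ⨯₃ b) 2) := by
    have h1 : y ⬝ᵥ (K *ᵥ g) = K.det * g i := by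
      rw [Matrix.dotProduct_mulVec, hyK, smul_dotProduct, single_one_dotProduct, smul_eq_mul]
    rw [← h1, dotProduct, Fin.sum_univ_succ, h0, Fin.sum_univ_three, h, h, h]
    simp only [Fin.succ_zero_eq_one, Fin.succ_one_eq_two]
    rw [show Fin.succ (2 : Fin 3) = 3 from rfl]
    ring
  set Y : Matrix (Fin 4) (Fin 4) R :=
    Matrix.of ![y, Pi.single 0 1, ![0, a 0, a 1, a 2], ![0, b 0, b 1, b 2]] with hY
  have hYdet : Y.det = -(y 1 * (a ⨯₃ b) 0 + y 2 * (a ⨯₃ b) 1 + y 3 * (a ⨯₃ b) 2) := by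
    rw [hY, Matrix.det_succ_row _ 1, Fin.sum_univ_four]
    simp only [Matrix.of_apply, Matrix.cons_val_one, Matrix.cons_val_zero]
    rw [Pi.single_eq_same, Pi.single_eq_of_ne (by decide), Pi.single_eq_of_ne (by decide),
      Pi.single_eq_of_ne (by decide), Matrix.det_fin_three]
    simp [cross_apply, Matrix.submatrix_apply, Fin.succAbove]
    ring
  have hmul : Y * K = Matrix.of ![K.det • Pi.single i 1, K 0, ∑ j, a j • K j.succ,
      ∑ j, b j • K j.succ] := by
    funext k
    rw [Matrix.mul_apply_eq_vecMul]
    fin_cases k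
    · exact hyK
    · funext l
      simp [hY, Matrix.vecMul, dotProduct, Fin.sum_univ_succ]
    · funext l
      simp [hY, Matrix.vecMul, dotProduct, Fin.sum_univ_succ]
    · funext l
      simp [hY, Matrix.vecMul, dotProduct, Fin.sum_univ_succ]
  have hdet : Y.det * K.det = K.det * crossDet i (K 0) (∑ j, a j • K j.succ)
      (∑ j, b j • K j.succ) := by
    rw [← Matrix.det_mul, hmul, crossDet]
    have := Matrix.det_updateRow_smul (Matrix.of ![Pi.single i 1, K 0, ∑ j, a j • K j.succ,
      ∑ j, b j • K j.succ]) 0 K.det (Pi.single i 1)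
    convert this using 2
    · ext k l
      fin_cases k <;> simp [Matrix.updateRow_apply]
    · congr 1
      ext k l
      fin_cases k <;> simp [Matrix.updateRow_apply]
  rw [hyg]
  refine mul_left_cancel₀ hK ?_
  rw [hYdet] at hdet
  linear_combination -ρ * hdet

/-- A vector orthogonal to `a` and `b` is proportional to their cross product. -/
theorem mul_crossProduct_eq {a b v : Fin 3 → R} (ha : ∑ j, v j * a j = 0) (hb : ∑ j, v j * b j = 0)
    (j k : Fin 3) : v j * (a ⨯₃ b) k = v k * (a ⨯₃ b) j := by
  rw [Fin.sum_univ_three] at ha hb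
  simp only [cross_apply]
  fin_cases j <;> fin_cases k <;> simp
  · linear_combination a 2 * hb - b 2 * ha
  · linear_combination b 1 * ha - a 1 * hb
  · linear_combination b 2 * ha - a 2 * hb
  · linear_combination a 0 * hb - b 0 * ha
  · linear_combination a 1 * hb - b 1 * ha
  · linear_combination b 0 * ha - a 0 * hb

end Determinant

/-! ### Charts of the blow-up -/

section Chart

variable {R : Type*} [CommRing R] [Algebra ℂ R]

theorem blowUpChart_of_mem {S : Set P3} {b : Module.Basis (Fin 4) ℂ (Fin 4 → ℂ)}
    (h : Projectivization.mk ℂ (b 0) (b.ne_zero 0) ∈ S) (i : Fin 4) : blowUpChart S b i =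
      C (b 0 i) + X 0 * (C (b 1 i) + X 1 * C (b 2 i) + X 2 * C (b 3 i)) := by
  rw [blowUpChart, if_pos h]

theorem blowUpChart_of_notMem {S : Set P3} {b : Module.Basis (Fin 4) ℂ (Fin 4 → ℂ)}
    (h : Projectivization.mk ℂ (b 0) (b.ne_zero 0) ∉ S) : blowUpChart S b = affineChart b := by
  funext i
  rw [blowUpChart, if_neg h]

theorem pderiv_affineChart (b : Module.Basis (Fin 4) ℂ (Fin 4 → ℂ)) (j : Fin 3) (i : Fin 4) :
    pderiv j (affineChart b i) = C (b j.succ i) := by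
  classical
  simp [affineChart, Derivation.leibniz, pderiv_X, Pi.single_apply]

theorem pderiv_aeval_affineChart (b : Module.Basis (Fin 4) ℂ (Fin 4 → ℂ)) (j : Fin 3)
    (F : MvPolynomial (Fin 4) ℂ) : pderiv j (aeval (affineChart b) F) =
      aeval (affineChart b) (dirDeriv (b j.succ) F) := by
  rw [derivation_aeval, aeval_dirDeriv]
  refine Finset.sum_congr rfl fun i _ => ?_
  rw [pderiv_affineChart, mul_comm]
  rfl

open Classical in
/-- The equation of the exceptional divisor along a curve `γ` in the chart attached to `b`. -/
def exceptionalEquation (S : Set P3) (b : Module.Basis (Fin 4) ℂ (Fin 4 → ℂ)) (γ : Fin 3 → R) : R :=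
  if Projectivization.mk ℂ (b 0) (b.ne_zero 0) ∈ S then γ 0 else 1

/-- The matrix of the chart attached to `b` along a curve `γ`: its first row is the
curve in homogeneous coordinates, and the other rows are the partial derivatives of the chart. -/
def chartMatrix (S : Set P3) (b : Module.Basis (Fin 4) ℂ (Fin 4 → ℂ)) (γ : Fin 3 → R) :
    Matrix (Fin 4) (Fin 4) R :=
  Fin.cons (fun i => aeval γ (blowUpChart S b i))
    fun j i => aeval γ (pderiv j (blowUpChart S b i))

theorem det_basis_ne_zero (b : Module.Basis (Fin 4) ℂ (Fin 4 → ℂ)) :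
    (Matrix.of fun i => b i).det ≠ 0 := by
  have h := Matrix.linearIndependent_rows_iff_isUnit (A := Matrix.of fun i => b i)
  rw [Matrix.isUnit_iff_isUnit_det, isUnit_iff_ne_zero] at h
  exact h.mp b.linearIndependent

/-- The Jacobian of the blow-up is the square of the equation of the exceptional divisor. -/
theorem det_chartMatrix (S : Set P3) (b : Module.Basis (Fin 4) ℂ (Fin 4 → ℂ)) (γ : Fin 3 → R) :
    (chartMatrix S b γ).det = exceptionalEquation S b γ ^ 2 *
      algebraMap ℂ R (Matrix.of fun i => b i).det := by
  have hB : algebraMap ℂ R (Matrix.of fun i => b i).det =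
      ((Matrix.of fun i => b i).map (algebraMap ℂ R)).det := by
    rw [RingHom.map_det]
    rfl
  by_cases h : Projectivization.mk ℂ (b 0) (b.ne_zero 0) ∈ S
  · have hmul : chartMatrix S b γ = Matrix.of ![![1, γ 0, γ 0 * γ 1, γ 0 * γ 2],
        ![0, 1, γ 1, γ 2], ![0, 0, γ 0, 0], ![0, 0, 0, γ 0]] *
        (Matrix.of fun i => b i).map (algebraMap ℂ R) := by
      ext k i
      fin_cases k
      · simp [chartMatrix, blowUpChart_of_mem h, Matrix.mul_apply, Fin.sum_univ_four]
        ring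
      · change aeval γ (pderiv 0 (blowUpChart S b i)) = _
        simp [blowUpChart_of_mem h, Matrix.mul_apply, Fin.sum_univ_four,
          Derivation.leibniz, pderiv_X]
      · change aeval γ (pderiv 1 (blowUpChart S b i)) = _
        simp [blowUpChart_of_mem h, Matrix.mul_apply, Fin.sum_univ_four,
          Derivation.leibniz, pderiv_X]
      · change aeval γ (pderiv 2 (blowUpChart S b i)) = _
        simp [blowUpChart_of_mem h, Matrix.mul_apply, Fin.sum_univ_four,
          Derivation.leibniz, pderiv_X]
    rw [hmul, Matrix.det_mul, hB, exceptionalEquation, if_pos h]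
    congr 1
    simp [Matrix.det_succ_row_zero, Fin.sum_univ_succ]
    ring
  · have hmul : chartMatrix S b γ = Matrix.of ![![1, γ 0, γ 1, γ 2],
        ![0, 1, 0, 0], ![0, 0, 1, 0], ![0, 0, 0, 1]] *
        (Matrix.of fun i => b i).map (algebraMap ℂ R) := by
      ext k i
      fin_cases k
      · simp [chartMatrix, blowUpChart_of_notMem h, affineChart, Matrix.mul_apply,
          Fin.sum_univ_succ]
      · change aeval γ (pderiv 0 (blowUpChart S b i)) = _
        simp [blowUpChart_of_notMem h, pderiv_affineChart, Matrix.mul_apply,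
          Fin.sum_univ_four]
      · change aeval γ (pderiv 1 (blowUpChart S b i)) = _
        simp [blowUpChart_of_notMem h, pderiv_affineChart, Matrix.mul_apply,
          Fin.sum_univ_four]
      · change aeval γ (pderiv 2 (blowUpChart S b i)) = _
        simp [blowUpChart_of_notMem h, pderiv_affineChart, Matrix.mul_apply,
          Fin.sum_univ_four]
    rw [hmul, Matrix.det_mul, hB, exceptionalEquation, if_neg h]
    congr 1
    simp [Matrix.det_succ_row_zero, Fin.sum_univ_succ]

theorem aeval_aeval_chart {S : Set P3} {b : Module.Basis (Fin 4) ℂ (Fin 4 → ℂ)} (γ : Fin 3 → R)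
    (G : MvPolynomial (Fin 4) ℂ) : aeval γ (aeval (blowUpChart S b) G) =
      aeval (fun i => aeval γ (blowUpChart S b i)) G :=
  comp_aeval_apply _ _ _

theorem IsStrictTransformEquation.aeval_eq {F : MvPolynomial (Fin 4) ℂ} {S : Set P3}
    {b : Module.Basis (Fin 4) ℂ (Fin 4 → ℂ)} {f : MvPolynomial (Fin 3) ℂ}
    (hf : IsStrictTransformEquation F S b f) (γ : Fin 3 → R) :
    exceptionalEquation S b γ ^ 3 * aeval γ f =
      aeval (fun i => aeval γ (blowUpChart S b i)) F := by
  rw [← aeval_aeval_chart]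
  by_cases h : Projectivization.mk ℂ (b 0) (b.ne_zero 0) ∈ S
  · rw [← hf.1 h, exceptionalEquation, if_pos h]
    simp
  · rw [← hf.2 h, exceptionalEquation, if_neg h]
    simp

open scoped Matrix in
/-- The gradients of the surface and of its strict transform along a curve on the strict transform. -/
theorem IsStrictTransformEquation.chartMatrix_mulVec {F : MvPolynomial (Fin 4) ℂ} {S : Set P3}
    {b : Module.Basis (Fin 4) ℂ (Fin 4 → ℂ)} {f : MvPolynomial (Fin 3) ℂ}
    (hf : IsStrictTransformEquation F S b f) {γ : Fin 3 → R} (hγ : aeval γ f = 0) (j : Fin 3) :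
    (chartMatrix S b γ *ᵥ fun i => aeval (fun i => aeval γ (blowUpChart S b i)) (pderiv i F))
      j.succ = exceptionalEquation S b γ ^ 3 * aeval γ (pderiv j f) := by
  have h1 : (chartMatrix S b γ *ᵥ fun i => aeval (fun i => aeval γ (blowUpChart S b i))
      (pderiv i F)) j.succ = aeval γ (pderiv j (aeval (blowUpChart S b) F)) := by
    rw [derivation_aeval, map_sum (aeval γ), Matrix.mulVec, dotProduct]
    refine Finset.sum_congr rfl fun i _ => ?_
    rw [map_mul, aeval_aeval_chart, mul_comm]
    rfl
  rw [h1]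
  by_cases h : Projectivization.mk ℂ (b 0) (b.ne_zero 0) ∈ S
  · rw [← hf.1 h, exceptionalEquation, if_pos h]
    simp [Derivation.leibniz, hγ]
  · rw [← hf.2 h, exceptionalEquation, if_neg h]
    simp

/-- Surfaces through the blown up points contain the exceptional divisor after pullback. -/
theorem exceptionalEquation_dvd {S : Set P3} {b : Module.Basis (Fin 4) ℂ (Fin 4 → ℂ)}
    (γ : Fin 3 → R) {G : MvPolynomial (Fin 4) ℂ}
    (hG : Projectivization.mk ℂ (b 0) (b.ne_zero 0) ∈ S → eval (b 0) G = 0) :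
    exceptionalEquation S b γ ∣ aeval (fun i => aeval γ (blowUpChart S b i)) G := by
  by_cases h : Projectivization.mk ℂ (b 0) (b.ne_zero 0) ∈ S
  · rw [exceptionalEquation, if_pos h]
    have := dvd_aeval_of_eval_eq_zero (γ 0)
      (fun i => aeval γ (C (b 1 i) + X 1 * C (b 2 i) + X 2 * C (b 3 i))) (hG h)
    simpa [blowUpChart_of_mem h] using this
  · rw [exceptionalEquation, if_neg h]
    exact one_dvd _

/-- Surfaces that are singular in the blown up points contain twice the exceptional divisor after
pullback. -/
theorem exceptionalEquation_sq_dvd {S : Set P3} {b : Module.Basis (Fin 4) ℂ (Fin 4 → ℂ)}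
    (γ : Fin 3 → R) {G : MvPolynomial (Fin 4) ℂ}
    (hG : Projectivization.mk ℂ (b 0) (b.ne_zero 0) ∈ S →
      eval (b 0) G = 0 ∧ ∀ i, eval (b 0) (pderiv i G) = 0) :
    exceptionalEquation S b γ ^ 2 ∣ aeval (fun i => aeval γ (blowUpChart S b i)) G := by
  by_cases h : Projectivization.mk ℂ (b 0) (b.ne_zero 0) ∈ S
  · rw [exceptionalEquation, if_pos h]
    have := sq_dvd_aeval_of_eval_eq_zero (γ 0)
      (fun i => aeval γ (C (b 1 i) + X 1 * C (b 2 i) + X 2 * C (b 3 i))) (hG h).1 (hG h).2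
    simpa [blowUpChart_of_mem h] using this
  · rw [exceptionalEquation, if_neg h, one_pow]
    exact one_dvd _

end Chart

theorem mk_basis_notMem_span_singleton (b : Module.Basis (Fin 4) ℂ (Fin 4 → ℂ)) (a : ℂ) :
    b 1 ≠ a • b 0 := by
  intro h
  have h1 := congrArg (fun v => b.repr v 1) h
  simp at h1

/-- The strict transform of the surface is smooth. Over a triple point this is the smoothness of the
tangent cone. -/
theorem IsStrictTransformEquation.exists_pderiv_ne_zero {F : MvPolynomial (Fin 4) ℂ}
    (hF : F.IsHomogeneous 6)
    (hsing : ∀ P ∈ singularLocus F, IsOrdinaryTriplePoint F P)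
    {b : Module.Basis (Fin 4) ℂ (Fin 4 → ℂ)} {f : MvPolynomial (Fin 3) ℂ}
    (hf : IsStrictTransformEquation F (singularLocus F) b f) (h0 : eval 0 f = 0) :
    ∃ j, eval 0 (pderiv j f) ≠ 0 := by
  by_contra! hno
  by_cases h : Projectivization.mk ℂ (b 0) (b.ne_zero 0) ∈ singularLocus F
  · have htrip : IsTripleVector F (b 0) := by
      obtain ⟨a, ha, hab⟩ := exists_rep_mk_eq_smul (b 0) (b.ne_zero 0)
      have h1 := ((hsing _ h).isTripleVector_rep hF).smul hF (inv_ne_zero ha)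
      rwa [hab, smul_smul, inv_mul_cancel₀ ha, one_smul] at h1
    -- restrict to the line through the triple point with direction `b 1`
    set θ : MvPolynomial (Fin 3) ℂ →ₐ[ℂ] Polynomial ℂ := aeval ![Polynomial.X, 0, 0] with hθ
    have hθ0 : ∀ g, (θ g).coeff 0 = eval 0 g := by
      intro g
      rw [Polynomial.coeff_zero_eq_eval_zero, ← Polynomial.coe_evalRingHom, hθ,
        MvPolynomial.map_aeval, MvPolynomial.eval, MvPolynomial.coe_eval₂Hom,
        MvPolynomial.coe_eval₂Hom]
      congr 1
      · ext; simp
      · ext i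
        fin_cases i <;> simp
    have hθchart : ∀ G, θ (aeval (blowUpChart (singularLocus F) b) G) =
        lineRestriction G (b 0) (b 1) := by
      intro G
      rw [comp_aeval_apply, lineRestriction]
      congr 2
      funext i
      simp [blowUpChart_of_mem h, hθ]
    have hX : θ (X 0) = Polynomial.X := by simp [hθ]
    have h3 : eval (b 0) (dirDeriv (b 1) (dirDeriv (b 1) (dirDeriv (b 1) F))) = 0 := by
      have h1 := congrArg θ (hf.1 h)
      rw [hθchart, map_mul, map_pow, hX, mul_comm] at h1
      rw [coeff_lineRestriction_three, ← h1, Polynomial.coeff_mul_X_pow' , if_pos le_rfl,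
        Nat.sub_self, hθ0, h0, mul_zero]
    have h2 : ∀ j : Fin 2, eval (b 0) (dirDeriv (b 1) (dirDeriv (b 1)
        (dirDeriv (b j.succ.succ) F))) = 0 := by
      intro j
      have h1 := congrArg (pderiv j.succ) (hf.1 h)
      rw [derivation_aeval, Derivation.leibniz, Derivation.leibniz_pow,
        pderiv_X_of_ne (Fin.succ_ne_zero j).symm] at h1
      have h4 : ∀ i, pderiv j.succ (blowUpChart (singularLocus F) b i) =
          X 0 * C (b j.succ.succ i) := by
        intro i
        rw [blowUpChart_of_mem h]
        fin_cases j <;> simp [Derivation.leibniz, pderiv_X]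
      have h5 : (X 0 : MvPolynomial (Fin 3) ℂ) ^ 2 * pderiv j.succ f =
          aeval (blowUpChart (singularLocus F) b) (dirDeriv (b j.succ.succ) F) := by
        refine mul_left_cancel₀ (X_ne_zero (0 : Fin 3)) ?_
        rw [aeval_dirDeriv, Finset.mul_sum]
        simp only [mul_zero, smul_zero, add_zero, smul_eq_mul, h4] at h1
        rw [← mul_assoc, ← pow_succ', h1]
        refine Finset.sum_congr rfl fun i _ => ?_
        rw [algebraMap_eq]
        ring
      have h6 := congrArg θ h5
      rw [hθchart, map_mul, map_pow, hX, mul_comm] at h6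
      rw [coeff_lineRestriction_two, ← h6, Polynomial.coeff_mul_X_pow', if_pos le_rfl,
        Nat.sub_self, hθ0, hno, mul_zero]
    have h1 : eval (b 0) (dirDeriv (b 1) (dirDeriv (b 1) (dirDeriv (b 0) F))) = 0 := by
      rw [dirDeriv_comm (b 1) (b 0), dirDeriv_comm (b 1) (b 0), eval_dirDeriv_self
        (isHomogeneous_dirDeriv (isHomogeneous_dirDeriv hF _) _), htrip.second, mul_zero]
    obtain ⟨a, ha⟩ := htrip.cone (b 1) fun z => by
      let Z : Module.Dual ℂ (Fin 4 → ℂ) :=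
        { toFun := fun z => eval (b 0) (dirDeriv (b 1) (dirDeriv (b 1) (dirDeriv z F)))
          map_add' := fun v w => by simp only [dirDeriv_add_left, map_add]
          map_smul' := fun a w => by
            simp [dirDeriv_smul_left, Derivation.leibniz] }
      have hZ : Z = 0 := b.ext fun j => by
        fin_cases j
        · exact h1
        · exact h3
        · exact h2 0
        · exact h2 1
      exact LinearMap.congr_fun hZ z
    exact mk_basis_notMem_span_singleton b a ha
  · have hchart := blowUpChart_of_notMem h
    have hf2 := hf.2 h
    rw [hchart] at hf2
    have hb : chartPoint b 0 = b 0 := by simp [chartPoint]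
    rw [hf2, eval_aeval_affineChart, hb] at h0
    apply h
    rw [mk_mem_singularLocus_iff hF]
    refine ⟨h0, fun i => ?_⟩
    rw [← dirDeriv_single]
    let Z : Module.Dual ℂ (Fin 4 → ℂ) :=
      { toFun := fun w => eval (b 0) (dirDeriv w F)
        map_add' := fun v w => by rw [dirDeriv_add_left, map_add]
        map_smul' := fun a w => by rw [dirDeriv_smul_left, map_mul, eval_C]; rfl }
    have hZ : Z = 0 := b.ext fun j => by
      refine Fin.cases ?_ (fun j => ?_) j
      · change eval (b 0) (dirDeriv (b 0) F) = 0
        rw [eval_dirDeriv_self hF, h0, mul_zero]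
      · have h1 := hno j
        rw [hf2, pderiv_aeval_affineChart, eval_aeval_affineChart, hb] at h1
        exact h1
    exact LinearMap.congr_fun hZ _

/-! ### Parametrized curves -/

theorem eval_aeval_eq {n m : ℕ} (φ : Fin n → MvPolynomial (Fin m) ℂ) (τ : Fin m → ℂ)
    (G : MvPolynomial (Fin n) ℂ) : eval τ (aeval φ G) = eval (fun i => eval τ (φ i)) G := by
  rw [MvPolynomial.map_aeval, MvPolynomial.eval, MvPolynomial.coe_eval₂Hom, MvPolynomial.eval,
    MvPolynomial.coe_eval₂Hom]
  congr 1
  ext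
  simp

theorem constantCoeff_aeval {n : ℕ} (γ : Fin n → PowerSeries ℂ) (G : MvPolynomial (Fin n) ℂ) :
    PowerSeries.constantCoeff (aeval γ G) =
      eval (fun j => PowerSeries.constantCoeff (γ j)) G := by
  rw [MvPolynomial.map_aeval, MvPolynomial.eval, MvPolynomial.coe_eval₂Hom,
    MvPolynomial.coe_eval₂Hom]
  rfl

theorem expansion_aeval (τ τ' : Fin 2 → ℂ) (φ : Fin 4 → MvPolynomial (Fin 2) ℂ)
    (G : MvPolynomial (Fin 4) ℂ) :
    expansion τ τ' (aeval φ G) = aeval (fun i => expansion τ τ' (φ i)) G :=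
  comp_aeval_apply _ _ _

namespace ParametrizesStrictTransform

variable {S : Set P3} {C : IrreducibleCurve} {e : ℕ} {φ : Fin 4 → MvPolynomial (Fin 2) ℂ}

theorem mk_mem (hφ : ParametrizesStrictTransform S C.carrier e φ) {τ : Fin 2 → ℂ} (hτ : τ ≠ 0) :
    Projectivization.mk ℂ (fun i => eval τ (φ i)) (hφ.base_point_free τ hτ) ∈ C.carrier :=
  (hφ.image _).mpr ⟨τ, hτ, rfl⟩

theorem isHomogeneous_aeval (hφ : ParametrizesStrictTransform S C.carrier e φ) {n : ℕ}
    {G : MvPolynomial (Fin 4) ℂ} (hG : G.IsHomogeneous n) : (aeval φ G).IsHomogeneous (e * n) :=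
  hG.aeval φ hφ.homogeneous

theorem aeval_eq_zero_iff (hφ : ParametrizesStrictTransform S C.carrier e φ) {n : ℕ}
    {G : MvPolynomial (Fin 4) ℂ} (hG : G.IsHomogeneous n) :
    aeval φ G = 0 ↔ VanishesOn G C.carrier := by
  constructor
  · intro h Q hQ
    obtain ⟨τ, hτ, rfl⟩ := (hφ.image Q).mp hQ
    rw [eval_rep_mk_eq_zero_iff hG, ← eval_aeval_eq, h, map_zero]
  · intro h
    -- the factor `X 0` takes care of the point `0`, which is not a point of the projective line
    refine (mul_eq_zero.mp (?_ : X 0 * aeval φ G = 0)).resolve_left (X_ne_zero 0)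
    refine MvPolynomial.funext fun τ => ?_
    rw [map_mul, eval_X, map_zero]
    by_cases hτ : τ = 0
    · rw [hτ, Pi.zero_apply, zero_mul]
    · rw [eval_aeval_eq, (eval_rep_mk_eq_zero_iff hG _ (hφ.base_point_free τ hτ)).mp
        (h _ (hφ.mk_mem hτ)), mul_zero]

theorem degree_pos (hφ : ParametrizesStrictTransform S C.carrier e φ) : 0 < e := by
  by_contra! he
  obtain rfl : e = 0 := by omega
  obtain ⟨P, hP, Q, hQ, hPQ⟩ := C.exists_ne
  obtain ⟨τ, hτ, rfl⟩ := (hφ.image P).mp hP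
  obtain ⟨σ, hσ, rfl⟩ := (hφ.image Q).mp hQ
  refine hPQ ((Projectivization.mk_eq_mk_iff' ℂ _ _ _ _).mpr ⟨1, ?_⟩)
  funext i
  rw [one_smul]
  exact eval_eq_eval_of_isHomogeneous_zero (hφ.homogeneous i) _ _

end ParametrizesStrictTransform

namespace IsLocalLift

variable {S : Set P3} {e : ℕ} {φ : Fin 4 → MvPolynomial (Fin 2) ℂ} {τ τ' : Fin 2 → ℂ}
  {b : Module.Basis (Fin 4) ℂ (Fin 4 → ℂ)} {γ : Fin 3 → PowerSeries ℂ}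

theorem aeval_eq {c : (PowerSeries ℂ)ˣ} (hc : ∀ i, aeval γ (blowUpChart S b i) =
      (c : PowerSeries ℂ) * expansion τ τ' (φ i)) {n : ℕ}
    {G : MvPolynomial (Fin 4) ℂ} (hG : G.IsHomogeneous n) :
    aeval (fun i => aeval γ (blowUpChart S b i)) G =
      (c : PowerSeries ℂ) ^ n * expansion τ τ' (aeval φ G) := by
  rw [funext hc, aeval_mul_of_isHomogeneous hG, expansion_aeval]

/-- The lift maps `[τ]` to a point over `[b 0]`. -/
theorem exists_eq_smul (h : IsLocalLift S φ τ τ' b γ) :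
    ∃ a : ℂ, a ≠ 0 ∧ b 0 = a • fun i => eval τ (φ i) := by
  obtain ⟨c, hc⟩ := h.lifts
  refine ⟨PowerSeries.constantCoeff (c : PowerSeries ℂ),
    (PowerSeries.isUnit_iff_constantCoeff.mp c.isUnit).ne_zero, ?_⟩
  funext i
  have h1 := congrArg PowerSeries.constantCoeff (hc i)
  rw [constantCoeff_aeval, map_mul, constantCoeff_expansion, funext h.centred] at h1
  rw [Pi.smul_apply, smul_eq_mul, ← h1]
  by_cases hS : Projectivization.mk ℂ (b 0) (b.ne_zero 0) ∈ S
  · simp [blowUpChart_of_mem hS]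
  · simp [blowUpChart_of_notMem hS, affineChart]

theorem mk_eq (h : IsLocalLift S φ τ τ' b γ) (h0 : (fun i => eval τ (φ i)) ≠ 0) :
    Projectivization.mk ℂ (b 0) (b.ne_zero 0) = Projectivization.mk ℂ _ h0 := by
  obtain ⟨a, ha, hab⟩ := h.exists_eq_smul
  exact (Projectivization.mk_eq_mk_iff' ℂ _ _ _ _).mpr ⟨a, hab.symm⟩

/-- The lifted curve is not contained in the exceptional divisor. -/
theorem exceptionalEquation_ne_zero {C : IrreducibleCurve}
    (hφ : ParametrizesStrictTransform S C.carrier e φ) {p : P1}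
    (h : IsLocalLift S φ p.rep τ' b γ) : exceptionalEquation S b γ ≠ 0 := by
  by_cases hS : Projectivization.mk ℂ (b 0) (b.ne_zero 0) ∈ S
  · rw [exceptionalEquation, if_pos hS]
    intro h0
    obtain ⟨Q, hQ, hQb⟩ := C.infinite.exists_notMem_finset
      {Projectivization.mk ℂ (b 0) (b.ne_zero 0)}
    have hne : Projectivization.mk ℂ (b 0) (b.ne_zero 0) ≠ Q := fun h => hQb (by simp [h])
    obtain ⟨f, hf, hfQ⟩ := exists_dual_apply_eq (linearIndependent_rep_pair hne) 0 1
    have hf0 : f (b 0) = 0 := by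
      obtain ⟨a, ha, hab⟩ := exists_rep_mk_eq_smul (b 0) (b.ne_zero 0)
      rw [hab, map_smul, smul_eq_mul] at hf
      exact (mul_eq_zero.mp hf).resolve_left ha
    obtain ⟨c, hc⟩ := h.lifts
    have hL := isHomogeneous_linForm f
    have h1 := IsLocalLift.aeval_eq hc hL
    have h2 : ∀ i, aeval γ (blowUpChart S b i) = algebraMap ℂ (PowerSeries ℂ) (b 0 i) := by
      intro i
      rw [blowUpChart_of_mem hS]
      simp [h0]
    have h3 : aeval (fun i => algebraMap ℂ (PowerSeries ℂ) (b 0 i)) (linForm f) =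
        algebraMap ℂ (PowerSeries ℂ) (eval (b 0) (linForm f)) :=
      (aeval_algebraMap_apply _ (b 0) _).trans (by rw [aeval_eq_eval])
    rw [funext h2, h3, eval_linForm, hf0, map_zero, eq_comm, mul_eq_zero,
      or_iff_right (pow_ne_zero _ c.ne_zero)] at h1
    have h4 : aeval φ (linForm f) = 0 := by
      by_contra hne
      exact expansion_ne_zero (hφ.isHomogeneous_aeval hL) hne h.parameter h1
    have h5 := (hφ.aeval_eq_zero_iff hL).mp h4 Q hQ
    rw [eval_linForm, hfQ] at h5
    exact one_ne_zero h5
  · rw [exceptionalEquation, if_neg hS]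
    exact one_ne_zero

end IsLocalLift

/-! ### The normal bundle of the strict transform -/

/-- The entries of the cross product of the partial derivatives of `φ` and of `w`. They describe the
image of `w` in the normal bundle of the parametrized curve. -/
def normalForm (φ w : Fin 4 → MvPolynomial (Fin 2) ℂ) (i : Fin 4) : MvPolynomial (Fin 2) ℂ :=
  crossDet i (fun k => pderiv 0 (φ k)) (fun k => pderiv 1 (φ k)) w

theorem isHomogeneous_normalForm {φ w : Fin 4 → MvPolynomial (Fin 2) ℂ} {e m : ℕ}
    (hφ : ∀ i, (φ i).IsHomogeneous e) (hw : ∀ i, (w i).IsHomogeneous m) (i : Fin 4) :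
    (normalForm φ w i).IsHomogeneous (e - 1 + (e - 1 + m)) := by
  rw [normalForm, crossDet_eq]
  have h1 : ((-1) ^ (i : ℕ) : MvPolynomial (Fin 2) ℂ) = C ((-1) ^ (i : ℕ)) := by simp
  rw [h1]
  refine IsHomogeneous.C_mul ?_ _
  have h2 : ∀ j k l, (pderiv 0 (φ j) * (pderiv 1 (φ k) * w l - pderiv 1 (φ l) * w k)).IsHomogeneous
      (e - 1 + (e - 1 + m)) := fun j k l =>
    (hφ j).pderiv.mul (((hφ k).pderiv.mul (hw l)).sub ((hφ l).pderiv.mul (hw k)))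
  exact ((h2 _ _ _).sub (h2 _ _ _)).add (h2 _ _ _)

theorem expansion_normalForm (τ τ' : Fin 2 → ℂ) (φ w : Fin 4 → MvPolynomial (Fin 2) ℂ)
    (i : Fin 4) : expansion τ τ' (normalForm φ w i) =
      crossDet i (fun k => expansion τ τ' (pderiv 0 (φ k)))
        (fun k => expansion τ τ' (pderiv 1 (φ k))) (fun k => expansion τ τ' (w k)) := by
  simp only [normalForm, crossDet_eq, expansion, map_mul, map_sub, map_add, map_pow, map_neg,
    map_one]

theorem isUnit_C {a : ℂ} (ha : a ≠ 0) : IsUnit (PowerSeries.C a) :=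
  (isUnit_iff_ne_zero.mpr ha).map (PowerSeries.C (R := ℂ))

/-- The determinant of `φ`, its derivative and `w` in terms of the homogeneous partial derivatives
of `φ`. -/
theorem natCast_mul_crossDet_expansion {φ w : Fin 4 → MvPolynomial (Fin 2) ℂ} {e : ℕ}
    (hφ : ∀ i, (φ i).IsHomogeneous e) (τ τ' : Fin 2 → ℂ) (i : Fin 4) :
    (e : PowerSeries ℂ) * crossDet i (fun k => expansion τ τ' (φ k))
      (fun k => PowerSeries.derivative ℂ (expansion τ τ' (φ k))) (fun k => expansion τ τ' (w k)) =
      PowerSeries.C (τ 0 * τ' 1 - τ 1 * τ' 0) * expansion τ τ' (normalForm φ w i) := by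
  have hE : (e : PowerSeries ℂ) • (fun k => expansion τ τ' (φ k)) =
      (PowerSeries.C (τ 0) + PowerSeries.C (τ' 0) * PowerSeries.X) •
        (fun k => expansion τ τ' (pderiv 0 (φ k))) +
      (PowerSeries.C (τ 1) + PowerSeries.C (τ' 1) * PowerSeries.X) •
        fun k => expansion τ τ' (pderiv 1 (φ k)) :=
    funext fun k => natCast_mul_expansion τ τ' (hφ k)
  have hD : (fun k => PowerSeries.derivative ℂ (expansion τ τ' (φ k))) =
      PowerSeries.C (τ' 0) • (fun k => expansion τ τ' (pderiv 0 (φ k))) +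
      PowerSeries.C (τ' 1) • fun k => expansion τ τ' (pderiv 1 (φ k)) :=
    funext fun k => derivative_expansion τ τ' (φ k)
  rw [← crossDet_smul, hE, hD, crossDet_combination, expansion_normalForm, map_sub, map_mul,
    map_mul]
  ring

theorem derivative_chart (S : Set P3) (b : Module.Basis (Fin 4) ℂ (Fin 4 → ℂ))
    (γ : Fin 3 → PowerSeries ℂ) :
    (fun i => PowerSeries.derivative ℂ (aeval γ (blowUpChart S b i))) =
      ∑ j, PowerSeries.derivative ℂ (γ j) • chartMatrix S b γ j.succ := by
  funext i
  rw [derivation_aeval, Finset.sum_apply]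
  refine Finset.sum_congr rfl fun j _ => ?_
  rw [Pi.smul_apply, smul_eq_mul, mul_comm]
  rfl

theorem crossDet_chart {S : Set P3} {b : Module.Basis (Fin 4) ℂ (Fin 4 → ℂ)}
    {γ : Fin 3 → PowerSeries ℂ} {Φ : Fin 4 → PowerSeries ℂ} {c : PowerSeries ℂ}
    (hc : ∀ i, aeval γ (blowUpChart S b i) = c * Φ i) (V : Fin 4 → PowerSeries ℂ) (i : Fin 4) :
    crossDet i (chartMatrix S b γ 0)
      (∑ j, PowerSeries.derivative ℂ (γ j) • chartMatrix S b γ j.succ) V =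
      c ^ 2 * crossDet i Φ (fun k => PowerSeries.derivative ℂ (Φ k)) V := by
  have h0 : chartMatrix S b γ 0 =
      c • Φ + (0 : PowerSeries ℂ) • fun k => PowerSeries.derivative ℂ (Φ k) := by
    rw [zero_smul, add_zero]
    exact funext hc
  have h1 : (∑ j, PowerSeries.derivative ℂ (γ j) • chartMatrix S b γ j.succ) =
      PowerSeries.derivative ℂ c • Φ + c • fun k => PowerSeries.derivative ℂ (Φ k) := by
    rw [← derivative_chart]
    funext k
    simp only [hc, Derivation.leibniz, Pi.add_apply, Pi.smul_apply, smul_eq_mul]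
    ring
  rw [h0, h1, crossDet_combination]
  ring

open scoped Matrix in
theorem map_crossProduct {R R' : Type*} [CommRing R] [CommRing R'] (f : R →+* R')
    (u v : Fin 3 → R) (k : Fin 3) :
    f ((u ⨯₃ v) k) = ((fun j => f (u j)) ⨯₃ fun j => f (v j)) k := by
  fin_cases k <;> simp [cross_apply]

open scoped Matrix in
/-- The gradient of the strict transform of the surface along a curve is a multiple of the cross
product of two tangent vectors. -/
theorem exists_gradient_eq {F : MvPolynomial (Fin 4) ℂ} (hF : F.IsHomogeneous 6)
    (hsing : ∀ P ∈ singularLocus F, IsOrdinaryTriplePoint F P)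
    {b : Module.Basis (Fin 4) ℂ (Fin 4 → ℂ)} {γ : Fin 3 → PowerSeries ℂ}
    (hγ : ∀ j, PowerSeries.constantCoeff (γ j) = 0) {f : MvPolynomial (Fin 3) ℂ}
    (hf : IsStrictTransformEquation F (singularLocus F) b f) (hfγ : aeval γ f = 0)
    {η : Fin 3 → PowerSeries ℂ} (hη : ∑ j, aeval γ (pderiv j f) * η j = 0)
    (hind : LinearIndependent ℂ ![fun j => PowerSeries.constantCoeff (η j),
      fun j => PowerSeries.coeff 1 (γ j)]) :
    ∃ κ : (PowerSeries ℂ)ˣ, ∀ j, aeval γ (pderiv j f) =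
      (κ : PowerSeries ℂ) * ((fun j => PowerSeries.derivative ℂ (γ j)) ⨯₃ η) j := by
  set γ' : Fin 3 → PowerSeries ℂ := fun j => PowerSeries.derivative ℂ (γ j) with hγ'
  have hf0 : eval 0 f = 0 := by
    have h4 := congrArg PowerSeries.constantCoeff hfγ
    rw [constantCoeff_aeval, funext hγ, map_zero] at h4
    exact h4
  have hfγ' : ∑ j, aeval γ (pderiv j f) * γ' j = 0 := by
    rw [← derivation_aeval, hfγ, map_zero]
  have hγ'0 : (fun j => PowerSeries.constantCoeff (γ' j)) = fun j => PowerSeries.coeff 1 (γ j) := by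
    funext j
    rw [← PowerSeries.coeff_zero_eq_constantCoeff_apply, hγ', PowerSeries.coeff_derivative]
    simp
  obtain ⟨k, hk⟩ : ∃ k, IsUnit ((γ' ⨯₃ η) k) := by
    set x : Fin 3 → ℂ := fun j => PowerSeries.coeff 1 (γ j)
    set y : Fin 3 → ℂ := fun j => PowerSeries.constantCoeff (η j)
    have h3 : LinearIndependent ℂ ![x, y] := LinearIndependent.pair_symm_iff.mp hind
    have h4 : x ⨯₃ y ≠ 0 := crossProduct_ne_zero_iff_linearIndependent.mpr h3
    obtain ⟨k, hk⟩ := Function.ne_iff.mp h4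
    refine ⟨k, PowerSeries.isUnit_iff_constantCoeff.mpr ?_⟩
    rw [map_crossProduct, hγ'0, isUnit_iff_ne_zero]
    exact hk
  obtain ⟨v, hv⟩ := hk
  set κ := aeval γ (pderiv k f) * (v⁻¹ : (PowerSeries ℂ)ˣ) with hκ
  have hgrad : ∀ j, aeval γ (pderiv j f) = κ * (γ' ⨯₃ η) j := by
    intro j
    have h4 := mul_crossProduct_eq hfγ' hη j k
    rw [← hv] at h4
    have h5 : (v : PowerSeries ℂ) * (v⁻¹ : (PowerSeries ℂ)ˣ) = 1 := v.mul_inv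
    rw [hκ]
    linear_combination (v⁻¹ : (PowerSeries ℂ)ˣ).val * h4 - aeval γ (pderiv j f) * h5
  have hκu : IsUnit κ := by
    obtain ⟨j, hj⟩ := hf.exists_pderiv_ne_zero hF hsing hf0
    rw [PowerSeries.isUnit_iff_constantCoeff, isUnit_iff_ne_zero]
    intro h0
    apply hj
    have h4 := congrArg PowerSeries.constantCoeff (hgrad j)
    rw [constantCoeff_aeval, funext hγ, map_mul, h0, zero_mul] at h4
    exact h4
  obtain ⟨u, hu⟩ := hκu
  exact ⟨u, hu ▸ hgrad⟩

open scoped Matrix in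
/-- The gradient of the surface and the cross product `normalForm φ w` are both normal to the surface
along the curve. Their quotient is determined by the order of `w` in the normal bundle
of the strict transform and by the order of contact with the exceptional divisor. -/
theorem exists_normalForm_eq {F : MvPolynomial (Fin 4) ℂ} (hF : F.IsHomogeneous 6)
    (hsing : ∀ P ∈ singularLocus F, IsOrdinaryTriplePoint F P) {C : IrreducibleCurve}
    (hCF : C.carrier ⊆ surface F) {e : ℕ} {φ w : Fin 4 → MvPolynomial (Fin 2) ℂ}
    (hφ : ParametrizesStrictTransform (singularLocus F) C.carrier e φ) {p : P1} {τ' : Fin 2 → ℂ}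
    {b : Module.Basis (Fin 4) ℂ (Fin 4 → ℂ)} {γ : Fin 3 → PowerSeries ℂ}
    (hγ : IsLocalLift (singularLocus F) φ p.rep τ' b γ) {f : MvPolynomial (Fin 3) ℂ}
    (hf : IsStrictTransformEquation F (singularLocus F) b f)
    {η : Fin 3 → PowerSeries ℂ} (hη : ∑ j, aeval γ (pderiv j f) * η j = 0)
    (hind : LinearIndependent ℂ ![fun j => PowerSeries.constantCoeff (η j),
      fun j => PowerSeries.coeff 1 (γ j)]) {A B M N : PowerSeries ℂ}
    (hw : ∀ i, B * expansion p.rep τ' (w i) =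
      A * ∑ j, aeval γ (pderiv j (blowUpChart (singularLocus F) b i)) * η j
        + M * expansion p.rep τ' (φ i)
        + N * PowerSeries.derivative ℂ (expansion p.rep τ' (φ i))) :
    ∃ u : (PowerSeries ℂ)ˣ, ∀ i, B * exceptionalEquation (singularLocus F) b γ *
      expansion p.rep τ' (normalForm φ w i) =
        (u : PowerSeries ℂ) * A * expansion p.rep τ' (aeval φ (pderiv i F)) := by
  set S := singularLocus F with hS
  set ξ := exceptionalEquation S b γ with hξ
  have hξ0 : ξ ≠ 0 := hγ.exceptionalEquation_ne_zero hφ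
  obtain ⟨c, hc⟩ := hγ.lifts
  set K := chartMatrix S b γ with hK
  set Φ : Fin 4 → PowerSeries ℂ := fun k => expansion p.rep τ' (φ k) with hΦ
  set Φ' : Fin 4 → PowerSeries ℂ := fun k => PowerSeries.derivative ℂ (Φ k) with hΦ'
  set W : Fin 4 → PowerSeries ℂ := fun k => expansion p.rep τ' (w k) with hW
  set V : Fin 4 → PowerSeries ℂ := ∑ j, η j • K j.succ with hV
  set γ' : Fin 3 → PowerSeries ℂ := fun j => PowerSeries.derivative ℂ (γ j) with hγ'
  set β' : Fin 4 → PowerSeries ℂ := ∑ j, γ' j • K j.succ with hβ'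
  set g : Fin 4 → PowerSeries ℂ :=
    fun i => aeval (fun i => aeval γ (blowUpChart S b i)) (pderiv i F) with hg
  set δ : ℂ := p.rep 0 * τ' 1 - p.rep 1 * τ' 0 with hδ
  have hδ0 : δ ≠ 0 := (linearIndependent_pair_iff _ _).mp hγ.parameter
  have h1 : ∀ i, (e : PowerSeries ℂ) * crossDet i Φ Φ' W =
      PowerSeries.C δ * expansion p.rep τ' (normalForm φ w i) :=
    natCast_mul_crossDet_expansion hφ.homogeneous p.rep τ'
  have hWV : B • W = A • V + M • Φ + N • Φ' := by
    funext k
    have hVk : V k = ∑ j, aeval γ (pderiv j (blowUpChart S b k)) * η j := by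
      rw [hV, Finset.sum_apply]
      exact Finset.sum_congr rfl fun j _ => mul_comm _ _
    simp only [Pi.add_apply, Pi.smul_apply, smul_eq_mul, hVk]
    exact hw k
  have h2 : ∀ i, B * crossDet i Φ Φ' W = A * crossDet i Φ Φ' V := fun i => by
    rw [← crossDet_smul_right, hWV, crossDet_add_right]
  have h3 : ∀ i, crossDet i (K 0) β' V = (c : PowerSeries ℂ) ^ 2 * crossDet i Φ Φ' V :=
    crossDet_chart hc V
  have hFβ : aeval (fun i => aeval γ (blowUpChart S b i)) F = 0 := by
    rw [IsLocalLift.aeval_eq hc hF, (hφ.aeval_eq_zero_iff hF).mpr fun Q hQ => hCF hQ]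
    simp [expansion]
  have hfγ : aeval γ f = 0 := by
    have h4 := hf.aeval_eq γ
    rw [hFβ] at h4
    exact (mul_eq_zero.mp h4).resolve_left (pow_ne_zero 3 hξ0)
  obtain ⟨κ, hgrad⟩ := exists_gradient_eq hF hsing hγ.centred hf hfγ hη hind
  -- comparison with the gradient of `F`
  have hKdet : K.det = ξ ^ 2 * PowerSeries.C (Matrix.of fun i => b i).det := det_chartMatrix S b γ
  have hδb := det_basis_ne_zero b
  have hKdet0 : K.det ≠ 0 := by
    rw [hKdet]
    exact mul_ne_zero (pow_ne_zero 2 hξ0) (isUnit_C hδb).ne_zero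
  have hKg0 : (K *ᵥ g) 0 = 0 := by
    have h4 := congrArg (aeval fun i => aeval γ (blowUpChart S b i)) hF.sum_X_mul_pderiv
    rw [map_sum, map_nsmul, hFβ, smul_zero] at h4
    rw [← h4, Matrix.mulVec, dotProduct]
    refine Finset.sum_congr rfl fun i _ => ?_
    rw [map_mul, aeval_X]
    rfl
  have hKg : ∀ j, (K *ᵥ g) j.succ = ξ ^ 3 * (κ : PowerSeries ℂ) * (γ' ⨯₃ η) j := by
    intro j
    rw [mul_assoc, ← hgrad]
    exact hf.chartMatrix_mulVec hfγ j
  have h5 : ∀ i, ξ * (κ : PowerSeries ℂ) * crossDet i (K 0) β' V =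
      -(PowerSeries.C (Matrix.of fun i => b i).det *
        ((c : PowerSeries ℂ) ^ 5 * expansion p.rep τ' (aeval φ (pderiv i F)))) := by
    intro i
    have h6 := mul_crossDet_eq hKdet0 hKg0 hKg i
    have h7 : g i = (c : PowerSeries ℂ) ^ 5 * expansion p.rep τ' (aeval φ (pderiv i F)) :=
      IsLocalLift.aeval_eq hc hF.pderiv
    rw [hKdet, h7] at h6
    refine mul_left_cancel₀ (pow_ne_zero 2 hξ0) ?_
    linear_combination h6
  have hu₁ : IsUnit (PowerSeries.C δ * (c : PowerSeries ℂ) ^ 2 * (κ : PowerSeries ℂ)) :=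
    ((isUnit_C hδ0).mul (c.isUnit.pow 2)).mul κ.isUnit
  have hu₂ : IsUnit (-((e : PowerSeries ℂ) * PowerSeries.C (Matrix.of fun i => b i).det *
      (c : PowerSeries ℂ) ^ 5)) := by
    have he : IsUnit (e : PowerSeries ℂ) := by
      rw [← map_natCast (PowerSeries.C (R := ℂ))]
      exact isUnit_C (by exact_mod_cast hφ.degree_pos.ne')
    exact ((he.mul (isUnit_C hδb)).mul (c.isUnit.pow 5)).neg
  obtain ⟨u₁, hu₁⟩ := hu₁
  obtain ⟨u₂, hu₂⟩ := hu₂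
  refine ⟨u₁⁻¹ * u₂, fun i => ?_⟩
  rw [Units.val_mul, mul_assoc, mul_assoc, mul_assoc, Units.eq_inv_mul_iff_mul_eq, hu₁, hu₂]
  have e1 := h1 i
  have e2 := h2 i
  have e3 := h3 i
  have e5 := h5 i
  linear_combination (-(B * ξ * (c : PowerSeries ℂ) ^ 2 * (κ : PowerSeries ℂ))) * e1 +
    (ξ * (c : PowerSeries ℂ) ^ 2 * (κ : PowerSeries ℂ) * e) * e2 - (A * ξ * (κ : PowerSeries ℂ) * e) * e3 + (A * e) * e5

/-! ### Contact with the exceptional divisor -/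

theorem exists_eq_unit_mul_X_pow {ξ : PowerSeries ℂ} (h : ξ ≠ 0) :
    ∃ u : (PowerSeries ℂ)ˣ, ξ = (u : PowerSeries ℂ) * PowerSeries.X ^ ξ.order.toNat :=
  ⟨PowerSeries.Unit_of_divided_by_X_pow_order ξ, by
    rw [PowerSeries.Unit_of_divided_by_X_pow_order_nonzero h, mul_comm]
    exact PowerSeries.X_pow_order_mul_divXPowOrder.symm⟩

theorem le_of_X_pow_dvd {k n : ℕ} {u : PowerSeries ℂ} (hu : IsUnit u)
    (h : PowerSeries.X ^ k ∣ u * PowerSeries.X ^ n) : k ≤ n :=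
  (pow_dvd_pow_iff PowerSeries.X_ne_zero PowerSeries.X_prime.not_isUnit).mp (hu.dvd_mul_left.mp h)

theorem eq_of_unit_mul_X_pow {k n : ℕ} {u v : PowerSeries ℂ} (hu : IsUnit u) (hv : IsUnit v)
    (h : u * PowerSeries.X ^ k = v * PowerSeries.X ^ n) : k = n :=
  le_antisymm (le_of_X_pow_dvd hv (h ▸ dvd_mul_left _ _))
    (le_of_X_pow_dvd hu (h ▸ dvd_mul_left _ _))

theorem HasZeros.ne_zero {G : MvPolynomial (Fin 2) ℂ} {M : Multiset P1} (h : HasZeros G M) :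
    G ≠ 0 := by
  classical
  rintro rfl
  set p : P1 := Projectivization.mk ℂ ![1, 0] (by simp)
  obtain ⟨τ', hτ'⟩ := exists_linearIndependent_pair p.rep p.rep_nonzero
  obtain ⟨u, hu⟩ := h.exists_expansion_eq hτ'
  have h0 : expansion p.rep τ' 0 = 0 := by simp [expansion]
  rw [h0] at hu
  exact mul_ne_zero u.ne_zero (pow_ne_zero _ PowerSeries.X_ne_zero) hu.symm

section Contact

variable {F : MvPolynomial (Fin 4) ℂ} {C : IrreducibleCurve} {e : ℕ}
  {φ : Fin 4 → MvPolynomial (Fin 2) ℂ}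

open Classical in
/-- The order of contact `μ` of the lifted curve with the exceptional divisor relates the order of a
section of the normal bundle to the zeros of binary forms, and it bounds the order of contact of the
curve with surfaces through the triple points from below. -/
theorem HasNormalOrder.exists_contact (hF : F.IsHomogeneous 6)
    (hsing : ∀ P ∈ singularLocus F, IsOrdinaryTriplePoint F P) (hCF : C.carrier ⊆ surface F)
    (hφ : ParametrizesStrictTransform (singularLocus F) C.carrier e φ)
    {w : Fin 4 → MvPolynomial (Fin 2) ℂ} {p : P1} {k : ℤ}
    (h : HasNormalOrder F (singularLocus F) φ w p.rep k) :
    ∃ μ : ℕ,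
      (∀ i, normalForm φ w i = 0 → aeval φ (pderiv i F) = 0) ∧
      (∀ i MT MG, HasZeros (normalForm φ w i) MT → HasZeros (aeval φ (pderiv i F)) MG →
        (MT.count p : ℤ) - MG.count p = k - μ) ∧
      (∀ (n : ℕ) (G : MvPolynomial (Fin 4) ℂ) (M : Multiset P1), G.IsHomogeneous n →
        (∀ Q ∈ singularLocus F ∩ C.carrier, eval Q.rep G = 0) →
        HasZeros (aeval φ G) M → μ ≤ M.count p) ∧
      (∀ (n : ℕ) (G : MvPolynomial (Fin 4) ℂ) (M : Multiset P1), G.IsHomogeneous n →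
        (∀ Q ∈ singularLocus F ∩ C.carrier,
          eval Q.rep G = 0 ∧ ∀ w, eval Q.rep (dirDeriv w G) = 0) →
        HasZeros (aeval φ G) M → 2 * μ ≤ M.count p) ∧
      (Projectivization.mk ℂ _ (hφ.base_point_free p.rep p.rep_nonzero) ∉ singularLocus F →
        μ = 0) := by
  obtain ⟨τ', b, γ, f, η, A, B, M, N, hγ, hf, hη, hind, hA, hB, hw, rfl⟩ := h
  obtain ⟨u, hu⟩ := exists_normalForm_eq hF hsing hCF hφ hγ hf hη hind hw
  set ξ := exceptionalEquation (singularLocus F) b γ with hξ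
  have hξ0 : ξ ≠ 0 := hγ.exceptionalEquation_ne_zero hφ
  obtain ⟨uA, hAu⟩ := exists_eq_unit_mul_X_pow hA
  obtain ⟨uB, hBu⟩ := exists_eq_unit_mul_X_pow hB
  obtain ⟨uξ, hξu⟩ := exists_eq_unit_mul_X_pow hξ0
  obtain ⟨c, hc⟩ := hγ.lifts
  have hmk := hγ.mk_eq (hφ.base_point_free p.rep p.rep_nonzero)
  have hmem : Projectivization.mk ℂ (b 0) (b.ne_zero 0) ∈ C.carrier :=
    hmk ▸ hφ.mk_mem p.rep_nonzero
  refine ⟨ξ.order.toNat, fun i hi => ?_, fun i MT MG hT hG => ?_, fun n G M hG hGS hM => ?_,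
    fun n G M hG hGS hM => ?_, fun hp => ?_⟩
  · have h1 := hu i
    have h0 : expansion p.rep τ' 0 = 0 := by simp [expansion]
    rw [hi, h0, mul_zero, eq_comm, mul_eq_zero, or_iff_right (mul_ne_zero u.ne_zero hA)] at h1
    by_contra hne
    exact expansion_ne_zero (hφ.isHomogeneous_aeval hF.pderiv) hne hγ.parameter h1
  · obtain ⟨uT, hT⟩ := hT.exists_expansion_eq hγ.parameter
    obtain ⟨uG, hG⟩ := hG.exists_expansion_eq hγ.parameter
    have h1 := hu i
    rw [hT, hG] at h1
    have h2 : ((uB * uξ * uT : (PowerSeries ℂ)ˣ) : PowerSeries ℂ) *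
        PowerSeries.X ^ (B.order.toNat + ξ.order.toNat + MT.count p) =
        ((u * uA * uG : (PowerSeries ℂ)ˣ) : PowerSeries ℂ) *
          PowerSeries.X ^ (A.order.toNat + MG.count p) := by
      simp only [Units.val_mul, pow_add]
      conv at h1 => lhs; rw [hBu, hξu]
      conv at h1 => rhs; rw [hAu]
      linear_combination h1
    have h3 := eq_of_unit_mul_X_pow (Units.isUnit _) (Units.isUnit _) h2
    omega
  · obtain ⟨v, hv⟩ := hM.exists_expansion_eq hγ.parameter
    have h1 : ξ ∣ aeval (fun i => aeval γ (blowUpChart (singularLocus F) b i)) G :=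
      exceptionalEquation_dvd γ fun hS =>
        (eval_rep_mk_eq_zero_iff hG _ _).mp (hGS _ ⟨hS, hmem⟩)
    rw [IsLocalLift.aeval_eq hc hG, hv, hξu, uξ.isUnit.mul_left_dvd, ← mul_assoc] at h1
    exact le_of_X_pow_dvd ((c.isUnit.pow n).mul v.isUnit) h1
  · obtain ⟨v, hv⟩ := hM.exists_expansion_eq hγ.parameter
    have h1 : ξ ^ 2 ∣ aeval (fun i => aeval γ (blowUpChart (singularLocus F) b i)) G :=
      exceptionalEquation_sq_dvd γ fun hS => by
        obtain ⟨h2, h3⟩ := hGS _ ⟨hS, hmem⟩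
        refine ⟨(eval_rep_mk_eq_zero_iff hG _ _).mp h2, fun i => ?_⟩
        rw [← dirDeriv_single]
        exact (eval_rep_mk_eq_zero_iff (isHomogeneous_dirDeriv hG _) _ _).mp (h3 _)
    rw [IsLocalLift.aeval_eq hc hG, hv, hξu, mul_pow, (uξ.isUnit.pow 2).mul_left_dvd, ← mul_assoc,
      ← pow_mul, mul_comm _ 2] at h1
    exact le_of_X_pow_dvd ((c.isUnit.pow n).mul v.isUnit) h1
  · rw [hξ, exceptionalEquation, if_neg (hmk ▸ hp)]
    simp

/-- A curve of self-intersection `-1` meets the exceptional divisor with total multiplicity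
`2 e + 1`. -/
theorem HasNormalDegree.exists_contact [DecidableEq P1] (hF : F.IsHomogeneous 6)
    (hsing : ∀ P ∈ singularLocus F, IsOrdinaryTriplePoint F P) (hCF : C.carrier ⊆ surface F)
    (hφ : ParametrizesStrictTransform (singularLocus F) C.carrier e φ)
    (h : HasNormalDegree F (singularLocus F) e φ (-1)) :
    ∃ (μ : P1 → ℕ) (s : Finset P1), ∑ p ∈ s, μ p = 2 * e + 1 ∧
      (∀ (n : ℕ) (G : MvPolynomial (Fin 4) ℂ) (M : Multiset P1), G.IsHomogeneous n →
        (∀ Q ∈ singularLocus F ∩ C.carrier, eval Q.rep G = 0) →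
        HasZeros (aeval φ G) M → ∀ p, μ p ≤ M.count p) ∧
      (∀ (n : ℕ) (G : MvPolynomial (Fin 4) ℂ) (M : Multiset P1), G.IsHomogeneous n →
        (∀ Q ∈ singularLocus F ∩ C.carrier,
          eval Q.rep G = 0 ∧ ∀ w, eval Q.rep (dirDeriv w G) = 0) →
        HasZeros (aeval φ G) M → ∀ p, 2 * μ p ≤ M.count p) ∧
      (∀ p : P1, Projectivization.mk ℂ _ (hφ.base_point_free p.rep p.rep_nonzero) ∉
        singularLocus F → μ p = 0) := by
  obtain ⟨m, w, o, hw, ho, hsum⟩ := h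
  choose μ h0 hcount h1 h2 hoff using fun p => (ho p).exists_contact hF hsing hCF hφ
  obtain ⟨i, hi⟩ := exists_not_vanishesOn_pderiv hF (finite_singularLocus hF hsing) C
  have hG0 : aeval φ (pderiv i F) ≠ 0 := fun h => hi ((hφ.aeval_eq_zero_iff hF.pderiv).mp h)
  obtain ⟨p₀⟩ : Nonempty P1 := inferInstance
  have hT0 : normalForm φ w i ≠ 0 := fun h => hG0 (h0 p₀ i h)
  obtain ⟨MT, hMT, hT⟩ := exists_hasZeros (isHomogeneous_normalForm hφ.homogeneous hw i) hT0
  obtain ⟨MG, hMG, hG⟩ := exists_hasZeros (hφ.isHomogeneous_aeval hF.pderiv) hG0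
  set s := MT.toFinset ∪ MG.toFinset ∪ o.support with hs
  refine ⟨μ, s, ?_, fun n G M hG hS hM p => ?_, fun n G M hG hS hM p => ?_, hoff⟩
  -- the sum over all points of `MT.count - MG.count = o - μ`; here `o` has sum `-1 + (m - e)`
  · have e1 : ∑ p ∈ s, MT.count p = e - 1 + (e - 1 + m) := by
      rw [Multiset.sum_count_eq_card fun p hp => by simp [hs, hp], hMT]
    have e2 : ∑ p ∈ s, MG.count p = e * 5 := by
      rw [Multiset.sum_count_eq_card fun p hp => by simp [hs, hp], hMG]
    have e3 : ∑ p ∈ s, o p = -1 + ((m : ℤ) - e) := by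
      rw [← hsum, Finsupp.sum_of_support_subset o Finset.subset_union_right _ fun _ _ => rfl]
    have e4 : ∑ p ∈ s, ((MT.count p : ℤ) - MG.count p) = ∑ p ∈ s, (o p - μ p) := by
      refine Finset.sum_congr rfl fun p _ => ?_
      convert hcount p i MT MG hT hG
    rw [Finset.sum_sub_distrib, Finset.sum_sub_distrib, e3] at e4
    have e5 : ((∑ p ∈ s, μ p : ℕ) : ℤ) = 2 * e + 1 := by
      have he := hφ.degree_pos
      have e1' : ∑ p ∈ s, (MT.count p : ℤ) = ((e - 1 + (e - 1 + m) : ℕ) : ℤ) := by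
        exact_mod_cast e1
      have e2' : ∑ p ∈ s, (MG.count p : ℤ) = ((e * 5 : ℕ) : ℤ) := by
        exact_mod_cast e2
      rw [e1', e2'] at e4
      push_cast
      omega
    exact_mod_cast e5
  · convert h1 p n G M hG hS hM
  · convert h2 p n G M hG hS hM

theorem sum_le_card_of_le_count [DecidableEq P1] {M : Multiset P1} (s : Finset P1) {μ : P1 → ℕ}
    (h : ∀ p, μ p ≤ M.count p) : ∑ p ∈ s, μ p ≤ M.card := by
  calc ∑ p ∈ s, μ p ≤ ∑ p ∈ s ∪ M.toFinset, μ p :=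
        Finset.sum_le_sum_of_subset Finset.subset_union_left
    _ ≤ ∑ p ∈ s ∪ M.toFinset, M.count p := Finset.sum_le_sum fun p _ => h p
    _ = M.card := Multiset.sum_count_eq_card fun p hp => by simp [hp]

end Contact

/-! ### The degree of the parametrization -/

/-- Outside the blown up points the curve itself lifts to the affine charts. -/
theorem exists_isLocalLift {S : Set P3} {φ : Fin 4 → MvPolynomial (Fin 2) ℂ} {τ τ' : Fin 2 → ℂ}
    (hτ : LinearIndependent ℂ ![τ, τ']) {b : Module.Basis (Fin 4) ℂ (Fin 4 → ℂ)} {a : ℂ}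
    (ha : a ≠ 0) (hab : (fun i => eval τ (φ i)) = a • b 0)
    (hS : Projectivization.mk ℂ (b 0) (b.ne_zero 0) ∉ S) : ∃ γ, IsLocalLift S φ τ τ' b γ := by
  let y : Fin 4 → PowerSeries ℂ := fun j =>
    ∑ i, PowerSeries.C (b.repr (Pi.single i 1) j) * expansion τ τ' (φ i)
  have hy : ∀ j, PowerSeries.constantCoeff (y j) = a * b.repr (b 0) j := by
    intro j
    have h1 := dual_apply_eq_sum (b.coord j) (fun i => eval τ (φ i))
    rw [hab, map_smul, smul_eq_mul] at h1
    rw [← b.coord_apply, h1, map_sum]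
    refine Finset.sum_congr rfl fun i _ => ?_
    rw [map_mul, PowerSeries.constantCoeff_C, constantCoeff_expansion, b.coord_apply]
  have hy0 : IsUnit (y 0) := by
    rw [PowerSeries.isUnit_iff_constantCoeff, hy]
    simpa using ha
  obtain ⟨v, hv⟩ := hy0
  have hsum : ∀ i, ∑ j, y j * PowerSeries.C (b j i) = expansion τ τ' (φ i) := by
    intro i
    have h1 : ∀ k, ∑ j, b.repr (Pi.single k 1) j * b j i = Pi.single (M := fun _ => ℂ) k 1 i := by
      intro k
      have h2 := congrFun (b.sum_repr (Pi.single k 1)) i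
      rw [Finset.sum_apply] at h2
      rw [← h2]
      rfl
    calc ∑ j, y j * PowerSeries.C (b j i)
        = ∑ k, PowerSeries.C (∑ j, b.repr (Pi.single k 1) j * b j i) * expansion τ τ' (φ k) := by
          simp only [y, Finset.sum_mul, map_sum, map_mul]
          rw [Finset.sum_comm]
          refine Finset.sum_congr rfl fun k _ => Finset.sum_congr rfl fun j _ => ?_
          ring
      _ = expansion τ τ' (φ i) := by
          simp only [h1]
          rw [Finset.sum_eq_single i]
          · simp
          · intro k _ hk
            rw [Pi.single_eq_of_ne' hk, map_zero, zero_mul]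
          · simp
  refine ⟨fun j => (v⁻¹ : (PowerSeries ℂ)ˣ) * y j.succ, hτ, fun j => ?_, v⁻¹, fun i => ?_⟩
  · rw [map_mul, hy, b.repr_self, Finsupp.single_eq_of_ne (Fin.succ_ne_zero j), mul_zero, mul_zero]
  · have h1 : (v⁻¹ : (PowerSeries ℂ)ˣ).val * y 0 = 1 := by rw [← hv, Units.inv_mul]
    rw [blowUpChart_of_notMem hS, ← hsum, Fin.sum_univ_succ]
    simp only [affineChart, map_add, map_sum, map_mul, aeval_X, MvPolynomial.aeval_C,
      PowerSeries.algebraMap_apply, Algebra.algebraMap_self, RingHom.id_apply]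
    rw [mul_add, ← mul_assoc, h1, one_mul, Finset.mul_sum]
    congr 1
    exact Finset.sum_congr rfl fun j _ => by ring

namespace ParametrizesStrictTransform

variable {S : Set P3} {C : IrreducibleCurve} {e : ℕ} {φ : Fin 4 → MvPolynomial (Fin 2) ℂ}

/-- The parametrization is injective outside the blown up points. -/
theorem eq_of_mk_eq (hφ : ParametrizesStrictTransform S C.carrier e φ) {p q : P1}
    (h : Projectivization.mk ℂ _ (hφ.base_point_free p.rep p.rep_nonzero) =
      Projectivization.mk ℂ _ (hφ.base_point_free q.rep q.rep_nonzero))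
    (hS : Projectivization.mk ℂ _ (hφ.base_point_free p.rep p.rep_nonzero) ∉ S) : p = q := by
  by_contra hpq
  have hp0 := hφ.base_point_free p.rep p.rep_nonzero
  obtain ⟨b, hb⟩ : ∃ b : Module.Basis (Fin 4) ℂ (Fin 4 → ℂ), b 0 = fun i => eval p.rep (φ i) := by
    obtain ⟨A, hA⟩ := SeparatingDual.exists_continuousLinearEquiv_apply_eq (R := ℂ)
      ((Pi.basisFun ℂ (Fin 4)).ne_zero 0) hp0
    exact ⟨(Pi.basisFun ℂ (Fin 4)).map A.toLinearEquiv, by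
      rw [Module.Basis.map_apply]; exact hA⟩
  have hbS : Projectivization.mk ℂ (b 0) (b.ne_zero 0) ∉ S := by
    simpa only [hb] using hS
  obtain ⟨a, ha⟩ := (Projectivization.mk_eq_mk_iff' ℂ _ _ _ _).mp h.symm
  have ha0 : a ≠ 0 := by
    rintro rfl
    rw [zero_smul] at ha
    exact hφ.base_point_free q.rep q.rep_nonzero ha.symm
  obtain ⟨τ₁, hτ₁⟩ := exists_linearIndependent_pair p.rep p.rep_nonzero
  obtain ⟨τ₂, hτ₂⟩ := exists_linearIndependent_pair q.rep q.rep_nonzero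
  obtain ⟨γ₁, hγ₁⟩ := exists_isLocalLift hτ₁ one_ne_zero (by rw [hb, one_smul]) hbS
  obtain ⟨γ₂, hγ₂⟩ := exists_isLocalLift (φ := φ) hτ₂ ha0 (by rw [hb, ha]) hbS
  refine hφ.injective _ _ _ _ b γ₁ γ₂ hγ₁ hγ₂ ?_
  rw [linearIndependent_pair_iff]
  intro h0
  refine hpq ((eval_pointForm_rep_eq_zero_iff q p).mp ?_)
  rw [eval_pointForm]
  linear_combination h0

/-- A general plane intersects the curve in `e` points, since the parametrization is injective
outside the blown up points. -/
theorem le_degree (hφ : ParametrizesStrictTransform S C.carrier e φ) {n : ℕ}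
    {H : MvPolynomial (Fin 4) ℂ} (hH : H.IsHomogeneous n) (hHC : ¬ VanishesOn H C.carrier)
    (hHS : ∀ Q ∈ S, eval Q.rep H = 0) : e ≤ C.degree := by
  classical
  obtain ⟨Q, hQ⟩ := C.infinite.nonempty
  obtain ⟨f₁, hf₁⟩ := exists_dual_apply_eq_one Q.rep_nonzero
  have hB0 : aeval φ (linForm f₁) ≠ 0 := by
    rw [Ne, hφ.aeval_eq_zero_iff (isHomogeneous_linForm f₁)]
    intro h
    have := h Q hQ
    rw [eval_linForm, hf₁] at this
    exact one_ne_zero this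
  have hB := hφ.isHomogeneous_aeval (isHomogeneous_linForm f₁)
  obtain ⟨MB, -, hMB⟩ := exists_hasZeros hB hB0
  obtain ⟨f₀, hf₀⟩ := Module.exists_dual_forall_apply_ne_zero (K := ℂ)
    (fun p : MB.toFinset => fun i => eval p.1.rep (φ i))
    fun p => hφ.base_point_free p.1.rep p.1.rep_nonzero
  have hA := hφ.isHomogeneous_aeval (isHomogeneous_linForm f₀)
  rw [mul_one] at hA hB
  obtain ⟨MZ, -, hMZ⟩ := exists_hasZeros (hφ.isHomogeneous_aeval hH)
    (fun h => hHC ((hφ.aeval_eq_zero_iff hH).mp h))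
  obtain ⟨c, M, hM, hMcard, hMnodup, hMZM⟩ := exists_simple_zeros hφ.degree_pos hA hB
    (fun τ hτ hτB hτA => by
      have h1 := (hMB.mem_iff (Projectivization.mk ℂ τ hτ)).mpr
        ((eval_rep_mk_eq_zero_iff hB τ hτ).mpr hτB)
      refine hf₀ ⟨_, Multiset.mem_toFinset.mpr h1⟩ ?_
      have h2 := (eval_rep_mk_eq_zero_iff hA τ hτ).mpr hτA
      rwa [eval_aeval_eq, eval_linForm] at h2) MZ.toFinset
  set f := f₀ + c • f₁ with hf
  have hL : aeval φ (linForm f) = aeval φ (linForm f₀) + MvPolynomial.C c * aeval φ (linForm f₁) := by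
    refine MvPolynomial.funext fun τ => ?_
    rw [map_add, map_mul, eval_C, eval_aeval_eq, eval_aeval_eq, eval_aeval_eq, eval_linForm,
      eval_linForm, eval_linForm, hf]
    rfl
  rw [← hL] at hM
  let ψ : P1 → P3 := fun p => Projectivization.mk ℂ _ (hφ.base_point_free p.rep p.rep_nonzero)
  have hψS : ∀ p ∈ M, ψ p ∉ S := by
    intro p hp hpS
    refine hMZM p hp (Multiset.mem_toFinset.mpr ((hMZ.mem_iff p).mpr ?_))
    rw [eval_aeval_eq]
    exact (eval_rep_mk_eq_zero_iff hH _ _).mp (hHS _ hpS)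
  have hcard : (M.toFinset.image ψ).card = e := by
    rw [Finset.card_image_of_injOn, Multiset.toFinset_card_of_nodup hMnodup, hMcard]
    intro p hp q _ hpq
    exact hφ.eq_of_mk_eq hpq (hψS p (Multiset.mem_toFinset.mp hp))
  have h1 := C.card_le (isHomogeneous_linForm f)
    (fun h => hM.ne_zero ((hφ.aeval_eq_zero_iff (isHomogeneous_linForm f)).mpr h))
    (M.toFinset.image ψ)
    (fun P hP => by
      obtain ⟨p, -, rfl⟩ := Finset.mem_image.mp hP
      exact hφ.mk_mem p.rep_nonzero)
    (fun P hP => by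
      obtain ⟨p, hp, rfl⟩ := Finset.mem_image.mp hP
      refine (eval_rep_mk_eq_zero_iff (isHomogeneous_linForm f) _ _).mpr ?_
      rw [← eval_aeval_eq]
      exact (hM.mem_iff p).mp (Multiset.mem_toFinset.mp hp))
  rwa [hcard, mul_one] at h1

/-- The derivative of the parametrization is tangent to the curve, so that a form that is tangent to
the curve pulls back to a binary form with a double zero. -/
theorem two_le_count [DecidableEq P1] (hφ : ParametrizesStrictTransform S C.carrier e φ) {n : ℕ}
    {G : MvPolynomial (Fin 4) ℂ} (hG : G.IsHomogeneous n) {p : P1} {P : P3}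
    (hP : P = Projectivization.mk ℂ _ (hφ.base_point_free p.rep p.rep_nonzero))
    (h0 : eval P.rep G = 0)
    (h1 : ∀ w, IsTangentVector C.carrier P.rep w → eval P.rep (dirDeriv w G) = 0)
    {M : Multiset P1} (hM : HasZeros (aeval φ G) M) : 2 ≤ M.count p := by
  subst hP
  obtain ⟨τ', hτ'⟩ := exists_linearIndependent_pair p.rep p.rep_nonzero
  set w : Fin 4 → ℂ := fun i => PowerSeries.coeff 1 (expansion p.rep τ' (φ i)) with hw
  have hcoeff : ∀ H : MvPolynomial (Fin 4) ℂ,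
      PowerSeries.coeff 1 (expansion p.rep τ' (aeval φ H)) =
        eval (fun i => eval p.rep (φ i)) (dirDeriv w H) := by
    intro H
    have hder : ∀ x : PowerSeries ℂ,
        PowerSeries.constantCoeff (PowerSeries.derivative ℂ x) = PowerSeries.coeff 1 x := by
      intro x
      rw [← PowerSeries.coeff_zero_eq_constantCoeff_apply, PowerSeries.coeff_derivative]
      simp
    rw [← hder, expansion_aeval, derivation_aeval, eval_dirDeriv, map_sum]
    refine Finset.sum_congr rfl fun i _ => ?_
    rw [map_mul, hder, constantCoeff_aeval, mul_comm]
    simp only [constantCoeff_expansion]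
    rfl
  have hwt : ∀ (k : ℕ) (H : MvPolynomial (Fin 4) ℂ), H.IsHomogeneous k →
      (eval (Projectivization.mk ℂ _ (hφ.base_point_free p.rep p.rep_nonzero)).rep
        (dirDeriv w H) = 0 ↔ PowerSeries.coeff 1 (expansion p.rep τ' (aeval φ H)) = 0) :=
    fun k H hH => by
      rw [hcoeff, eval_rep_mk_eq_zero_iff (isHomogeneous_dirDeriv hH w)]
  have h2 := (hwt n G hG).mp (h1 w fun k H hH hHC => by
    rw [hwt k H hH, (hφ.aeval_eq_zero_iff hH).mpr hHC]
    simp [expansion])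
  have h3 : PowerSeries.constantCoeff (expansion p.rep τ' (aeval φ G)) = 0 := by
    rw [constantCoeff_expansion, eval_aeval_eq]
    exact (eval_rep_mk_eq_zero_iff hG _ _).mp h0
  obtain ⟨u, hu⟩ := hM.exists_expansion_eq hτ'
  refine le_of_X_pow_dvd u.isUnit (hu ▸ PowerSeries.X_pow_dvd_iff.mpr fun m hm => ?_)
  obtain rfl | rfl : m = 0 ∨ m = 1 := by omega
  · rw [PowerSeries.coeff_zero_eq_constantCoeff_apply, h3]
  · exact h2

end ParametrizesStrictTransform

/-- There is no curve of degree three on the surface whose strict transform is a smooth rational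
curve of self-intersection `-1`. -/
theorem not_isMinusOneCurve {F : MvPolynomial (Fin 4) ℂ} (hF : F.IsHomogeneous 6)
    (hsing : ∀ P ∈ singularLocus F, IsOrdinaryTriplePoint F P) (C : IrreducibleCurve)
    (hC : C.degree = 3) : ¬ IsMinusOneCurve F C.carrier := by
  classical
  rintro ⟨hCF, e, φ, hφ, hdeg⟩
  obtain ⟨μ, s, hsum, h1, h2, hoff⟩ := hdeg.exists_contact hF hsing hCF hφ
  obtain ⟨i, hi⟩ := exists_not_vanishesOn_pderiv hF (finite_singularLocus hF hsing) C
  have he : e ≤ 3 := hC ▸ hφ.le_degree hF.pderiv hi fun Q hQ => hQ.2 i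
  refine false_of_cubic hF hsing C hC hCF (fun P hP hPS G hG hGS hGP hGw => ?_) fun G hG hGS => ?_
  · by_contra hGC
    obtain ⟨M, hMcard, hM⟩ := exists_hasZeros (hφ.isHomogeneous_aeval hG)
      (fun h => hGC ((hφ.aeval_eq_zero_iff hG).mp h))
    obtain ⟨τ, hτ, hPτ⟩ := (hφ.image P).mp hP
    set p : P1 := Projectivization.mk ℂ τ hτ with hp
    have hPp : P = Projectivization.mk ℂ _ (hφ.base_point_free p.rep p.rep_nonzero) := by
      obtain ⟨a, ha, hpa⟩ := exists_rep_mk_eq_smul τ hτ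
      rw [hPτ]
      refine (Projectivization.mk_eq_mk_iff' ℂ _ _ _ _).mpr ⟨(a ^ e)⁻¹, funext fun k => ?_⟩
      rw [Pi.smul_apply, smul_eq_mul, hp, hpa, eval_smul_of_isHomogeneous (hφ.homogeneous k),
        inv_mul_cancel_left₀ (pow_ne_zero e ha)]
    have hcount := hφ.two_le_count hG hPp hGP hGw hM
    have hμp : μ p = 0 := hoff p (hPp ▸ hPS)
    have h3 := sum_le_card_of_le_count (insert p s) (μ := fun q => 2 * μ q + if q = p then 2 else 0)
      (M := M) fun q => by
        by_cases hq : q = p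
        · rw [hq, hμp, if_pos rfl]
          omega
        · rw [if_neg hq, add_zero]
          exact h2 5 G M hG hGS hM q
    have h4 : ∑ q ∈ insert p s, μ q = ∑ q ∈ s, μ q :=
      Finset.sum_insert_of_eq_zero_if_notMem fun _ => hμp
    -- now `2 (2 e + 1) + 2 ≤ 5 e`, which is false for `e ≤ 3`
    rw [Finset.sum_add_distrib, ← Finset.mul_sum, h4, hsum, hMcard, Finset.sum_ite_eq',
      if_pos (Finset.mem_insert_self p s)] at h3
    omega
  · by_contra hGC
    obtain ⟨M, hMcard, hM⟩ := exists_hasZeros (hφ.isHomogeneous_aeval hG)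
      (fun h => hGC ((hφ.aeval_eq_zero_iff hG).mp h))
    -- there would be `2 e + 1` zeros of a binary form of degree `2 e`
    have h3 := sum_le_card_of_le_count s (h1 2 G M hG hGS hM)
    rw [hsum, hMcard] at h3
    omega

end TripleSextic

end

theorem mainTheorem12 (F : MvPolynomial (Fin 4) ℂ) (hF0 : F ≠ 0) (hF : F.IsHomogeneous 6)
    (hsing : ∀ P ∈ TripleSextic.singularLocus F, TripleSextic.IsOrdinaryTriplePoint F P) :
    (∀ D : TripleSextic.Curve, D.degree = 3 → D.support ⊆ TripleSextic.surface F →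
      {P : TripleSextic.P3 | TripleSextic.IsOrdinaryTriplePoint F P ∧ P ∈ D.support}.encard ≤ 6) ∧
    ¬ ∃ C : TripleSextic.IrreducibleCurve,
      C.degree = 3 ∧ TripleSextic.IsMinusOneCurve F C.carrier := by
  refine ⟨fun D hD hDF => TripleSextic.encard_triple_le_six hF hsing D hD hDF, ?_⟩
  rintro ⟨C, hC, hCm⟩
  exact TripleSextic.not_isMinusOneCurve hF hsing C hC hCm
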